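/- Let $\Bbbk$ be a field with $\operatorname{char}\Bbbk\neq 2$ and $n\ge 0$ an integer. Let $\alpha,\beta_i,\gamma_i,\lambda_{ij}\in\Bbbk$ ($1\le i\le n$, resp. $1\le i<j\le n$), and let $Cl(\alpha,\beta_i,\gamma_i,\lambda_{ij})$ be the (Clifford) $\Bbbk$-algebra with generators $G=X_0,X_1,\dots,X_n$ and relations $G^2=\alpha$, $X_i^2=\beta_i$, $GX_i+X_iG=\gamma_i$, $X_iX_j+X_jX_i=\lambda_{ij}$ ($i<j$). For $R=\{i_1<\dots<i_s\}\subseteq\{0,1,\dots,n\}$ write $X_R=X_{i_1}\cdots X_{i_s}$. Let $E(n)=Cl(1,0,0,0)$ as an algebra, with generators denoted $g,x_1,\dots,x_n$ and monomials $x_P$ ($P\subseteq\{1,\dots,n\}$); it is a Hopf algebra with $\Delta(g)=g\otimes g$, $\Delta(x_i)=x_i\otimes g+1\otimes x_i$, $\varepsilon(g)=1$, $\varepsilon(x_i)=0$, $S(g)=g$, $S(x_i)=gx_i$. The algebra $A=Cl(\alpha,\beta_i,\gamma_i,\lambda_{ij})$ is a right $E(n)$-comodule algebra through the algebra map $\rho$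 with $\rho(G)=G\otimes g$, $\rho(X_i)=X_i\otimes g+1\otimes x_i$ (the canonical coaction). Put $H=E(n)$. Consider the cowreath $(A\otimes H^{op},H,\psi)$, i.e. the coalgebra $H$ in the monoidal category of (right) transfer morphisms through the algebra $A\otimes H^{op}$, with $\psi(h\otimes a\otimes l)=a_{0}\otimes l_{1}\otimes l_{2}ha_{1}$, comultiplication $h\mapsto 1_A\otimes 1_H\otimes h_1\otimes h_2$ and counit $h\mapsto\varepsilon(h)1_A\otimes 1_H$. It is called *rt-separable* if there is a linear map $B^A:H\otimes H\to A$ such that $B:h\otimes h'\mapsto B^A(h\otimes h')\otimes 1_H$ is a normalized Casimir morphism of this coalgebra (a morphism $B:H\otimes H\to 1$ in that category with $(\mathrm{Id}\otimes B)(\Delta\otimes \mathrm{Id})=(B\otimes \mathrm{Id})(\mathrm{Id}\otimes\Delta)$ and $B\Delta=\varepsilon$); explicitly, if for all $a\in A$, $h,h',h''\in H$ $$a_0B^A(ha_1\otimes h'a_2)=B^A(h\otimes h')a,\qquad B^A(1\otimes h)_0\otimes B^A(1\otimes h)_1=B^A(1\otimes h_1)\otimes h_2,$$ $$B^A(h_1h'\otimes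 h_2h'')=\varepsilon(h)B^A(h'\otimes h''),\qquad B^A(1\otimes 1)=1.$$ **(a)** The cowreath $(A\otimes H^{op},H,\psi)$ is rt-separable if and only if 1. all of $\alpha,\beta_i,\gamma_i,\lambda_{ij}$ are $0$ (that is, $A=Cl(0,0,0,0)$), or 2. $\alpha\ne0$, $\beta_i=\frac{\gamma_i^2}{4\alpha}$ for all $i$ and $\lambda_{ij}=\frac{\gamma_i\gamma_j}{2\alpha}$ for all $i<j$. **Notation for (b).** For a finite set $P=\{i_1<\dots<i_s\}$ of integers and $F=\{i_{j_1},\dots,i_{j_r}\}\subseteq P$ with $|F|=r$, put $S(F,P)=(j_1+\dots+j_r)-\frac{r(r+1)}2$. For $Q\subseteq\{1,\dots,n\}$ put $\overline Q=Q\sqcup\{0\}$. For a finite set $T$ of integers, $\pi_2(T)$ is the set of perfect matchings of $T$, i.e. partitions of $T$ into blocks with two elements ($\pi_2(\emptyset)=\{\emptyset\}$). The sign $\mathrm{sgn}(\mathcal P)$ of $\mathcal P\in\pi_2(T)$ is the sign of the permutation of $T$ which sends the $i$-th smallest element of $T$ to the $i$-th entry of the list obtained by writing each block in increasing order and ordering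 the blocks by their largest elements. With $\lambda_{0j}=\gamma_j$, put $\Lambda(\mathcal P)=\prod_{\{i<j\}\in\mathcal P}\lambda_{ij}$. **(b)** A linear map $B^A:H\otimes H\to A$ makes $B^A\otimes 1_H$ a normalized Casimir morphism as above if and only if 1. or 2. holds and there are $\mu\in\Bbbk$ and $\eta_S\in\Bbbk$ ($S\subseteq\{1,\dots,n\}$) such that, for $j,l\in\{0,1\}$ and all $P,Q\subseteq\{1,\dots,n\}$, $$B^A(g^jx_P\otimes g^lx_Q)=B^A(1\otimes S(g^jx_P)g^lx_Q),\qquad B^A(1\otimes1)=1,$$ $$B^A(1\otimes x_Q)=\sum_{\substack{R\subseteq\overline Q\\|R|\equiv|Q|\ (2)}}(-1)^{S(Q\setminus R,Q)}\,\eta_{Q\setminus R}\,X_R,$$ $$B^A(1\otimes gx_Q)=\frac{\mu}{2^{\lfloor|\overline Q|/2\rfloor}}\sum_{\substack{R\subseteq\overline Q\\|R|\equiv|\overline Q|\ (2)}}(-1)^{S(R,\overline Q)+\frac{|\overline Q|-|R|}2}\,2^{\lfloor|R|/2\rfloor}\sum_{\mathcal P\in\pi_2(\overline Q\setminus R)}\mathrm{sgn}(\mathcal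 P)\Lambda(\mathcal P)\,X_R,$$ and, if $\alpha\neq0$, for every $T\subseteq\{1,\dots,n\}$ with $|T|$ odd $$\eta_T=\sum_{i\in T}(-1)^{S(\{i\},T)+1}\,\eta_{T\setminus\{i\}}\,\frac{\gamma_i}{2\alpha}.$$ **(c)** These parameters are otherwise free: if 1. or 2. holds, then for every $\mu$ and every family $(\eta_S)$ with $\eta_\emptyset=1$ that satisfies the last condition, there is exactly one such $B^A$ that is given by the formulas in (b). -/

import Mathlib

open scoped TensorProduct

noncomputable section

/-- `m ⊗ Id_M : R ⊗ R ⊗ M → R ⊗ M`, where `m` is the multiplication of `R`. -/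
def mulTensor (k R M : Type*) [Field k] [Ring R] [Algebra k R] [AddCommGroup M] [Module k M] :
    R ⊗[k] (R ⊗[k] M) →ₗ[k] R ⊗[k] M :=
  (LinearMap.mul' k R).rTensor M ∘ₗ (TensorProduct.assoc k R R M).symm.toLinearMap

@[simp]
theorem mulTensor_tmul {k R M : Type*} [Field k] [Ring R] [Algebra k R] [AddCommGroup M]
    [Module k M] (r s : R) (m : M) :
    mulTensor k R M (r ⊗ₜ[k] (s ⊗ₜ[k] m)) = (r * s) ⊗ₜ[k] m := by
  simp [mulTensor]

/-- For `ψ : X ⊗ R → R ⊗ X`, the map `(ψ ⊗ Id_X) (Id_X ⊗ ψ) : X ⊗ X ⊗ R → R ⊗ X ⊗ X`. -/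
def transferSq {k R X : Type*} [Field k] [Ring R] [Algebra k R] [AddCommGroup X] [Module k X]
    (ψ : X ⊗[k] R →ₗ[k] R ⊗[k] X) : (X ⊗[k] X) ⊗[k] R →ₗ[k] R ⊗[k] (X ⊗[k] X) :=
  (TensorProduct.assoc k R X X).toLinearMap ∘ₗ ψ.rTensor X ∘ₗ
    (TensorProduct.assoc k X R X).symm.toLinearMap ∘ₗ ψ.lTensor X ∘ₗ
    (TensorProduct.assoc k X X R).toLinearMap

/-- A cowreath `(R, X, ψ)` in the monoidal category of `k`-vector spaces, that is, a coalgebra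
`(X, ψ)` in the monoidal category of right transfer morphisms through the algebra `R`. -/
structure Cowreath (k R X : Type*) [Field k] [Ring R] [Algebra k R] [AddCommGroup X]
    [Module k X] where
  /-- the entwining map -/
  ψ : X ⊗[k] R →ₗ[k] R ⊗[k] X
  /-- the comultiplication -/
  δ : X →ₗ[k] R ⊗[k] (X ⊗[k] X)
  /-- the counit -/
  ε : X →ₗ[k] R
  ψ_mul : ψ ∘ₗ (LinearMap.mul' k R).lTensor X ∘ₗ (TensorProduct.assoc k X R R).toLinearMap =
    mulTensor k R X ∘ₗ ψ.lTensor R ∘ₗ (TensorProduct.assoc k R X R).toLinearMap ∘ₗ ψ.rTensor R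
  ψ_one : ∀ x : X, ψ (x ⊗ₜ[k] 1) = 1 ⊗ₜ[k] x
  δ_hom : mulTensor k R (X ⊗[k] X) ∘ₗ (transferSq ψ).lTensor R ∘ₗ
      (TensorProduct.assoc k R (X ⊗[k] X) R).toLinearMap ∘ₗ δ.rTensor R =
    mulTensor k R (X ⊗[k] X) ∘ₗ δ.lTensor R ∘ₗ ψ
  coassoc : (TensorProduct.assoc k X X X).toLinearMap.lTensor R ∘ₗ
      mulTensor k R ((X ⊗[k] X) ⊗[k] X) ∘ₗ
      (TensorProduct.assoc k R (X ⊗[k] X) X).toLinearMap.lTensor R ∘ₗ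
      (δ.rTensor X).lTensor R ∘ₗ δ =
    mulTensor k R (X ⊗[k] (X ⊗[k] X)) ∘ₗ
      (TensorProduct.assoc k R X (X ⊗[k] X)).toLinearMap.lTensor R ∘ₗ
      (ψ.rTensor (X ⊗[k] X)).lTensor R ∘ₗ
      (TensorProduct.assoc k X R (X ⊗[k] X)).symm.toLinearMap.lTensor R ∘ₗ
      (δ.lTensor X).lTensor R ∘ₗ δ
  ε_hom : LinearMap.mul' k R ∘ₗ ε.lTensor R ∘ₗ ψ = LinearMap.mul' k R ∘ₗ ε.rTensor R
  counit_left : mulTensor k R X ∘ₗ (ε.rTensor X).lTensor R ∘ₗ δ = TensorProduct.mk k R X 1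
  counit_right : mulTensor k R X ∘ₗ ψ.lTensor R ∘ₗ (ε.lTensor X).lTensor R ∘ₗ δ =
    TensorProduct.mk k R X 1

/-- `B : X ⊗ X → R` is a normalized Casimir morphism for the coalgebra `(X, ψ)` in the category of
right transfer morphisms through `R`: it is a morphism `X ⊛ X → 1` in that category,
`(Id_X ⊛ B) ⊙ (δ ⊛ Id_X) = (B ⊛ Id_X) ⊙ (Id_X ⊛ δ)`, and `B ⊙ δ = ε`. -/
structure Cowreath.IsNormalizedCasimir {k R X : Type*} [Field k] [Ring R] [Algebra k R]
    [AddCommGroup X] [Module k X] (C : Cowreath k R X) (B : X ⊗[k] X →ₗ[k] R) : Prop where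
  hom : LinearMap.mul' k R ∘ₗ B.lTensor R ∘ₗ transferSq C.ψ = LinearMap.mul' k R ∘ₗ B.rTensor R
  casimir : mulTensor k R X ∘ₗ C.ψ.lTensor R ∘ₗ (B.lTensor X).lTensor R ∘ₗ
      (TensorProduct.assoc k X X X).toLinearMap.lTensor R ∘ₗ
      (TensorProduct.assoc k R (X ⊗[k] X) X).toLinearMap ∘ₗ C.δ.rTensor X =
    mulTensor k R X ∘ₗ (B.rTensor X).lTensor R ∘ₗ
      (TensorProduct.assoc k X X X).symm.toLinearMap.lTensor R ∘ₗ
      (TensorProduct.assoc k R X (X ⊗[k] X)).toLinearMap ∘ₗ C.ψ.rTensor (X ⊗[k] X) ∘ₗ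
      (TensorProduct.assoc k X R (X ⊗[k] X)).symm.toLinearMap ∘ₗ C.δ.lTensor X
  normalized : LinearMap.mul' k R ∘ₗ B.lTensor R ∘ₗ C.δ = C.ε

/-- A right `H`-comodule algebra structure on the algebra `A`. -/
structure ComoduleAlgebra (k H A : Type*) [Field k] [Ring H] [HopfAlgebra k H] [Ring A]
    [Algebra k A] where
  /-- the coaction -/
  ρ : A →ₐ[k] A ⊗[k] H
  coassoc : (TensorProduct.assoc k A H H).toLinearMap ∘ₗ ρ.toLinearMap.rTensor H ∘ₗ
    ρ.toLinearMap = (Coalgebra.comul (R := k) (A := H)).lTensor A ∘ₗ ρ.toLinearMap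
  counit : (Coalgebra.counit (R := k) (A := H)).lTensor A ∘ₗ ρ.toLinearMap =
    (TensorProduct.mk k A k).flip 1


namespace ComoduleAlgebra

section
variable {k H A : Type*} [Field k] [Ring H] [HopfAlgebra k H] [Ring A] [Algebra k A]

/-- `h ⊗ (a ⊗ x) ⊗ (l ⊗ y) ↦ a ⊗ l ⊗ y h x`. -/
def psiAux (k H K A : Type*) [Field k] [Ring H] [Algebra k H] [Ring K] [Algebra k K] [Ring A]
    [Algebra k A] : K ⊗[k] ((A ⊗[k] K) ⊗[k] (H ⊗[k] K)) →ₗ[k] (A ⊗[k] Hᵐᵒᵖ) ⊗[k] K :=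
  TensorProduct.map ((MulOpposite.opLinearEquiv k).toLinearMap.lTensor A)
    (LinearMap.mul' k K ∘ₗ (TensorProduct.comm k K K).toLinearMap ∘ₗ
      (LinearMap.mul' k K).rTensor K ∘ₗ (TensorProduct.assoc k K K K).symm.toLinearMap) ∘ₗ
  (TensorProduct.leftComm k K (A ⊗[k] H) (K ⊗[k] K)).toLinearMap ∘ₗ
  (TensorProduct.tensorTensorTensorComm k A K H K).toLinearMap.lTensor K

@[simp]
theorem psiAux_tmul {K : Type*} [Ring K] [Algebra k K] (h x y : K) (l : H) (a : A) :
    psiAux k H K A (h ⊗ₜ[k] ((a ⊗ₜ[k] x) ⊗ₜ[k] (l ⊗ₜ[k] y))) =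
      (a ⊗ₜ[k] MulOpposite.op l) ⊗ₜ[k] (y * (h * x)) := by
  simp [psiAux]

/-- The entwining map `ψ (h ⊗ a ⊗ l) = a₀ ⊗ l₁ ⊗ l₂ h a₁`. -/
def psi (M : ComoduleAlgebra k H A) : H ⊗[k] (A ⊗[k] Hᵐᵒᵖ) →ₗ[k] (A ⊗[k] Hᵐᵒᵖ) ⊗[k] H :=
  psiAux k H H A ∘ₗ (TensorProduct.map M.ρ.toLinearMap
    (Coalgebra.comul (R := k) ∘ₗ (MulOpposite.opLinearEquiv k).symm.toLinearMap)).lTensor H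

theorem psi_tmul (M : ComoduleAlgebra k H A) (h : H) (a : A) (l : Hᵐᵒᵖ) :
    M.psi (h ⊗ₜ[k] (a ⊗ₜ[k] l)) =
      psiAux k H H A (h ⊗ₜ[k] (M.ρ a ⊗ₜ[k] Coalgebra.comul (R := k) l.unop)) := by
  simp [psi]

theorem psi_tmul_one (M : ComoduleAlgebra k H A) (h : H) :
    M.psi (h ⊗ₜ[k] 1) = 1 ⊗ₜ[k] h := by
  rw [Algebra.TensorProduct.one_def, psi_tmul]
  simp [Algebra.TensorProduct.one_def]

theorem psi_mul (M : ComoduleAlgebra k H A) :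
    M.psi ∘ₗ (LinearMap.mul' k (A ⊗[k] Hᵐᵒᵖ)).lTensor H ∘ₗ
        (TensorProduct.assoc k H (A ⊗[k] Hᵐᵒᵖ) (A ⊗[k] Hᵐᵒᵖ)).toLinearMap =
      mulTensor k (A ⊗[k] Hᵐᵒᵖ) H ∘ₗ M.psi.lTensor (A ⊗[k] Hᵐᵒᵖ) ∘ₗ
        (TensorProduct.assoc k (A ⊗[k] Hᵐᵒᵖ) H (A ⊗[k] Hᵐᵒᵖ)).toLinearMap ∘ₗ
        M.psi.rTensor (A ⊗[k] Hᵐᵒᵖ) := by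
  ext h a l b l'
  simp only [TensorProduct.AlgebraTensorModule.curry_apply, TensorProduct.curry_apply,
    LinearMap.coe_comp, Function.comp_apply, LinearMap.coe_restrictScalars,
    LinearEquiv.coe_coe, TensorProduct.assoc_tmul, LinearMap.lTensor_tmul, LinearMap.mul'_apply,
    LinearMap.rTensor_tmul, Algebra.TensorProduct.tmul_mul_tmul, psi_tmul, map_mul,
    MulOpposite.unop_mul, Bialgebra.comul_mul]
  generalize M.ρ a = u
  generalize Coalgebra.comul (R := k) l.unop = s
  induction u with
  | zero => simp
  | add u v hu hv => simp only [add_mul, TensorProduct.add_tmul, TensorProduct.tmul_add, map_add, hu, hv]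
  | tmul a x =>
  induction s with
  | zero => simp
  | add u v hu hv => simp only [mul_add, TensorProduct.add_tmul, TensorProduct.tmul_add, map_add, hu, hv]
  | tmul l y =>
  simp only [psiAux_tmul, TensorProduct.assoc_tmul, LinearMap.lTensor_tmul, psi_tmul]
  generalize M.ρ b = u
  generalize Coalgebra.comul (R := k) l'.unop = s
  induction u with
  | zero => simp
  | add u v hu hv => simp only [mul_add, TensorProduct.add_tmul, TensorProduct.tmul_add, map_add, hu, hv]
  | tmul b x' =>
  induction s with
  | zero => simp
  | add u v hu hv => simp only [add_mul, TensorProduct.tmul_add, map_add, hu, hv]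
  | tmul l' y' => simp [mul_assoc]

theorem transferSq_psi (M : ComoduleAlgebra k H A) (z : H ⊗[k] H) (a : A) (l : Hᵐᵒᵖ) :
    transferSq M.psi (z ⊗ₜ[k] (a ⊗ₜ[k] l)) =
      psiAux k H (H ⊗[k] H) A (z ⊗ₜ[k]
        ((Coalgebra.comul (R := k) (A := H)).lTensor A (M.ρ a) ⊗ₜ[k]
          (Coalgebra.comul (R := k) (A := H)).lTensor H (Coalgebra.comul (R := k) l.unop))) := by
  rw [← Coalgebra.coassoc_apply, ← AlgHom.toLinearMap_apply, ← LinearMap.comp_apply,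
    ← M.coassoc]
  induction z with
  | zero => simp
  | add u v hu hv => simp only [TensorProduct.add_tmul, map_add, hu, hv]
  | tmul h h' =>
  simp only [transferSq, LinearMap.coe_comp, Function.comp_apply, LinearEquiv.coe_coe,
    TensorProduct.assoc_tmul, LinearMap.lTensor_tmul, psi_tmul, AlgHom.toLinearMap_apply]
  generalize M.ρ a = u
  generalize Coalgebra.comul (R := k) l.unop = s
  induction u with
  | zero => simp
  | add u v hu hv => simp only [TensorProduct.add_tmul, TensorProduct.tmul_add, map_add, hu, hv]
  | tmul a x =>
  induction s with
  | zero => simp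
  | add u v hu hv => simp only [TensorProduct.tmul_add, map_add, hu, hv]
  | tmul l y =>
  simp only [psiAux_tmul, TensorProduct.assoc_symm_tmul, LinearMap.rTensor_tmul, psi_tmul,
    AlgHom.toLinearMap_apply, MulOpposite.unop_op]
  generalize M.ρ a = u
  generalize Coalgebra.comul (R := k) l = s
  induction u with
  | zero => simp
  | add u v hu hv => simp only [TensorProduct.add_tmul, TensorProduct.tmul_add, map_add, hu, hv]
  | tmul a x =>
  induction s with
  | zero => simp
  | add u v hu hv => simp only [TensorProduct.add_tmul, TensorProduct.tmul_add, map_add, hu, hv]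
  | tmul l y => simp

theorem one_tmul_comul_coassoc {R : Type*} [Ring R] [Algebra k R] (ψ : H ⊗[k] R →ₗ[k] R ⊗[k] H)
    (hψ : ∀ x : H, ψ (x ⊗ₜ[k] 1) = 1 ⊗ₜ[k] x) (δ : H →ₗ[k] R ⊗[k] (H ⊗[k] H))
    (hδ : δ = TensorProduct.mk k R (H ⊗[k] H) 1 ∘ₗ Coalgebra.comul) :
    (TensorProduct.assoc k H H H).toLinearMap.lTensor R ∘ₗ
      mulTensor k R ((H ⊗[k] H) ⊗[k] H) ∘ₗ
      (TensorProduct.assoc k R (H ⊗[k] H) H).toLinearMap.lTensor R ∘ₗ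
      (δ.rTensor H).lTensor R ∘ₗ δ =
    mulTensor k R (H ⊗[k] (H ⊗[k] H)) ∘ₗ
      (TensorProduct.assoc k R H (H ⊗[k] H)).toLinearMap.lTensor R ∘ₗ
      (ψ.rTensor (H ⊗[k] H)).lTensor R ∘ₗ
      (TensorProduct.assoc k H R (H ⊗[k] H)).symm.toLinearMap.lTensor R ∘ₗ
      (δ.lTensor H).lTensor R ∘ₗ δ := by
  subst hδ
  ext h
  have := Coalgebra.coassoc_apply (R := k) h
  simp only [LinearMap.coe_comp, Function.comp_apply, LinearEquiv.coe_coe,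
    LinearMap.lTensor_tmul, TensorProduct.mk_apply]
  trans (1 : R) ⊗ₜ[k] (TensorProduct.assoc k H H H)
    ((Coalgebra.comul (R := k)).rTensor H (Coalgebra.comul (R := k) h))
  · generalize Coalgebra.comul (R := k) h = s
    induction s with
    | zero => simp
    | add u v hu hv => simp only [TensorProduct.tmul_add, map_add, hu, hv]
    | tmul l y => simp
  · rw [this]
    generalize Coalgebra.comul (R := k) h = s
    induction s with
    | zero => simp
    | add u v hu hv => simp only [TensorProduct.tmul_add, map_add, hu, hv]
    | tmul l y => simp [hψ]

/-- The cowreath `(A ⊗ Hᵒᵖ, H, ψ)` attached to a right `H`-comodule algebra `A`, with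
`δ h = 1 ⊗ 1 ⊗ h₁ ⊗ h₂` and `ε h = ε(h) 1 ⊗ 1`. -/
def cowreath (M : ComoduleAlgebra k H A) : Cowreath k (A ⊗[k] Hᵐᵒᵖ) H where
  ψ := M.psi
  δ := TensorProduct.mk k (A ⊗[k] Hᵐᵒᵖ) (H ⊗[k] H) 1 ∘ₗ Coalgebra.comul
  ε := Algebra.linearMap k (A ⊗[k] Hᵐᵒᵖ) ∘ₗ Coalgebra.counit
  ψ_mul := M.psi_mul
  ψ_one := M.psi_tmul_one
  δ_hom := by
    ext h a l
    simp only [TensorProduct.AlgebraTensorModule.curry_apply, TensorProduct.curry_apply,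
      LinearMap.coe_comp, Function.comp_apply, LinearMap.coe_restrictScalars,
      LinearEquiv.coe_coe, TensorProduct.assoc_tmul, LinearMap.lTensor_tmul,
      LinearMap.rTensor_tmul, psi_tmul, TensorProduct.mk_apply, transferSq_psi]
    generalize M.ρ a = u
    generalize Coalgebra.comul (R := k) l.unop = s
    induction u with
    | zero => simp
    | add u v hu hv => simp only [TensorProduct.add_tmul, TensorProduct.tmul_add, map_add, hu, hv]
    | tmul a x =>
    induction s with
    | zero => simp
    | add u v hu hv => simp only [TensorProduct.tmul_add, map_add, hu, hv]
    | tmul l y => simp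
  coassoc := one_tmul_comul_coassoc M.psi M.psi_tmul_one _ rfl
  ε_hom := by
    ext h a l
    have h1 := LinearMap.congr_fun M.counit a
    have h2 := Coalgebra.lTensor_counit_comul (R := k) l.unop
    simp only [LinearMap.coe_comp, Function.comp_apply, AlgHom.toLinearMap_apply,
      LinearMap.flip_apply, TensorProduct.mk_apply] at h1
    simp only [TensorProduct.AlgebraTensorModule.curry_apply, TensorProduct.curry_apply,
      LinearMap.coe_comp, Function.comp_apply, LinearMap.coe_restrictScalars,
      LinearMap.rTensor_tmul, psi_tmul]
    trans Coalgebra.counit (R := k) h • TensorProduct.map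
      (TensorProduct.rid k A).toLinearMap ((MulOpposite.opLinearEquiv k).toLinearMap ∘ₗ
      (TensorProduct.rid k H).toLinearMap)
      ((Coalgebra.counit (R := k) (A := H)).lTensor A (M.ρ a) ⊗ₜ[k]
      (Coalgebra.counit (R := k) (A := H)).lTensor H (Coalgebra.comul (R := k) l.unop))
    · generalize M.ρ a = u
      generalize Coalgebra.comul (R := k) l.unop = s
      induction u with
      | zero => simp
      | add u v hu hv =>
        simp only [TensorProduct.add_tmul, TensorProduct.tmul_add, map_add, hu, hv, smul_add]
      | tmul a x =>
      induction s with
      | zero => simp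
      | add u v hu hv => simp only [TensorProduct.tmul_add, map_add, hu, hv, smul_add]
      | tmul l y =>
        simp [Algebra.algebraMap_eq_smul_one, TensorProduct.smul_tmul', smul_smul]
        ring_nf
    · rw [h1, h2]
      simp [Algebra.algebraMap_eq_smul_one]
  counit_left := by
    ext h
    have := Coalgebra.rTensor_counit_comul (R := k) h
    simp only [LinearMap.coe_comp, Function.comp_apply, LinearMap.lTensor_tmul,
      TensorProduct.mk_apply]
    trans (1 : A ⊗[k] Hᵐᵒᵖ) ⊗ₜ[k] (TensorProduct.lid k H)
      ((Coalgebra.counit (R := k)).rTensor H (Coalgebra.comul (R := k) h))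
    · generalize Coalgebra.comul (R := k) h = s
      induction s with
      | zero => simp
      | add u v hu hv => simp only [TensorProduct.tmul_add, map_add, hu, hv]
      | tmul l y => simp [Algebra.algebraMap_eq_smul_one, TensorProduct.smul_tmul]
    · rw [this]; simp
  counit_right := by
    ext h
    have := Coalgebra.lTensor_counit_comul (R := k) h
    simp only [LinearMap.coe_comp, Function.comp_apply, LinearMap.lTensor_tmul,
      TensorProduct.mk_apply]
    trans (1 : A ⊗[k] Hᵐᵒᵖ) ⊗ₜ[k] (TensorProduct.rid k H)
      ((Coalgebra.counit (R := k)).lTensor H (Coalgebra.comul (R := k) h))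
    · generalize Coalgebra.comul (R := k) h = s
      induction s with
      | zero => simp
      | add u v hu hv => simp only [TensorProduct.tmul_add, map_add, hu, hv]
      | tmul l y => simp [Algebra.algebraMap_eq_smul_one, psi_tmul_one]
    · rw [this]; simp


/-- `h ⊗ h' ↦ B^A(h ⊗ h') ⊗ 1_H`. -/
def rtExtend (BA : H ⊗[k] H →ₗ[k] A) : H ⊗[k] H →ₗ[k] A ⊗[k] Hᵐᵒᵖ :=
  (TensorProduct.mk k A Hᵐᵒᵖ).flip 1 ∘ₗ BA

/-- The cowreath `(A ⊗ Hᵒᵖ, H, ψ)` is right-trivially separable via `B^A`: the map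
`h ⊗ h' ↦ B^A(h ⊗ h') ⊗ 1_H` is a normalized Casimir morphism. -/
def IsRtCasimir (M : ComoduleAlgebra k H A) (BA : H ⊗[k] H →ₗ[k] A) : Prop :=
  M.cowreath.IsNormalizedCasimir (rtExtend BA)

/-- The cowreath `(A ⊗ Hᵒᵖ, H, ψ)` is right-trivially separable. -/
def IsRtSeparable (M : ComoduleAlgebra k H A) : Prop :=
  ∃ BA : H ⊗[k] H →ₗ[k] A, M.IsRtCasimir BA

/-- `(1 ⊗ h₁) Δ(S(h₂)) = S(h) ⊗ 1`. -/
theorem one_tmul_mul_comul_antipode (h : H) :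
    LinearMap.mul' k (H ⊗[k] H) (TensorProduct.map (TensorProduct.mk k H H 1)
      (Coalgebra.comul ∘ₗ HopfAlgebra.antipode k) (Coalgebra.comul (R := k) h)) =
      HopfAlgebra.antipode k h ⊗ₜ[k] 1 := by
  have hA : ∀ x : H, (1 : H) ⊗ₜ[k] x = LinearMap.mul' k (H ⊗[k] H) (TensorProduct.map
      ((TensorProduct.mk k H H).flip 1 ∘ₗ HopfAlgebra.antipode k) Coalgebra.comul
      (Coalgebra.comul (R := k) x)) := by
    intro x
    trans (LinearMap.mul' k H ∘ₗ (HopfAlgebra.antipode k).rTensor H).rTensor H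
      ((TensorProduct.assoc k H H H).symm
        ((Coalgebra.comul (R := k)).lTensor H (Coalgebra.comul (R := k) x)))
    · rw [Coalgebra.coassoc_symm_apply, ← LinearMap.comp_apply, ← LinearMap.rTensor_comp]
      have : LinearMap.mul' k H ∘ₗ (HopfAlgebra.antipode k).rTensor H ∘ₗ Coalgebra.comul =
        Algebra.linearMap k H ∘ₗ Coalgebra.counit := HopfAlgebra.mul_antipode_rTensor_comul
      rw [LinearMap.comp_assoc, this, LinearMap.rTensor_comp, LinearMap.comp_apply,
        Coalgebra.rTensor_counit_comul]
      simp
    · generalize Coalgebra.comul (R := k) x = s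
      induction s with
      | zero => simp
      | add u v hu hv => simp only [map_add, hu, hv]
      | tmul l y =>
        simp only [LinearMap.lTensor_tmul, TensorProduct.map_tmul]
        generalize Coalgebra.comul (R := k) y = s
        induction s with
        | zero => simp
        | add u v hu hv => simp only [TensorProduct.tmul_add, map_add, hu, hv]
        | tmul l y => simp
  have key : LinearMap.mul' k (H ⊗[k] H) ∘ₗ (LinearMap.mul' k (H ⊗[k] H) ∘ₗ
      TensorProduct.map ((TensorProduct.mk k H H).flip 1 ∘ₗ HopfAlgebra.antipode k)
        Coalgebra.comul).rTensor (H ⊗[k] H) ∘ₗ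
      (Coalgebra.comul ∘ₗ HopfAlgebra.antipode k).lTensor (H ⊗[k] H) =
    LinearMap.mul' k (H ⊗[k] H) ∘ₗ
      TensorProduct.map ((TensorProduct.mk k H H).flip 1 ∘ₗ HopfAlgebra.antipode k)
        (Coalgebra.comul ∘ₗ LinearMap.mul' k H ∘ₗ (HopfAlgebra.antipode k).lTensor H) ∘ₗ
      (TensorProduct.assoc k H H H).toLinearMap := by
    ext x y z
    simp [mul_assoc]
  trans LinearMap.mul' k (H ⊗[k] H) ((LinearMap.mul' k (H ⊗[k] H) ∘ₗ
      TensorProduct.map ((TensorProduct.mk k H H).flip 1 ∘ₗ HopfAlgebra.antipode k)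
        Coalgebra.comul).rTensor (H ⊗[k] H)
      ((Coalgebra.comul ∘ₗ HopfAlgebra.antipode k).lTensor (H ⊗[k] H)
      ((Coalgebra.comul (R := k)).rTensor H (Coalgebra.comul (R := k) h))))
  · generalize Coalgebra.comul (R := k) h = s
    induction s with
    | zero => simp
    | add u v hu hv => simp only [map_add, hu, hv]
    | tmul x y =>
      simp only [TensorProduct.map_tmul, TensorProduct.mk_apply, hA x, LinearMap.rTensor_tmul,
        LinearMap.lTensor_tmul, LinearMap.comp_apply]
  · have := LinearMap.congr_fun key
      ((Coalgebra.comul (R := k)).rTensor H (Coalgebra.comul (R := k) h))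
    simp only [LinearMap.comp_apply, LinearEquiv.coe_coe, Coalgebra.coassoc_apply] at this
    refine (this.trans ?_)
    have h2 : TensorProduct.map ((TensorProduct.mk k H H).flip 1 ∘ₗ HopfAlgebra.antipode k)
        (Coalgebra.comul ∘ₗ LinearMap.mul' k H ∘ₗ (HopfAlgebra.antipode k).lTensor H)
        ((Coalgebra.comul (R := k)).lTensor H (Coalgebra.comul (R := k) h)) =
      TensorProduct.map ((TensorProduct.mk k H H).flip 1 ∘ₗ HopfAlgebra.antipode k)
        (Coalgebra.comul ∘ₗ Algebra.linearMap k H)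
        ((Coalgebra.counit (R := k)).lTensor H (Coalgebra.comul (R := k) h)) := by
      generalize Coalgebra.comul (R := k) h = s
      induction s with
      | zero => simp
      | add u v hu hv => simp only [map_add, hu, hv]
      | tmul x y =>
        simp only [TensorProduct.map_tmul, LinearMap.lTensor_tmul, LinearMap.comp_apply,
          HopfAlgebra.mul_antipode_lTensor_comul_apply, Algebra.linearMap_apply]
    rw [h2, Coalgebra.lTensor_counit_comul]
    simp

/-- `Δ(x₁) (1 ⊗ S(x₂)) = x ⊗ 1`. -/
theorem comul_mul_one_tmul_antipode (x : H) :
    LinearMap.mul' k (H ⊗[k] H) (TensorProduct.map Coalgebra.comul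
      (TensorProduct.mk k H H 1 ∘ₗ HopfAlgebra.antipode k) (Coalgebra.comul (R := k) x)) =
      x ⊗ₜ[k] 1 := by
  trans (LinearMap.mul' k H ∘ₗ (HopfAlgebra.antipode k).lTensor H).lTensor H
    ((TensorProduct.assoc k H H H)
      ((Coalgebra.comul (R := k)).rTensor H (Coalgebra.comul (R := k) x)))
  · generalize Coalgebra.comul (R := k) x = s
    induction s with
    | zero => simp
    | add u v hu hv => simp only [map_add, hu, hv]
    | tmul l y =>
      simp only [LinearMap.rTensor_tmul, TensorProduct.map_tmul]
      generalize Coalgebra.comul (R := k) l = s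
      induction s with
      | zero => simp
      | add u v hu hv => simp only [TensorProduct.add_tmul, map_add, hu, hv]
      | tmul l y => simp
  · rw [Coalgebra.coassoc_apply, ← LinearMap.comp_apply, ← LinearMap.lTensor_comp]
    have : LinearMap.mul' k H ∘ₗ (HopfAlgebra.antipode k).lTensor H ∘ₗ Coalgebra.comul =
      Algebra.linearMap k H ∘ₗ Coalgebra.counit := HopfAlgebra.mul_antipode_lTensor_comul
    rw [LinearMap.comp_assoc, this, LinearMap.lTensor_comp, LinearMap.comp_apply,
      Coalgebra.lTensor_counit_comul]
    simp

/-- If `B^A(h₁ h' ⊗ h₂ h'') = ε(h) B^A(h' ⊗ h'')` then `B^A(h ⊗ h') = B^A(1 ⊗ S(h) h')`. -/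
theorem apply_tmul_of_invariant {BA : H ⊗[k] H →ₗ[k] A}
    (h3 : ∀ (h : H) (z : H ⊗[k] H), BA (Coalgebra.comul h * z) = Coalgebra.counit (R := k) h • BA z)
    (x y : H) : BA (x ⊗ₜ[k] y) = BA (1 ⊗ₜ[k] (HopfAlgebra.antipode k x * y)) := by
  have h4 : BA (x ⊗ₜ[k] y) = (BA ∘ₗ LinearMap.mulRight k ((1 : H) ⊗ₜ[k] y)) (x ⊗ₜ[k] 1) := by
    simp
  rw [h4, ← comul_mul_one_tmul_antipode (k := k) x]
  trans (BA ∘ₗ TensorProduct.mk k H H 1 ∘ₗ LinearMap.mulRight k y ∘ₗ HopfAlgebra.antipode k)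
    (TensorProduct.lid k H ((Coalgebra.counit (R := k)).rTensor H (Coalgebra.comul (R := k) x)))
  · generalize Coalgebra.comul (R := k) x = s
    induction s with
    | zero => simp
    | add u v hu hv => simp only [map_add, hu, hv]
    | tmul l y => simp [mul_assoc, h3]
  · rw [Coalgebra.rTensor_counit_comul]
    simp

/-- `a ⊗ l ↦ ε(l) a`. -/
def evalCounit (k H A : Type*) [Field k] [Ring H] [HopfAlgebra k H] [Ring A] [Algebra k A] :
    A ⊗[k] Hᵐᵒᵖ →ₗ[k] A :=
  (TensorProduct.rid k A).toLinearMap ∘ₗ (Coalgebra.counit (R := k) (A := H) ∘ₗ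
    (MulOpposite.opLinearEquiv k).symm.toLinearMap).lTensor A

@[simp]
theorem evalCounit_tmul (a : A) (l : Hᵐᵒᵖ) :
    evalCounit k H A (a ⊗ₜ[k] l) = Coalgebra.counit (R := k) l.unop • a := by
  simp [evalCounit]

theorem casimir_rtExtend_iff (M : ComoduleAlgebra k H A) (BA : H ⊗[k] H →ₗ[k] A) :
    (mulTensor k (A ⊗[k] Hᵐᵒᵖ) H ∘ₗ M.cowreath.ψ.lTensor (A ⊗[k] Hᵐᵒᵖ) ∘ₗ
      ((rtExtend BA).lTensor H).lTensor (A ⊗[k] Hᵐᵒᵖ) ∘ₗ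
      (TensorProduct.assoc k H H H).toLinearMap.lTensor (A ⊗[k] Hᵐᵒᵖ) ∘ₗ
      (TensorProduct.assoc k (A ⊗[k] Hᵐᵒᵖ) (H ⊗[k] H) H).toLinearMap ∘ₗ M.cowreath.δ.rTensor H =
    mulTensor k (A ⊗[k] Hᵐᵒᵖ) H ∘ₗ ((rtExtend BA).rTensor H).lTensor (A ⊗[k] Hᵐᵒᵖ) ∘ₗ
      (TensorProduct.assoc k H H H).symm.toLinearMap.lTensor (A ⊗[k] Hᵐᵒᵖ) ∘ₗ
      (TensorProduct.assoc k (A ⊗[k] Hᵐᵒᵖ) H (H ⊗[k] H)).toLinearMap ∘ₗ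
      M.cowreath.ψ.rTensor (H ⊗[k] H) ∘ₗ
      (TensorProduct.assoc k H (A ⊗[k] Hᵐᵒᵖ) (H ⊗[k] H)).symm.toLinearMap ∘ₗ
      M.cowreath.δ.lTensor H) ↔
      ∀ h h' : H, LinearMap.mul' k (A ⊗[k] H) (TensorProduct.map (TensorProduct.mk k A H 1)
          (M.ρ.toLinearMap ∘ₗ BA ∘ₗ (TensorProduct.mk k H H).flip h')
          (Coalgebra.comul (R := k) h)) =
        (BA ∘ₗ TensorProduct.mk k H H h).rTensor H (Coalgebra.comul h') := by
  have hL : ∀ (h h' : H), (mulTensor k (A ⊗[k] Hᵐᵒᵖ) H ∘ₗ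
      M.cowreath.ψ.lTensor (A ⊗[k] Hᵐᵒᵖ) ∘ₗ
      ((rtExtend BA).lTensor H).lTensor (A ⊗[k] Hᵐᵒᵖ) ∘ₗ
      (TensorProduct.assoc k H H H).toLinearMap.lTensor (A ⊗[k] Hᵐᵒᵖ) ∘ₗ
      (TensorProduct.assoc k (A ⊗[k] Hᵐᵒᵖ) (H ⊗[k] H) H).toLinearMap ∘ₗ
      M.cowreath.δ.rTensor H) (h ⊗ₜ[k] h') =
      ((TensorProduct.mk k A Hᵐᵒᵖ).flip 1).rTensor H (LinearMap.mul' k (A ⊗[k] H)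
        (TensorProduct.map (TensorProduct.mk k A H 1)
        (M.ρ.toLinearMap ∘ₗ BA ∘ₗ (TensorProduct.mk k H H).flip h')
        (Coalgebra.comul (R := k) h))) := by
    intro h h'
    simp only [LinearMap.coe_comp, Function.comp_apply, LinearMap.rTensor_tmul, cowreath,
      TensorProduct.mk_apply, LinearEquiv.coe_coe, TensorProduct.assoc_tmul,
      LinearMap.lTensor_tmul]
    generalize Coalgebra.comul (R := k) h = s
    induction s with
    | zero => simp
    | add u v hu hv => simp only [map_add, hu, hv, TensorProduct.tmul_add, TensorProduct.add_tmul]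
    | tmul x y =>
      simp only [TensorProduct.assoc_tmul, LinearMap.lTensor_tmul, TensorProduct.map_tmul,
        LinearMap.mul'_apply, TensorProduct.mk_apply, LinearMap.comp_apply, rtExtend,
        LinearMap.flip_apply, psi_tmul, AlgHom.toLinearMap_apply, MulOpposite.unop_one,
        Bialgebra.comul_one]
      generalize M.ρ (BA (y ⊗ₜ[k] h')) = u
      induction u with
      | zero => simp
      | add u v hu hv =>
        simp only [map_add, hu, hv, TensorProduct.tmul_add, TensorProduct.add_tmul, mul_add]
      | tmul a w => simp [Algebra.TensorProduct.one_def (A := H)]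
  have hR : ∀ (h h' : H), (mulTensor k (A ⊗[k] Hᵐᵒᵖ) H ∘ₗ
      ((rtExtend BA).rTensor H).lTensor (A ⊗[k] Hᵐᵒᵖ) ∘ₗ
      (TensorProduct.assoc k H H H).symm.toLinearMap.lTensor (A ⊗[k] Hᵐᵒᵖ) ∘ₗ
      (TensorProduct.assoc k (A ⊗[k] Hᵐᵒᵖ) H (H ⊗[k] H)).toLinearMap ∘ₗ
      M.cowreath.ψ.rTensor (H ⊗[k] H) ∘ₗ
      (TensorProduct.assoc k H (A ⊗[k] Hᵐᵒᵖ) (H ⊗[k] H)).symm.toLinearMap ∘ₗ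
      M.cowreath.δ.lTensor H) (h ⊗ₜ[k] h') =
      ((TensorProduct.mk k A Hᵐᵒᵖ).flip 1).rTensor H
        ((BA ∘ₗ TensorProduct.mk k H H h).rTensor H (Coalgebra.comul h')) := by
    intro h h'
    simp only [LinearMap.coe_comp, Function.comp_apply, LinearMap.rTensor_tmul, cowreath,
      TensorProduct.mk_apply, LinearEquiv.coe_coe, TensorProduct.assoc_symm_tmul,
      LinearMap.lTensor_tmul, psi_tmul_one, TensorProduct.assoc_tmul]
    generalize Coalgebra.comul (R := k) h' = s
    induction s with
    | zero => simp
    | add u v hu hv => simp only [map_add, hu, hv, TensorProduct.tmul_add]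
    | tmul x y => simp [rtExtend]
  have hinj : Function.Injective (((TensorProduct.mk k A Hᵐᵒᵖ).flip 1).rTensor H) := by
    refine Function.LeftInverse.injective (g := (evalCounit k H A).rTensor H) fun t => ?_
    rw [← LinearMap.comp_apply, ← LinearMap.rTensor_comp]
    have : evalCounit k H A ∘ₗ (TensorProduct.mk k A Hᵐᵒᵖ).flip 1 = LinearMap.id := by
      ext a
      simp
    simp [this]
  constructor
  · intro h x y
    have := LinearMap.congr_fun h (x ⊗ₜ[k] y)
    rw [hL, hR] at this
    exact hinj this
  · intro h
    refine TensorProduct.ext' fun x y => ?_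
    rw [hL, hR, h]

theorem hom_rtExtend_aux (BA : H ⊗[k] H →ₗ[k] A) (z : H ⊗[k] H) (u : A ⊗[k] H) (x y : H) :
    LinearMap.mul' k (A ⊗[k] Hᵐᵒᵖ) ((rtExtend BA).lTensor (A ⊗[k] Hᵐᵒᵖ)
      (psiAux k H (H ⊗[k] H) A (z ⊗ₜ[k] ((Coalgebra.comul (R := k) (A := H)).lTensor A u ⊗ₜ[k]
        (Coalgebra.comul (R := k) (A := H)).lTensor H (x ⊗ₜ[k] y))))) =
    LinearMap.mul' k A ((BA ∘ₗ LinearMap.mulLeft k (Coalgebra.comul y * z) ∘ₗ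
      Coalgebra.comul).lTensor A u) ⊗ₜ[k] MulOpposite.op x := by
  induction u with
  | zero => simp
  | add u v hu hv => simp only [map_add, hu, hv, TensorProduct.tmul_add, TensorProduct.add_tmul]
  | tmul a w => simp [rtExtend]

theorem hom_rtExtend_iff (M : ComoduleAlgebra k H A) (BA : H ⊗[k] H →ₗ[k] A) :
    (LinearMap.mul' k (A ⊗[k] Hᵐᵒᵖ) ∘ₗ (rtExtend BA).lTensor (A ⊗[k] Hᵐᵒᵖ) ∘ₗ
      transferSq M.cowreath.ψ = LinearMap.mul' k (A ⊗[k] Hᵐᵒᵖ) ∘ₗ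
      (rtExtend BA).rTensor (A ⊗[k] Hᵐᵒᵖ)) ↔
      (∀ (z : H ⊗[k] H) (a : A), LinearMap.mul' k A
        ((BA ∘ₗ LinearMap.mulLeft k z ∘ₗ Coalgebra.comul).lTensor A (M.ρ a)) = BA z * a) ∧
      (∀ (h : H) (z : H ⊗[k] H),
        BA (Coalgebra.comul h * z) = Coalgebra.counit (R := k) h • BA z) := by
  have hR : ∀ (z : H ⊗[k] H) (a : A) (l : Hᵐᵒᵖ), (LinearMap.mul' k (A ⊗[k] Hᵐᵒᵖ) ∘ₗ
      (rtExtend BA).rTensor (A ⊗[k] Hᵐᵒᵖ)) (z ⊗ₜ[k] (a ⊗ₜ[k] l)) = (BA z * a) ⊗ₜ[k] l := by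
    intro z a l
    simp [rtExtend]
  have hL : ∀ (z : H ⊗[k] H) (a : A) (l : Hᵐᵒᵖ), (LinearMap.mul' k (A ⊗[k] Hᵐᵒᵖ) ∘ₗ
      (rtExtend BA).lTensor (A ⊗[k] Hᵐᵒᵖ) ∘ₗ transferSq M.cowreath.ψ)
        (z ⊗ₜ[k] (a ⊗ₜ[k] l)) =
      LinearMap.mul' k (A ⊗[k] Hᵐᵒᵖ) ((rtExtend BA).lTensor (A ⊗[k] Hᵐᵒᵖ)
      (psiAux k H (H ⊗[k] H) A (z ⊗ₜ[k] ((Coalgebra.comul (R := k) (A := H)).lTensor A (M.ρ a)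
        ⊗ₜ[k] (Coalgebra.comul (R := k) (A := H)).lTensor H
          (Coalgebra.comul (R := k) l.unop))))) := by
    intro z a l
    simp only [LinearMap.comp_apply, cowreath, transferSq_psi]
  constructor
  · intro hh
    refine ⟨fun z a => ?_, fun h z => ?_⟩
    · have := congrArg (evalCounit k H A) (LinearMap.congr_fun hh (z ⊗ₜ[k] (a ⊗ₜ[k] 1)))
      rw [hL, hR, MulOpposite.unop_one, Bialgebra.comul_one, Algebra.TensorProduct.one_def,
        hom_rtExtend_aux, evalCounit_tmul, evalCounit_tmul, Bialgebra.comul_one] at this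
      simpa using this
    · have := congrArg (evalCounit k H A)
        (LinearMap.congr_fun hh (z ⊗ₜ[k] (1 ⊗ₜ[k] MulOpposite.op h)))
      rw [hL, hR, MulOpposite.unop_op, map_one, Algebra.TensorProduct.one_def,
        evalCounit_tmul, MulOpposite.unop_op, mul_one] at this
      rw [← this]
      trans (BA ∘ₗ LinearMap.mulRight k z ∘ₗ Coalgebra.comul) (TensorProduct.lid k H
        ((Coalgebra.counit (R := k)).rTensor H (Coalgebra.comul (R := k) h)))
      · rw [Coalgebra.rTensor_counit_comul]
        simp
      · generalize Coalgebra.comul (R := k) h = s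
        induction s with
        | zero => simp
        | add u v hu hv => simp only [map_add, hu, hv, TensorProduct.tmul_add]
        | tmul x y =>
          rw [hom_rtExtend_aux]
          simp
  · rintro ⟨h1, h3⟩
    refine TensorProduct.ext' fun z r => ?_
    induction r with
    | zero => simp
    | add u v hu hv => simp only [TensorProduct.tmul_add, map_add, hu, hv]
    | tmul a l =>
    rw [hL, hR]
    trans (BA z * a) ⊗ₜ[k] MulOpposite.op (TensorProduct.rid k H
      ((Coalgebra.counit (R := k)).lTensor H (Coalgebra.comul (R := k) l.unop)))
    · generalize Coalgebra.comul (R := k) l.unop = s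
      induction s with
      | zero => simp
      | add u v hu hv =>
        simp only [map_add, hu, hv, TensorProduct.tmul_add, MulOpposite.op_add]
      | tmul x y =>
        rw [hom_rtExtend_aux]
        have : BA ∘ₗ LinearMap.mulLeft k (Coalgebra.comul y * z) ∘ₗ Coalgebra.comul =
            Coalgebra.counit (R := k) y •
              (BA ∘ₗ LinearMap.mulLeft k z ∘ₗ Coalgebra.comul) := by
          ext w
          simp [h3]
        rw [this, LinearMap.lTensor_smul, LinearMap.smul_apply, map_smul, h1]
        simp [TensorProduct.smul_tmul]
    · rw [Coalgebra.lTensor_counit_comul]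
      simp

theorem normalized_rtExtend_iff (M : ComoduleAlgebra k H A) (BA : H ⊗[k] H →ₗ[k] A) :
    (LinearMap.mul' k (A ⊗[k] Hᵐᵒᵖ) ∘ₗ (rtExtend BA).lTensor (A ⊗[k] Hᵐᵒᵖ) ∘ₗ
      M.cowreath.δ = M.cowreath.ε) ↔ ∀ h : H, BA (Coalgebra.comul h) =
        Coalgebra.counit (R := k) h • 1 := by
  have hL : ∀ h : H, (LinearMap.mul' k (A ⊗[k] Hᵐᵒᵖ) ∘ₗ
      (rtExtend BA).lTensor (A ⊗[k] Hᵐᵒᵖ) ∘ₗ M.cowreath.δ) h =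
      BA (Coalgebra.comul h) ⊗ₜ[k] (1 : Hᵐᵒᵖ) := by
    intro h
    simp [cowreath, rtExtend]
  have hR : ∀ h : H, M.cowreath.ε h = (Coalgebra.counit (R := k) h • (1 : A)) ⊗ₜ[k]
      (1 : Hᵐᵒᵖ) := by
    intro h
    simp [cowreath, Algebra.algebraMap_eq_smul_one, Algebra.TensorProduct.one_def,
      TensorProduct.smul_tmul']
  constructor
  · intro hh h
    have := congrArg (evalCounit k H A) (LinearMap.congr_fun hh h)
    rw [hL, hR] at this
    simpa using this
  · intro hh
    refine LinearMap.ext fun h => ?_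
    rw [hL, hR, hh]

/-- `B^A ⊗ 1` is a normalized Casimir morphism iff, for all `a`, `h`, `h'`, `h''`,
`a₀ B^A(h a₁ ⊗ h' a₂) = B^A(h ⊗ h') a`, `B^A(1 ⊗ h)₀ ⊗ B^A(1 ⊗ h)₁ = B^A(1 ⊗ h₁) ⊗ h₂`,
`B^A(h₁ h' ⊗ h₂ h'') = ε(h) B^A(h' ⊗ h'')` and `B^A(1 ⊗ 1) = 1`. -/
theorem isRtCasimir_iff (M : ComoduleAlgebra k H A) (BA : H ⊗[k] H →ₗ[k] A) :
    M.IsRtCasimir BA ↔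
      (∀ (z : H ⊗[k] H) (a : A), LinearMap.mul' k A
        ((BA ∘ₗ LinearMap.mulLeft k z ∘ₗ Coalgebra.comul).lTensor A (M.ρ a)) = BA z * a) ∧
      (∀ h : H, M.ρ (BA (1 ⊗ₜ[k] h)) =
        (BA ∘ₗ TensorProduct.mk k H H 1).rTensor H (Coalgebra.comul h)) ∧
      (∀ (h : H) (z : H ⊗[k] H),
        BA (Coalgebra.comul h * z) = Coalgebra.counit (R := k) h • BA z) ∧
      BA (1 ⊗ₜ[k] 1) = 1 := by
  constructor
  · rintro ⟨h1, h2, h3⟩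
    obtain ⟨h1, h4⟩ := (hom_rtExtend_iff M BA).1 h1
    refine ⟨h1, fun h => ?_, h4, ?_⟩
    · have := (casimir_rtExtend_iff M BA).1 h2 1 h
      rw [Bialgebra.comul_one, Algebra.TensorProduct.one_def, TensorProduct.map_tmul,
        LinearMap.mul'_apply, TensorProduct.mk_apply, ← Algebra.TensorProduct.one_def,
        one_mul] at this
      exact this
    · simpa [Algebra.TensorProduct.one_def] using (normalized_rtExtend_iff M BA).1 h3 1
  · rintro ⟨h1, h2, h3, h4⟩
    refine ⟨(hom_rtExtend_iff M BA).2 ⟨h1, h3⟩, (casimir_rtExtend_iff M BA).2 fun h h' => ?_, (normalized_rtExtend_iff M BA).2 fun h => ?_⟩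
    · have := congrArg (fun w => (BA ∘ₗ TensorProduct.mk k H H 1).rTensor H
        (w * Coalgebra.comul (R := k) h')) (one_tmul_mul_comul_antipode (k := k) h)
      trans (BA ∘ₗ TensorProduct.mk k H H 1).rTensor H
        ((HopfAlgebra.antipode k h ⊗ₜ[k] 1) * Coalgebra.comul (R := k) h')
      · rw [← this]
        clear this
        generalize Coalgebra.comul (R := k) h = s
        induction s with
        | zero => simp
        | add u v hu hv => simp only [map_add, hu, hv, add_mul]
        | tmul x y =>
          simp only [TensorProduct.map_tmul, LinearMap.mul'_apply, LinearMap.comp_apply,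
            TensorProduct.mk_apply, LinearMap.flip_apply, AlgHom.toLinearMap_apply,
            apply_tmul_of_invariant h3 y h', h2, mul_assoc, ← Bialgebra.comul_mul]
          generalize Coalgebra.comul (R := k) (HopfAlgebra.antipode k y * h') = s
          induction s with
          | zero => simp
          | add u v hu hv => simp only [map_add, hu, hv, mul_add]
          | tmul x y => simp
      · generalize Coalgebra.comul (R := k) h' = s
        induction s with
        | zero => simp
        | add u v hu hv => simp only [map_add, hu, hv, mul_add]
        | tmul x y => simp [apply_tmul_of_invariant h3 h x]
    · have := h3 h 1
      rw [mul_one, Algebra.TensorProduct.one_def, h4] at this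
      exact this

end

end ComoduleAlgebra

/-- The defining relations of `Cl(α, β_i, γ_i, λ_ij)` on the free algebra with generators
`G` (index `0`) and `X_1, …, X_n` (index `i.succ` for `i : Fin n`). -/
inductive ClRel {k : Type*} [Field k] {n : ℕ} (α : k) (β γ : Fin n → k)
    (lam : Fin n → Fin n → k) : FreeAlgebra k (Fin (n + 1)) → FreeAlgebra k (Fin (n + 1)) → Prop
  | G_sq : ClRel α β γ lam (FreeAlgebra.ι k 0 * FreeAlgebra.ι k 0) (algebraMap k _ α)
  | X_sq (i : Fin n) : ClRel α β γ lam
      (FreeAlgebra.ι k i.succ * FreeAlgebra.ι k i.succ) (algebraMap k _ (β i))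
  | G_X (i : Fin n) : ClRel α β γ lam
      (FreeAlgebra.ι k 0 * FreeAlgebra.ι k i.succ + FreeAlgebra.ι k i.succ * FreeAlgebra.ι k 0)
      (algebraMap k _ (γ i))
  | X_X (i j : Fin n) (hij : i < j) : ClRel α β γ lam
      (FreeAlgebra.ι k i.succ * FreeAlgebra.ι k j.succ +
        FreeAlgebra.ι k j.succ * FreeAlgebra.ι k i.succ)
      (algebraMap k _ (lam i j))

/-- The Clifford algebra `Cl(α, β_i, γ_i, λ_ij)`; only the values `lam i j` with `i < j` matter. -/
def Cl {k : Type*} [Field k] {n : ℕ} (α : k) (β γ : Fin n → k) (lam : Fin n → Fin n → k) :=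
  RingQuot (ClRel α β γ lam)

namespace Cl

section
variable {k : Type*} [Field k] {n : ℕ} (α : k) (β γ : Fin n → k) (lam : Fin n → Fin n → k)

instance : Ring (Cl α β γ lam) := inferInstanceAs (Ring (RingQuot (ClRel α β γ lam)))

instance : Algebra k (Cl α β γ lam) :=
  inferInstanceAs (Algebra k (RingQuot (ClRel α β γ lam)))

/-- The generators `X_0 = G, X_1, …, X_n`. -/
def gen (i : Fin (n + 1)) : Cl α β γ lam :=
  RingQuot.mkAlgHom k (ClRel α β γ lam) (FreeAlgebra.ι k i)

/-- `X_R = X_{i_1} ⋯ X_{i_s}` for `R = {i_1 < ⋯ < i_s} ⊆ {0, 1, …, n}`. -/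
def mon (R : Finset (Fin (n + 1))) : Cl α β γ lam :=
  (R.sort.map (gen α β γ lam)).prod

variable {α β γ lam}

theorem gen_zero_sq : gen α β γ lam 0 * gen α β γ lam 0 = algebraMap k _ α := by
  have := RingQuot.mkAlgHom_rel k (ClRel.G_sq (α := α) (β := β) (γ := γ) (lam := lam))
  rw [map_mul, AlgHom.commutes] at this
  exact this

theorem gen_succ_sq (i : Fin n) :
    gen α β γ lam i.succ * gen α β γ lam i.succ = algebraMap k _ (β i) := by
  have := RingQuot.mkAlgHom_rel k (ClRel.X_sq (α := α) (β := β) (γ := γ) (lam := lam) i)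
  rw [map_mul, AlgHom.commutes] at this
  exact this

theorem gen_zero_mul_gen_succ (i : Fin n) :
    gen α β γ lam 0 * gen α β γ lam i.succ + gen α β γ lam i.succ * gen α β γ lam 0 =
      algebraMap k _ (γ i) := by
  have := RingQuot.mkAlgHom_rel k (ClRel.G_X (α := α) (β := β) (γ := γ) (lam := lam) i)
  rw [map_add, map_mul, map_mul, AlgHom.commutes] at this
  exact this

theorem gen_succ_mul_gen_succ {i j : Fin n} (hij : i < j) :
    gen α β γ lam i.succ * gen α β γ lam j.succ + gen α β γ lam j.succ * gen α β γ lam i.succ =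
      algebraMap k _ (lam i j) := by
  have := RingQuot.mkAlgHom_rel k (ClRel.X_X (α := α) (β := β) (γ := γ) (lam := lam) i j hij)
  rw [map_add, map_mul, map_mul, AlgHom.commutes] at this
  exact this

/-- The universal property of `Cl(α, β_i, γ_i, λ_ij)`. -/
def lift {A : Type*} [Ring A] [Algebra k A] (f : Fin (n + 1) → A)
    (h0 : f 0 * f 0 = algebraMap k A α)
    (h1 : ∀ i : Fin n, f i.succ * f i.succ = algebraMap k A (β i))
    (h2 : ∀ i : Fin n, f 0 * f i.succ + f i.succ * f 0 = algebraMap k A (γ i))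
    (h3 : ∀ i j : Fin n, i < j →
      f i.succ * f j.succ + f j.succ * f i.succ = algebraMap k A (lam i j)) :
    Cl α β γ lam →ₐ[k] A :=
  RingQuot.liftAlgHom k ⟨FreeAlgebra.lift k f, by
    rintro _ _ (_ | i | i | ⟨i, j, hij⟩)
    · simpa using h0
    · simpa using h1 i
    · simpa using h2 i
    · simpa using h3 i j hij⟩

@[simp]
theorem lift_gen {A : Type*} [Ring A] [Algebra k A] (f : Fin (n + 1) → A)
    (h0 : f 0 * f 0 = algebraMap k A α)
    (h1 : ∀ i : Fin n, f i.succ * f i.succ = algebraMap k A (β i))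
    (h2 : ∀ i : Fin n, f 0 * f i.succ + f i.succ * f 0 = algebraMap k A (γ i))
    (h3 : ∀ i j : Fin n, i < j →
      f i.succ * f j.succ + f j.succ * f i.succ = algebraMap k A (lam i j)) (i : Fin (n + 1)) :
    lift f h0 h1 h2 h3 (gen α β γ lam i) = f i := by
  unfold lift gen
  erw [RingQuot.liftAlgHom_mkAlgHom_apply]
  simp

@[ext]
theorem algHom_ext {A : Type*} [Ring A] [Algebra k A] {f g : Cl α β γ lam →ₐ[k] A}
    (h : ∀ i, f (gen α β γ lam i) = g (gen α β γ lam i)) : f = g := by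
  apply RingQuot.ringQuot_ext'
  apply FreeAlgebra.hom_ext
  funext i
  exact h i

theorem induction {C : Cl α β γ lam → Prop} (halg : ∀ r : k, C (algebraMap k _ r))
    (hgen : ∀ i, C (gen α β γ lam i)) (hmul : ∀ a b, C a → C b → C (a * b))
    (hadd : ∀ a b, C a → C b → C (a + b)) (a : Cl α β γ lam) : C a := by
  obtain ⟨x, rfl⟩ := RingQuot.mkAlgHom_surjective k (ClRel α β γ lam) a
  induction x with
  | grade0 r =>
    rw [AlgHom.commutes]
    exact halg r
  | grade1 i => exact hgen i
  | mul x y hx hy =>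
    rw [map_mul]
    exact hmul _ _ hx hy
  | add x y hx hy =>
    rw [map_add]
    exact hadd _ _ hx hy

end

end Cl

/-- The algebra `E(n)` with generators `g, x_1, …, x_n` and relations `g² = 1`, `x_i² = 0`,
`g x_i + x_i g = 0`, `x_i x_j + x_j x_i = 0`. -/
abbrev En (k : Type*) [Field k] (n : ℕ) := Cl (1 : k) (0 : Fin n → k) 0 0

namespace En

section
variable {k : Type*} [Field k] {n : ℕ}

/-- The generator `g`. -/
def g : En k n := Cl.gen 1 0 0 0 0

/-- The generators `x_1, …, x_n`. -/
def x (i : Fin n) : En k n := Cl.gen 1 0 0 0 i.succ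

/-- `x_P = x_{i_1} ⋯ x_{i_s}` for `P = {i_1 < ⋯ < i_s}`. -/
def xs (P : Finset (Fin n)) : En k n := (P.sort.map x).prod

theorem g_sq : (g : En k n) * g = 1 := by
  simpa [g] using Cl.gen_zero_sq (α := (1 : k)) (β := (0 : Fin n → k)) (γ := 0) (lam := 0)

theorem x_sq (i : Fin n) : (x i : En k n) * x i = 0 := by
  simpa [x] using Cl.gen_succ_sq (α := (1 : k)) (β := (0 : Fin n → k)) (γ := 0) (lam := 0) i

theorem g_x (i : Fin n) : (g : En k n) * x i = -(x i * g) := by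
  refine eq_neg_of_add_eq_zero_left ?_
  simpa [g, x] using
    Cl.gen_zero_mul_gen_succ (α := (1 : k)) (β := (0 : Fin n → k)) (γ := 0) (lam := 0) i

theorem x_x (i j : Fin n) : (x i : En k n) * x j = -(x j * x i) := by
  rcases lt_trichotomy i j with h | rfl | h
  · refine eq_neg_of_add_eq_zero_left ?_
    simpa [x] using Cl.gen_succ_mul_gen_succ (α := (1 : k)) (β := (0 : Fin n → k)) (γ := 0)
      (lam := 0) h
  · simp [x_sq]
  · refine eq_neg_of_add_eq_zero_right ?_
    simpa [x] using Cl.gen_succ_mul_gen_succ (α := (1 : k)) (β := (0 : Fin n → k)) (γ := 0)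
      (lam := 0) h

end

end En

/-- The canonical `E(n)`-coaction on `Cl(α, β_i, γ_i, λ_ij)` as an algebra map:
`G ↦ G ⊗ g`, `X_i ↦ X_i ⊗ g + 1 ⊗ x_i`. -/
def Cl.coact {k : Type*} [Field k] {n : ℕ} (α : k) (β γ : Fin n → k) (lam : Fin n → Fin n → k) :
    Cl α β γ lam →ₐ[k] Cl α β γ lam ⊗[k] En k n :=
  Cl.lift (Fin.cons (Cl.gen α β γ lam 0 ⊗ₜ[k] En.g)
      fun i => Cl.gen α β γ lam i.succ ⊗ₜ[k] En.g + 1 ⊗ₜ[k] En.x i)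
    (by
      simp [Cl.gen_zero_sq, En.g_sq])
    (fun i => by
      simp [add_mul, mul_add, Cl.gen_succ_sq, En.g_sq, En.x_sq, En.g_x, TensorProduct.tmul_neg])
    (fun i => by
      rw [Algebra.TensorProduct.algebraMap_apply, ← Cl.gen_zero_mul_gen_succ]
      simp [add_mul, mul_add, En.g_sq, En.g_x, TensorProduct.tmul_neg, TensorProduct.add_tmul]
      abel)
    (fun i j hij => by
      rw [Algebra.TensorProduct.algebraMap_apply, ← Cl.gen_succ_mul_gen_succ hij]
      simp [add_mul, mul_add, En.g_sq, En.g_x, En.x_x i j, TensorProduct.tmul_neg,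
        TensorProduct.add_tmul]
      abel)

theorem Cl.coact_gen_zero {k : Type*} [Field k] {n : ℕ} (α : k) (β γ : Fin n → k)
    (lam : Fin n → Fin n → k) :
    Cl.coact α β γ lam (Cl.gen α β γ lam 0) = Cl.gen α β γ lam 0 ⊗ₜ[k] En.g := by
  exact Cl.lift_gen _ _ _ _ _ _

theorem Cl.coact_gen_succ {k : Type*} [Field k] {n : ℕ} (α : k) (β γ : Fin n → k)
    (lam : Fin n → Fin n → k) (i : Fin n) :
    Cl.coact α β γ lam (Cl.gen α β γ lam i.succ) =
      Cl.gen α β γ lam i.succ ⊗ₜ[k] En.g + 1 ⊗ₜ[k] En.x i := by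
  exact Cl.lift_gen _ _ _ _ _ _

namespace En

section
variable {k : Type*} [Field k] {n : ℕ}

/-- The comultiplication: `Δ(g) = g ⊗ g`, `Δ(x_i) = x_i ⊗ g + 1 ⊗ x_i`. -/
def comulHom (k : Type*) [Field k] (n : ℕ) : En k n →ₐ[k] En k n ⊗[k] En k n :=
  Cl.coact 1 0 0 0

theorem comulHom_g : comulHom k n g = g ⊗ₜ[k] g := Cl.coact_gen_zero 1 0 0 0

theorem comulHom_x (i : Fin n) : comulHom k n (x i) = x i ⊗ₜ[k] g + 1 ⊗ₜ[k] x i :=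
  Cl.coact_gen_succ 1 0 0 0 i

/-- The counit: `ε(g) = 1`, `ε(x_i) = 0`. -/
def counitHom (k : Type*) [Field k] (n : ℕ) : En k n →ₐ[k] k :=
  Cl.lift (Fin.cons 1 fun _ => 0) (by simp) (by simp) (by simp) (by simp)

theorem counitHom_g : counitHom k n g = 1 := by simp [counitHom, g]

theorem counitHom_x (i : Fin n) : counitHom k n (x i) = 0 := by simp [counitHom, x]

/-- The antipode, as an anti-homomorphism: `S(g) = g`, `S(x_i) = g x_i`. -/
def antipodeHom (k : Type*) [Field k] (n : ℕ) : En k n →ₐ[k] (En k n)ᵐᵒᵖ :=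
  Cl.lift (Fin.cons (MulOpposite.op g) fun i => MulOpposite.op (g * x i))
    (by simp [← MulOpposite.op_mul, g_sq])
    (fun i => by
      simp only [Fin.cons_succ, ← MulOpposite.op_mul]
      rw [mul_assoc, ← mul_assoc (x i), ← neg_eq_iff_eq_neg.2 (g_x i), neg_mul, mul_assoc g,
        x_sq]
      simp)
    (fun i => by
      simp only [Fin.cons_succ, Fin.cons_zero, ← MulOpposite.op_mul, ← MulOpposite.op_add]
      rw [← mul_assoc, g_sq, mul_assoc, ← neg_eq_iff_eq_neg.2 (g_x i), mul_neg, ← mul_assoc, g_sq]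
      simp)
    (fun i j _ => by
      have h : ∀ i j : Fin n, (g : En k n) * x i * (g * x j) = -(x i * x j) := by
        intro i j
        rw [mul_assoc, ← mul_assoc (x i), ← neg_eq_iff_eq_neg.2 (g_x i), neg_mul, mul_neg,
          ← mul_assoc, ← mul_assoc, g_sq, one_mul]
      simp only [Fin.cons_succ, ← MulOpposite.op_mul, ← MulOpposite.op_add]
      rw [h, h, x_x i j]
      simp)

theorem antipodeHom_g : antipodeHom k n g = MulOpposite.op g := by simp [antipodeHom, g]

theorem antipodeHom_x (i : Fin n) : antipodeHom k n (x i) = MulOpposite.op (g * x i) := by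
  simp [antipodeHom, x]

end

end En

theorem Cl.coact_coassoc {k : Type*} [Field k] {n : ℕ} (α : k) (β γ : Fin n → k)
    (lam : Fin n → Fin n → k) :
    (Algebra.TensorProduct.assoc k k k (Cl α β γ lam) (En k n) (En k n)).toAlgHom.comp
      ((Algebra.TensorProduct.map (Cl.coact α β γ lam) (.id k (En k n))).comp
        (Cl.coact α β γ lam)) =
    (Algebra.TensorProduct.map (.id k (Cl α β γ lam)) (En.comulHom k n)).comp
      (Cl.coact α β γ lam) := by
  ext i
  refine Fin.cases ?_ (fun i => ?_) i
  · simp [Cl.coact_gen_zero, En.comulHom_g]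
  · simp [Cl.coact_gen_succ, En.comulHom_g, En.comulHom_x, TensorProduct.add_tmul,
      TensorProduct.tmul_add, Algebra.TensorProduct.one_def, add_assoc]

theorem Cl.coact_counit {k : Type*} [Field k] {n : ℕ} (α : k) (β γ : Fin n → k)
    (lam : Fin n → Fin n → k) :
    (Algebra.TensorProduct.map (.id k (Cl α β γ lam)) (En.counitHom k n)).comp
      (Cl.coact α β γ lam) = (Algebra.TensorProduct.rid k k (Cl α β γ lam)).symm := by
  ext i
  refine Fin.cases ?_ (fun i => ?_) i
  · simp [Cl.coact_gen_zero, En.counitHom_g]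
  · simp [Cl.coact_gen_succ, En.counitHom_g, En.counitHom_x]

namespace En

section
variable {k : Type*} [Field k] {n : ℕ}

instance : Bialgebra k (En k n) :=
  Bialgebra.ofAlgHom (comulHom k n) (counitHom k n) (Cl.coact_coassoc 1 0 0 0)
    (by
      apply Cl.algHom_ext
      intro i
      refine Fin.cases ?_ (fun i => ?_) i
      · change (Algebra.TensorProduct.map _ _) (comulHom k n g) = _
        rw [comulHom_g, Algebra.TensorProduct.map_tmul, counitHom_g]
        rfl
      · change (Algebra.TensorProduct.map _ _) (comulHom k n (x i)) = _
        rw [comulHom_x, map_add, Algebra.TensorProduct.map_tmul, Algebra.TensorProduct.map_tmul,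
          counitHom_x, map_one, TensorProduct.zero_tmul, zero_add]
        rfl)
    (Cl.coact_counit 1 0 0 0)

theorem comul_eq (a : En k n) : Coalgebra.comul (R := k) a = comulHom k n a := rfl

theorem counit_eq (a : En k n) : Coalgebra.counit (R := k) a = counitHom k n a := rfl

/-- The antipode as a linear map. -/
def antipodeMap (k : Type*) [Field k] (n : ℕ) : En k n →ₗ[k] En k n :=
  (MulOpposite.opLinearEquiv k).symm.toLinearMap ∘ₗ (antipodeHom k n).toLinearMap

theorem antipodeMap_mul (a b : En k n) :
    antipodeMap k n (a * b) = antipodeMap k n b * antipodeMap k n a := by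
  simp [antipodeMap]

theorem antipodeMap_algebraMap (r : k) :
    antipodeMap k n (algebraMap k _ r) = algebraMap k _ r := by
  simp [antipodeMap]

theorem antipodeMap_one : antipodeMap k n 1 = 1 := by
  simp [antipodeMap]

theorem antipodeMap_g : antipodeMap k n g = g := by
  simp [antipodeMap, antipodeHom_g]

theorem antipodeMap_x (i : Fin n) : antipodeMap k n (x i) = g * x i := by
  simp [antipodeMap, antipodeHom_x]

instance : HopfAlgebra k (En k n) where
  antipode := antipodeMap k n
  mul_antipode_rTensor_comul := by
    have hm : ∀ t s : En k n ⊗[k] En k n, ∀ c : k,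
        LinearMap.mul' k _ ((antipodeMap k n).rTensor _ t) = algebraMap k _ c →
        LinearMap.mul' k _ ((antipodeMap k n).rTensor _ (t * s)) =
          c • LinearMap.mul' k _ ((antipodeMap k n).rTensor _ s) := by
      intro t s c ht
      induction s with
      | zero => simp
      | add u v hu hv => simp only [mul_add, map_add, hu, hv, smul_add]
      | tmul u v =>
        trans antipodeMap k n u *
          (LinearMap.mul' k _ ((antipodeMap k n).rTensor _ t)) * v
        · clear ht
          induction t with
          | zero => simp
          | add u v hu hv => simp only [add_mul, mul_add, map_add, hu, hv]
          | tmul y z => simp [antipodeMap_mul, mul_assoc]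
        · rw [ht, ← Algebra.commutes, mul_assoc, ← Algebra.smul_def]
          simp
    ext a
    simp only [LinearMap.comp_apply, Algebra.linearMap_apply, comul_eq, counit_eq]
    induction a using Cl.induction with
    | halg r =>
      rw [AlgHom.commutes, AlgHom.commutes, Algebra.TensorProduct.algebraMap_apply]
      simp [antipodeMap_algebraMap]
    | hadd a b ha hb => simp only [map_add, ha, hb]
    | hmul a b ha hb =>
      rw [map_mul, hm _ _ _ ha, hb, map_mul, map_mul, Algebra.smul_def]
    | hgen i =>
      refine Fin.cases ?_ (fun i => ?_) i
      · change LinearMap.mul' k _ ((antipodeMap k n).rTensor _ (comulHom k n g)) =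
          algebraMap k _ (counitHom k n g)
        simp [comulHom_g, counitHom_g, antipodeMap_g, g_sq]
      · change LinearMap.mul' k _ ((antipodeMap k n).rTensor _ (comulHom k n (x i))) =
          algebraMap k _ (counitHom k n (x i))
        simp [comulHom_x, counitHom_x, antipodeMap_x, antipodeMap_one, g_x, mul_assoc, g_sq]
  mul_antipode_lTensor_comul := by
    have hm : ∀ t s : En k n ⊗[k] En k n, ∀ c : k,
        LinearMap.mul' k _ ((antipodeMap k n).lTensor _ s) = algebraMap k _ c →
        LinearMap.mul' k _ ((antipodeMap k n).lTensor _ (t * s)) =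
          c • LinearMap.mul' k _ ((antipodeMap k n).lTensor _ t) := by
      intro t s c hs
      induction t with
      | zero => simp
      | add u v hu hv => simp only [add_mul, map_add, hu, hv, smul_add]
      | tmul u v =>
        trans u * (LinearMap.mul' k _ ((antipodeMap k n).lTensor _ s)) * antipodeMap k n v
        · clear hs
          induction s with
          | zero => simp
          | add u v hu hv => simp only [add_mul, mul_add, map_add, hu, hv]
          | tmul y z => simp [antipodeMap_mul, mul_assoc]
        · rw [hs, ← Algebra.commutes, mul_assoc, ← Algebra.smul_def]
          simp
    ext a
    simp only [LinearMap.comp_apply, Algebra.linearMap_apply, comul_eq, counit_eq]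
    induction a using Cl.induction with
    | halg r =>
      rw [AlgHom.commutes, AlgHom.commutes, Algebra.TensorProduct.algebraMap_apply]
      simp [antipodeMap_one]
    | hadd a b ha hb => simp only [map_add, ha, hb]
    | hmul a b ha hb =>
      rw [map_mul, hm _ _ _ hb, ha, map_mul, map_mul, Algebra.smul_def, Algebra.commutes]
    | hgen i =>
      refine Fin.cases ?_ (fun i => ?_) i
      · change LinearMap.mul' k _ ((antipodeMap k n).lTensor _ (comulHom k n g)) =
          algebraMap k _ (counitHom k n g)
        simp [comulHom_g, counitHom_g, antipodeMap_g, g_sq]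
      · change LinearMap.mul' k _ ((antipodeMap k n).lTensor _ (comulHom k n (x i))) =
          algebraMap k _ (counitHom k n (x i))
        simp [comulHom_x, counitHom_x, antipodeMap_x, antipodeMap_g, g_x]

theorem antipode_eq (a : En k n) : HopfAlgebra.antipode k a = antipodeMap k n a := rfl

end

end En

/-- The Clifford algebra `Cl(α, β_i, γ_i, λ_ij)` with its canonical `E(n)`-coaction. -/
def Cl.comoduleAlgebra {k : Type*} [Field k] {n : ℕ} (α : k) (β γ : Fin n → k)
    (lam : Fin n → Fin n → k) : ComoduleAlgebra k (En k n) (Cl α β γ lam) where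
  ρ := Cl.coact α β γ lam
  coassoc := congrArg AlgHom.toLinearMap (Cl.coact_coassoc α β γ lam)
  counit := congrArg AlgHom.toLinearMap (Cl.coact_counit α β γ lam)


/-- `S(F, P) = (j_1 + ⋯ + j_r) - r (r + 1) / 2` for `F = {i_{j_1}, …, i_{j_r}} ⊆ P = {i_1 < i_2 < ⋯}`;
the subtraction does not truncate when `F ⊆ P`. -/
def posSum {ι : Type*} [LinearOrder ι] (F P : Finset ι) : ℕ :=
  (∑ f ∈ F, (P.filter fun p => p ≤ f).card) - F.card * (F.card + 1) / 2

/-- The perfect matchings of `S`: partitions of `S` into blocks of cardinality `2`. -/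
abbrev PerfectMatching {ι : Type*} [LinearOrder ι] (S : Finset ι) : Type _ :=
  {P : Finpartition S // ∀ b ∈ P.parts, b.card = 2}

namespace PerfectMatching

section
variable {ι : Type*} [LinearOrder ι] {S : Finset ι}

/-- The canonical presentation `P_1 | P_2 | ⋯ | P_m` of a perfect matching as a list: the elements
of each block are listed increasingly, the blocks are ordered by their largest elements. -/
def toList (P : PerfectMatching S) : List ι :=
  (S.filter fun s => ∀ t ∈ P.1.part s, t ≤ s).sort.flatMap fun s => (P.1.part s).sort

theorem mem_toList (P : PerfectMatching S) (a : ι) : a ∈ S.sort ↔ a ∈ P.toList := by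
  simp only [toList, List.mem_flatMap, Finset.mem_sort, Finset.mem_filter]
  constructor
  · intro ha
    have hne : (P.1.part a).Nonempty := P.1.part_nonempty.2 ha
    have hm := (P.1.part a).max'_mem hne
    have hmS : (P.1.part a).max' hne ∈ S := P.1.part_subset a hm
    have hp : P.1.part ((P.1.part a).max' hne) = P.1.part a :=
      P.1.part_eq_of_mem (P.1.part_mem.2 ha) hm
    exact ⟨_, ⟨hmS, fun t ht => Finset.le_max' _ _ (hp ▸ ht)⟩, hp.symm ▸ P.1.mem_part ha⟩
  · rintro ⟨s, -, ha⟩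
    exact P.1.part_subset s ha

theorem nodup_toList (P : PerfectMatching S) : P.toList.Nodup := by
  rw [toList, List.nodup_flatMap]
  refine ⟨fun s _ => Finset.sort_nodup _ _, ?_⟩
  refine (Finset.sort_nodup _ _).imp_of_mem ?_
  intro s t hs ht hst
  rw [Finset.mem_sort, Finset.mem_filter] at hs ht
  refine List.disjoint_left.2 fun a has hat => hst ?_
  rw [Finset.mem_sort] at has hat
  have h : P.1.part s = P.1.part t := by
    rw [← P.1.part_eq_of_mem (P.1.part_mem.2 hs.1) has,
      P.1.part_eq_of_mem (P.1.part_mem.2 ht.1) hat]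
  exact le_antisymm (ht.2 _ (h ▸ P.1.mem_part hs.1)) (hs.2 _ (h ▸ P.1.mem_part ht.1))

theorem length_toList (P : PerfectMatching S) : S.sort.length = P.toList.length :=
  (((List.perm_ext_iff_of_nodup (Finset.sort_nodup _ _) P.nodup_toList)).2 P.mem_toList).length_eq

/-- The permutation `σ_P` of `S` that sends the `i`-th smallest element of `S` to the `i`-th entry
of the canonical presentation of `P`. -/
def perm (P : PerfectMatching S) : Equiv.Perm {a : ι // a ∈ S.sort} :=
  ((Finset.sort_nodup S (· ≤ ·)).getEquiv).symm.trans <|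
    (finCongr P.length_toList).trans <|
      (P.nodup_toList.getEquiv).trans <|
        Equiv.subtypeEquivRight fun a => (P.mem_toList a).symm

/-- The sign of a perfect matching, i.e. the sign of `σ_P`. -/
def sgn (P : PerfectMatching S) : ℤ := (Equiv.Perm.sign P.perm : ℤ)

end

end PerfectMatching

/-- The scalars `λ_ij` for `0 ≤ i < j ≤ n`, with `λ_0j = γ_j`. -/
def lamBar {k : Type*} [Field k] {n : ℕ} (γ : Fin n → k) (lam : Fin n → Fin n → k) :
    Fin (n + 1) → Fin (n + 1) → k :=
  Fin.cons (Fin.cons 0 γ) fun i => Fin.cons (γ i) (lam i)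

/-- `Λ(P)`, the product over the blocks `{i < j}` of `P` of the scalars `λ_ij`. -/
def PerfectMatching.weight {k : Type*} [Field k] {n : ℕ} (γ : Fin n → k)
    (lam : Fin n → Fin n → k) {S : Finset (Fin (n + 1))} (P : PerfectMatching S) : k :=
  ∏ b ∈ P.1.parts, lamBar γ lam (b.inf id) (b.sup id)

/-- `Q ⊔ {0}` as a subset of `{0, 1, …, n}`, for `Q ⊆ {1, …, n}`. -/
def addZero {n : ℕ} (Q : Finset (Fin n)) : Finset (Fin (n + 1)) :=
  insert 0 (Q.map (Fin.succEmb n))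

/-- `Q \ R` as a subset of `{1, …, n}`, for `Q ⊆ {1, …, n}` and `R ⊆ {0, 1, …, n}`. -/
def diffZero {n : ℕ} (Q : Finset (Fin n)) (R : Finset (Fin (n + 1))) : Finset (Fin n) :=
  Q.filter fun i => i.succ ∉ R

namespace Cl

section
variable {k : Type*} [Field k] {n : ℕ}

/-- Either all the defining scalars vanish, or `α ≠ 0`, `β_i = γ_i² / (4 α)` and
`λ_ij = γ_i γ_j / (2 α)`. -/
def RtCondition (α : k) (β γ : Fin n → k) (lam : Fin n → Fin n → k) : Prop :=
  (α = 0 ∧ (∀ i, β i = 0) ∧ (∀ i, γ i = 0) ∧ ∀ i j, i < j → lam i j = 0) ∨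
    (α ≠ 0 ∧ (∀ i, β i = γ i ^ 2 / (4 * α)) ∧ ∀ i j, i < j → lam i j = γ i * γ j / (2 * α))

/-- If `α ≠ 0`, the recursion for `η_T` with `|T|` odd. -/
def EtaRecursion (α : k) (γ : Fin n → k) (η : Finset (Fin n) → k) : Prop :=
  α ≠ 0 → ∀ T : Finset (Fin n), Odd T.card →
    η T = ∑ i ∈ T, (-1) ^ (posSum {i} T + 1) * η (T.erase i) * (γ i / (2 * α))

/-- The explicit description of `B^A` in terms of the parameters `μ` and `η_S`. -/
structure CasimirFormula (α : k) (β γ : Fin n → k) (lam : Fin n → Fin n → k) (μ : k)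
    (η : Finset (Fin n) → k) (BA : En k n ⊗[k] En k n →ₗ[k] Cl α β γ lam) : Prop where
  apply_tmul : ∀ (j l : Fin 2) (P Q : Finset (Fin n)),
    BA ((En.g ^ (j : ℕ) * En.xs P) ⊗ₜ[k] (En.g ^ (l : ℕ) * En.xs Q)) =
      BA (1 ⊗ₜ[k] (HopfAlgebra.antipode k (En.g ^ (j : ℕ) * En.xs P) *
        (En.g ^ (l : ℕ) * En.xs Q)))
  apply_one : BA (1 ⊗ₜ[k] 1) = 1
  apply_x : ∀ Q : Finset (Fin n), BA (1 ⊗ₜ[k] En.xs Q) =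
    ∑ R ∈ (addZero Q).powerset with R.card ≡ Q.card [MOD 2],
      ((-1) ^ posSum (diffZero Q R) Q * η (diffZero Q R)) • mon α β γ lam R
  apply_g_x : ∀ Q : Finset (Fin n), BA (1 ⊗ₜ[k] (En.g * En.xs Q)) =
    (μ / 2 ^ ((addZero Q).card / 2)) •
      ∑ R ∈ (addZero Q).powerset with R.card ≡ (addZero Q).card [MOD 2],
        ((-1) ^ (posSum R (addZero Q) + ((addZero Q).card - R.card) / 2) * 2 ^ (R.card / 2) *
          ∑ P : PerfectMatching (addZero Q \ R), (P.sgn : k) * P.weight γ lam) • mon α β γ lam R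

end

end Cl

end

/-! Write σ for the automorphism X_i ↦ -X_i (`parity`), D_i for the twisted derivation with D_i X_j
= δ_ij (`contract`), p for the polar form p(i,j) = X_i X_j + X_j X_i (`polar`), and b for B^A(1 ⊗
-). Invariance of B^A amounts to B^A(x ⊗ y) = b(S(x) y), so everything becomes a question about b.
The functionals ε ∘ σ and ε ∘ D_i (i ≥ 1) on E(n) induce σ and D_i on Cl, and colinearity of b says
exactly that b commutes with σ and D_1, …, D_n (`colinear_iff`). The remaining condition is
multiplicative in a, so it is checked on generators (`isRtCasimir_iff`). The tool used throughout is
that an element killed by D_1, …, D_n lies in the span of 1 and G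
(`eq_smul_add_smul_of_contract_eq_zero`); it rests on the monomials X_R being a basis.

The conditions on generators behave differently on the two halves of E(n). On x_Q they say that
κ_j(b(x_Q)) = 0 for all j, where κ_j(a) = a X_j - X_j σ(a) = ∑_l p(j,l) D_l a (`superComm`). On g
x_Q they say that b(g x_Q x_i) = b(g x_Q) ∧ X_i and b(g x_Q) ∧ G = 0, where u ∧ X_j = (u X_j + X_j
σ(u))/2 (`wedgeRight`).

The half g x_Q: b(g) is odd and killed by D_1, …, D_n, so b(g) = μ G, and b(g x_Q) = μ G ∧ X_{i_1} ∧
⋯ ∧ X_{i_s}. Conversely these values always satisfy the conditions, because the operators - ∧ X_j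
anticommute and G ∧ G = 0. Expanding the wedge product in monomials is Wick's formula with Pfaffians
(`repr_wedge_xs`), proved by splitting off the largest index.

The half x_Q: commuting with the D_i determines b(x_Q) from smaller Q up to the span of 1 and G, and
parity leaves one scalar η_Q (`exists_eq_etaSum`). For Q = {i} this reads b(x_i) = X_i + d G, and
κ_j of it is the scalar p(j,i) + d p(j,0). Its vanishing for all j forces p = 0 if α = 0, and forces
every row of p to be a multiple of row 0 if α ≠ 0; these are the cases 1 and 2
(`IsCasimirOne.rtCondition`). In case 1 all κ_j vanish and η is free. In case 2 only κ_0 matters; it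
anticommutes with the D_i and squares to zero, so by induction on |Q| the element κ_0(b(x_Q)) is a
multiple of G for even |Q| and a scalar for odd |Q|. The multiple of G dies because κ_0(G) = 2α ≠ 0,
and the vanishing of the scalar is the recursion for η (`superComm_zero_etaSum`). -/

noncomputable section

/-! ### Polar form, parity, contractions and supercommutators in the Clifford algebra. -/

namespace Cl

section
variable {k : Type*} [Field k] {n : ℕ} {α : k} {β γ : Fin n → k} {lam : Fin n → Fin n → k}

/-- The polar form of the quadratic form of `Cl α β γ lam`: the scalars
`X_i X_j + X_j X_i`. -/
def polar (α : k) (β γ : Fin n → k) (lam : Fin n → Fin n → k) (i j : Fin (n + 1)) : k :=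
  if i < j then lamBar γ lam i j else if j < i then lamBar γ lam j i
  else 2 * (Fin.cons α β : Fin (n + 1) → k) i

theorem polar_of_lt {i j : Fin (n + 1)} (h : i < j) : polar α β γ lam i j = lamBar γ lam i j := by
  simp [polar, h]

theorem polar_comm (i j : Fin (n + 1)) : polar α β γ lam i j = polar α β γ lam j i := by
  unfold polar
  rcases lt_trichotomy i j with h | rfl | h
  · simp [h, h.not_gt]
  · rfl
  · simp [h, h.not_gt]

theorem polar_self (i : Fin (n + 1)) :
    polar α β γ lam i i = 2 * (Fin.cons α β : Fin (n + 1) → k) i := by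
  simp [polar]

theorem lamBar_zero_succ (i : Fin n) : lamBar γ lam 0 i.succ = γ i := by simp [lamBar]

theorem lamBar_succ_succ (i j : Fin n) : lamBar γ lam i.succ j.succ = lam i j := by simp [lamBar]

theorem polar_zero_zero : polar α β γ lam 0 0 = 2 * α := by simp [polar]

theorem polar_zero_succ (i : Fin n) : polar α β γ lam 0 i.succ = γ i := by
  rw [polar_of_lt (Fin.succ_pos i), lamBar_zero_succ]

theorem polar_succ_zero (i : Fin n) : polar α β γ lam i.succ 0 = γ i := by
  rw [polar_comm, polar_zero_succ]

theorem polar_succ_self (i : Fin n) : polar α β γ lam i.succ i.succ = 2 * β i := by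
  simp [polar]

theorem polar_succ_succ {i j : Fin n} (h : i < j) : polar α β γ lam i.succ j.succ = lam i j := by
  rw [polar_of_lt (Fin.succ_lt_succ_iff.2 h), lamBar_succ_succ]

theorem gen_sq (i : Fin (n + 1)) : gen α β γ lam i * gen α β γ lam i =
    algebraMap k _ ((Fin.cons α β : Fin (n + 1) → k) i) := by
  refine Fin.cases ?_ (fun i => ?_) i
  · exact gen_zero_sq
  · exact gen_succ_sq i

theorem gen_mul_gen_add (i j : Fin (n + 1)) :
    gen α β γ lam i * gen α β γ lam j + gen α β γ lam j * gen α β γ lam i =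
      algebraMap k _ (polar α β γ lam i j) := by
  have key : ∀ i j : Fin (n + 1), i < j →
      gen α β γ lam i * gen α β γ lam j + gen α β γ lam j * gen α β γ lam i =
      algebraMap k _ (polar α β γ lam i j) := by
    intro i j hij
    rw [polar_of_lt hij]
    obtain ⟨j, rfl⟩ := Fin.exists_succ_eq.2 (Fin.ne_zero_of_lt hij)
    revert hij
    refine Fin.cases ?_ (fun i => ?_) i
    · intro _
      rw [gen_zero_mul_gen_succ, lamBar_zero_succ]
    · intro hij
      rw [gen_succ_mul_gen_succ (Fin.succ_lt_succ_iff.1 hij), lamBar_succ_succ]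
  rcases lt_trichotomy i j with h | rfl | h
  · exact key i j h
  · rw [gen_sq, polar_self, two_mul, map_add]
  · rw [add_comm, key j i h, polar_comm]

/-- The universal property of the Clifford algebra in terms of the quadratic form and its
polar form. -/
theorem exists_algHom {B : Type*} [Ring B] [Algebra k B] (f : Fin (n + 1) → B)
    (hsq : ∀ i, f i * f i = algebraMap k B ((Fin.cons α β : Fin (n + 1) → k) i))
    (hadd : ∀ i j, i < j → f i * f j + f j * f i = algebraMap k B (polar α β γ lam i j)) :
    ∃ F : Cl α β γ lam →ₐ[k] B, ∀ i, F (gen α β γ lam i) = f i := by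
  refine ⟨lift f (hsq 0) (fun i => hsq i.succ) (fun i => ?_) (fun i j hij => ?_),
    fun i => lift_gen f _ _ _ _ i⟩
  · rw [hadd 0 i.succ (Fin.succ_pos i), polar_zero_succ]
  · rw [hadd _ _ (Fin.succ_lt_succ_iff.2 hij), polar_succ_succ hij]

theorem exists_parity : ∃ F : Cl α β γ lam →ₐ[k] Cl α β γ lam,
    ∀ i, F (gen α β γ lam i) = -gen α β γ lam i :=
  exists_algHom (fun i => -gen α β γ lam i) (fun i => by rw [neg_mul_neg, gen_sq])
    (fun i j _ => by rw [neg_mul_neg, neg_mul_neg, gen_mul_gen_add])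

/-- The grading automorphism `X_i ↦ -X_i`. -/
def parity : Cl α β γ lam →ₐ[k] Cl α β γ lam := exists_parity.choose

@[simp]
theorem parity_gen (i : Fin (n + 1)) : parity (gen α β γ lam i) = -gen α β γ lam i :=
  exists_parity.choose_spec i

@[simp]
theorem parity_parity (a : Cl α β γ lam) : parity (parity a) = a := by
  have : (parity.comp parity : Cl α β γ lam →ₐ[k] Cl α β γ lam) = AlgHom.id k _ := by
    ext i
    simp
  exact DFunLike.congr_fun this a

/-- A twisted derivation is the corner entry of an algebra map to upper triangular matrices. The
matrices given for the generators satisfy the Clifford relations: the diagonals do so for X_j and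
for -X_j, and the corner entries cancel because δ_ij is a scalar. -/
theorem exists_contractMatrix (i : Fin (n + 1)) :
    ∃ F : Cl α β γ lam →ₐ[k] Matrix (Fin 2) (Fin 2) (Cl α β γ lam),
      ∀ j, F (gen α β γ lam j) = !![gen α β γ lam j, if j = i then 1 else 0;
        0, -gen α β γ lam j] := by
  refine exists_algHom _ (fun j => ?_) (fun j l _ => ?_)
  · rw [Matrix.algebraMap_eq_diagonal, Matrix.mul_fin_two]
    ext a b
    fin_cases a <;> fin_cases b <;> split_ifs <;> simp [gen_sq]
  · rw [Matrix.algebraMap_eq_diagonal, Matrix.mul_fin_two, Matrix.mul_fin_two]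
    ext a b
    fin_cases a <;> fin_cases b <;> split_ifs <;> simp [gen_mul_gen_add]

/-- The matrix `a ↦ [[a, D a], [0, σ a]]` defining the contraction `D` with the `i`-th
coordinate. -/
def contractMatrix (i : Fin (n + 1)) :
    Cl α β γ lam →ₐ[k] Matrix (Fin 2) (Fin 2) (Cl α β γ lam) :=
  (exists_contractMatrix i).choose

theorem contractMatrix_gen (i j : Fin (n + 1)) : contractMatrix i (gen α β γ lam j) =
    !![gen α β γ lam j, if j = i then 1 else 0; 0, -gen α β γ lam j] :=
  (exists_contractMatrix i).choose_spec j

/-- The contraction with the `i`-th coordinate: the twisted derivation `D` with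
`D (a b) = D a σ b + a D b` and `D X_j = δ_ij`. -/
def contract (i : Fin (n + 1)) : Cl α β γ lam →ₗ[k] Cl α β γ lam where
  toFun a := contractMatrix i a 0 1
  map_add' a b := by simp
  map_smul' r a := by simp

theorem contractMatrix_apply (i : Fin (n + 1)) (a : Cl α β γ lam) :
    contractMatrix i a 0 0 = a ∧ contractMatrix i a 1 0 = 0 ∧
      contractMatrix i a 1 1 = parity a := by
  induction a using Cl.induction with
  | halg r => simp [Matrix.algebraMap_matrix_apply]
  | hgen j => simp [contractMatrix_gen]
  | hmul a b ha hb =>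
    simp [Matrix.mul_apply, Fin.sum_univ_two, ha, hb]
  | hadd a b ha hb => simp [ha, hb]

theorem contract_mul (i : Fin (n + 1)) (a b : Cl α β γ lam) :
    contract i (a * b) = contract i a * parity b + a * contract i b := by
  simp only [contract, LinearMap.coe_mk, AddHom.coe_mk, map_mul, Matrix.mul_apply,
    Fin.sum_univ_two, (contractMatrix_apply i a).1, (contractMatrix_apply i b).2.2]
  rw [add_comm]

@[simp]
theorem contract_gen (i j : Fin (n + 1)) :
    contract i (gen α β γ lam j) = if j = i then 1 else 0 := by
  simp [contract, contractMatrix_gen]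

@[simp]
theorem contract_algebraMap (i : Fin (n + 1)) (r : k) :
    contract i (algebraMap k (Cl α β γ lam) r) = 0 := by
  simp [contract, Matrix.algebraMap_matrix_apply]

@[simp]
theorem contract_one (i : Fin (n + 1)) : contract i (1 : Cl α β γ lam) = 0 := by
  simpa using contract_algebraMap (α := α) (β := β) (γ := γ) (lam := lam) i 1

theorem contract_mul_gen (i j : Fin (n + 1)) (a : Cl α β γ lam) :
    contract i (a * gen α β γ lam j) =
      -(contract i a * gen α β γ lam j) + if j = i then a else 0 := by
  rw [contract_mul, contract_gen, parity_gen]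
  split_ifs <;> simp

/-- The induction principle for right multiplication by generators. -/
theorem induction_right {C : Cl α β γ lam → Prop} (hone : C 1)
    (hsmul : ∀ (r : k) a, C a → C (r • a)) (hadd : ∀ a b, C a → C b → C (a + b))
    (hgen : ∀ a i, C a → C (a * gen α β γ lam i)) (a : Cl α β γ lam) : C a := by
  -- The general induction multiplies arbitrary elements; carrying a left factor b turns this into
  -- repeated right multiplication by generators.
  suffices h : ∀ b, C b → C (b * a) by simpa using h 1 hone
  induction a using Cl.induction with
  | halg r =>
    intro b hb
    rw [← Algebra.commutes, ← Algebra.smul_def]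
    exact hsmul r b hb
  | hgen i => exact fun b hb => hgen b i hb
  | hmul c d hc hd =>
    intro b hb
    rw [← mul_assoc]
    exact hd _ (hc b hb)
  | hadd c d hc hd =>
    intro b hb
    rw [mul_add]
    exact hadd _ _ (hc b hb) (hd b hb)

theorem contract_parity (i : Fin (n + 1)) (a : Cl α β γ lam) :
    contract i (parity a) = -parity (contract i a) := by
  induction a using induction_right with
  | hone => simp
  | hsmul r a ha => simp [ha]
  | hadd a b ha hb => simp [ha, hb, add_comm]
  | hgen a j ha =>
    rw [contract_mul_gen, map_mul, parity_gen, mul_neg, map_neg, contract_mul_gen, ha]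
    split_ifs <;> simp

theorem contract_contract (i j : Fin (n + 1)) (a : Cl α β γ lam) :
    contract i (contract j a) = -contract j (contract i a) := by
  induction a using induction_right with
  | hone => simp
  | hsmul r a ha => simp [ha]
  | hadd a b ha hb => simp [ha, hb, add_comm]
  | hgen a l ha =>
    rw [contract_mul_gen, contract_mul_gen, map_add, map_add, map_neg, map_neg, contract_mul_gen,
      contract_mul_gen, ha]
    split_ifs <;> simp [add_assoc]

/-- The supercommutator `a X_j - X_j σ(a)`, as a combination of contractions. -/
theorem mul_gen_sub (j : Fin (n + 1)) (a : Cl α β γ lam) :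
    a * gen α β γ lam j - gen α β γ lam j * parity a =
      ∑ l, polar α β γ lam j l • contract l a := by
  induction a using induction_right with
  | hone => simp
  | hsmul r a ha =>
    simp only [map_smul, smul_mul_assoc, mul_smul_comm, ← smul_sub, ha, Finset.smul_sum]
    exact Finset.sum_congr rfl fun l _ => smul_comm _ _ _
  | hadd a b ha hb =>
    simp only [map_add, add_mul, mul_add, smul_add, Finset.sum_add_distrib, ← ha, ← hb]
    abel
  | hgen a i ha =>
    simp only [contract_mul_gen, smul_add, smul_neg, Finset.sum_add_distrib,
      Finset.sum_neg_distrib, ← smul_mul_assoc, ← Finset.sum_mul, ← ha]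
    -- The only new term on the right is p(j,i) a; with p(j,i) written as X_j X_i + X_i X_j, the
    -- claim becomes an identity between words.
    have h := gen_mul_gen_add (α := α) (β := β) (γ := γ) (lam := lam) j i
    simp only [smul_ite, smul_zero, Finset.sum_ite_eq, Finset.mem_univ, if_true]
    rw [Algebra.smul_def, Algebra.commutes, ← h, map_mul, parity_gen]
    noncomm_ring

end

end Cl

end

/-! ### The basis of monomials X_R and coordinates in it. -/

theorem Finset.sort_insert_of_forall_lt {ι : Type*} [LinearOrder ι] {a : ι} {s : Finset ι}
    (h : ∀ x ∈ s, x < a) : (insert a s).sort = s.sort ++ [a] := by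
  refine (Finset.sortedLT_sort _).eq_of_mem_iff ?_ (by simp [or_comm])
  rw [List.sortedLT_iff_pairwise, List.pairwise_append]
  exact ⟨List.sortedLT_iff_pairwise.1 (Finset.sortedLT_sort _), by simp, by simpa using h⟩

noncomputable section

namespace Cl

section
variable {k : Type*} [Field k] {n : ℕ} {α : k} {β γ : Fin n → k} {lam : Fin n → Fin n → k}

@[simp]
theorem mon_empty : mon α β γ lam ∅ = 1 := by simp [mon]

@[simp]
theorem mon_singleton (i : Fin (n + 1)) : mon α β γ lam {i} = gen α β γ lam i := by simp [mon]

theorem mon_insert_of_forall_lt {j : Fin (n + 1)} {S : Finset (Fin (n + 1))}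
    (h : ∀ i ∈ S, i < j) :
    mon α β γ lam (insert j S) = mon α β γ lam S * gen α β γ lam j := by
  simp [mon, Finset.sort_insert_of_forall_lt h]

theorem mon_insert_of_forall_gt {j : Fin (n + 1)} {S : Finset (Fin (n + 1))}
    (h : ∀ i ∈ S, j < i) :
    mon α β γ lam (insert j S) = gen α β γ lam j * mon α β γ lam S := by
  simp [mon, Finset.sort_insert (· ≤ ·) (fun i hi => (h i hi).le)
    (fun hj => lt_irrefl _ (h j hj))]

theorem parity_mon (S : Finset (Fin (n + 1))) :
    parity (mon α β γ lam S) = (-1 : k) ^ S.card • mon α β γ lam S := by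
  induction S using Finset.induction_on_max with
  | empty => simp
  | insert j S hS ih =>
    rw [mon_insert_of_forall_lt hS, map_mul, ih, parity_gen,
      Finset.card_insert_of_notMem fun h => lt_irrefl _ (hS j h), pow_succ]
    simp

/-- The twist of D_i sits on the right factor, so X_i is reached from the right and each generator
of larger index costs a sign. -/
theorem contract_mon (i : Fin (n + 1)) (S : Finset (Fin (n + 1))) :
    contract i (mon α β γ lam S) =
      if i ∈ S then (-1 : k) ^ (S.filter (i < ·)).card • mon α β γ lam (S.erase i) else 0 := by
  induction S using Finset.induction_on_max with
  | empty => simp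
  | insert j S hS ih =>
    have hj : j ∉ S := fun h => lt_irrefl _ (hS j h)
    rw [mon_insert_of_forall_lt hS, contract_mul_gen, ih]
    by_cases hij : j = i
    · subst hij
      rw [if_neg hj, if_pos rfl, if_pos (Finset.mem_insert_self _ _), Finset.erase_insert hj,
        Finset.filter_insert, if_neg (lt_irrefl _), Finset.filter_false_of_mem]
      · simp
      · exact fun x hx => (hS x hx).not_gt
    · rw [if_neg hij, add_zero]
      by_cases hi : i ∈ S
      · rw [if_pos hi, if_pos (Finset.mem_insert_of_mem hi), Finset.erase_insert_of_ne hij,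
          mon_insert_of_forall_lt fun x hx => hS x (Finset.mem_of_mem_erase hx),
          Finset.filter_insert, if_pos (hS i hi), Finset.card_insert_of_notMem, pow_succ]
        · simp
        · simp [hj]
      · rw [if_neg hi, if_neg (by simp [hi, Ne.symm hij])]
        simp

/-- The bound U ⊆ S ∪ {j} is needed twice: in the induction it keeps all indices below the maximum
m, so that X_m can be appended without reordering, and in `En.xs_mul_x_mem` it shows that g never
appears. -/
theorem mon_mul_gen_mem (S : Finset (Fin (n + 1))) (j : Fin (n + 1)) :
    mon α β γ lam S * gen α β γ lam j ∈
      Submodule.span k (mon α β γ lam '' {U | U ⊆ insert j S}) := by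
  induction S using Finset.induction_on_max generalizing j with
  | empty =>
    refine Submodule.subset_span ⟨{j}, by simp, by simp⟩
  | insert m S hS ih =>
    rw [mon_insert_of_forall_lt hS, mul_assoc]
    have hmon : mon α β γ lam S ∈
        Submodule.span k (mon α β γ lam '' {U | U ⊆ insert j (insert m S)}) :=
      Submodule.subset_span ⟨S, fun x hx => by simp [hx], rfl⟩
    rcases lt_trichotomy j m with h | rfl | h
    · rw [eq_sub_of_add_eq (gen_mul_gen_add m j), mul_sub, ← Algebra.commutes, ← Algebra.smul_def]
      refine sub_mem (Submodule.smul_mem _ _ hmon) ?_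
      rw [← mul_assoc]
      have hle : Submodule.span k (mon α β γ lam '' {U | U ⊆ insert j S}) ≤
          (Submodule.span k (mon α β γ lam '' {U | U ⊆ insert j (insert m S)})).comap
            (LinearMap.mulRight k (gen α β γ lam m)) := by
        rw [Submodule.span_le]
        rintro _ ⟨U, hU, rfl⟩
        refine Submodule.subset_span ⟨insert m U, ?_, ?_⟩
        · rw [Set.mem_ofPred_eq, Finset.insert_comm]
          exact Finset.insert_subset_insert m hU
        · rw [mon_insert_of_forall_lt]
          · rfl
          · intro x hx
            rcases Finset.mem_insert.1 (hU hx) with rfl | hx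
            · exact h
            · exact hS x hx
      exact hle (ih j)
    · rw [gen_sq, ← Algebra.commutes, ← Algebra.smul_def]
      exact Submodule.smul_mem _ _ hmon
    · rw [← mul_assoc, ← mon_insert_of_forall_lt hS, ← mon_insert_of_forall_lt]
      · exact Submodule.subset_span ⟨_, Finset.Subset.refl _, rfl⟩
      · intro x hx
        rcases Finset.mem_insert.1 hx with rfl | hx
        · exact h
        · exact (hS x hx).trans h

theorem span_mon : Submodule.span k (Set.range (mon α β γ lam)) = ⊤ := by
  rw [eq_top_iff]
  rintro a -
  induction a using induction_right with
  | hone => exact Submodule.subset_span ⟨∅, mon_empty⟩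
  | hsmul r a ha => exact Submodule.smul_mem _ _ ha
  | hadd a b ha hb => exact add_mem ha hb
  | hgen a i ha =>
    have hle : Submodule.span k (Set.range (mon α β γ lam)) ≤
        (Submodule.span k (Set.range (mon α β γ lam))).comap
          (LinearMap.mulRight k (gen α β γ lam i)) := by
      rw [Submodule.span_le]
      rintro _ ⟨U, rfl⟩
      exact Submodule.span_mono (Set.image_subset_range _ _) (mon_mul_gen_mem U i)
    exact hle ha

/-- The bilinear form, upper triangular in the standard basis, with quadratic form
`v ↦ (∑ v_i X_i)²`. -/
def bilin (α : k) (β γ : Fin n → k) (lam : Fin n → Fin n → k) :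
    LinearMap.BilinForm k (Fin (n + 1) → k) :=
  Matrix.toBilin' (Matrix.of fun i j => if i < j then lamBar γ lam i j else
    if i = j then (Fin.cons α β : Fin (n + 1) → k) i else 0)

/-- Any algebra map to a nonzero ring suffices. The target is the Clifford algebra of a quadratic
form with the prescribed squares and polar form, which is nonzero since 2 is invertible. -/
theorem nontrivial (hk : (2 : k) ≠ 0) : Nontrivial (Cl α β γ lam) := by
  classical
  let Q : QuadraticForm k (Fin (n + 1) → k) := (bilin α β γ lam).toQuadraticMap
  let e : Fin (n + 1) → Fin (n + 1) → k := fun i => Pi.single i 1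
  have he : ∀ i j, bilin α β γ lam (e i) (e j) = if i < j then lamBar γ lam i j else
      if i = j then (Fin.cons α β : Fin (n + 1) → k) i else 0 := by
    intro i j
    simp [bilin, e, Matrix.toBilin'_single]
  obtain ⟨F, -⟩ := exists_algHom (α := α) (β := β) (γ := γ) (lam := lam)
    (fun i => CliffordAlgebra.ι Q (e i))
    (fun i => by
      rw [CliffordAlgebra.ι_sq_scalar, LinearMap.BilinMap.toQuadraticMap_apply, he]
      simp)
    (fun i j hij => by
      rw [CliffordAlgebra.ι_mul_ι_add_swap, LinearMap.BilinMap.polar_toQuadraticMap, he, he,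
        polar_of_lt hij]
      simp [hij, hij.not_gt, hij.ne'])
  have : Invertible (2 : k) := invertibleOfNonzero hk
  exact F.toRingHom.domain_nontrivial

/-- Contracting a linear relation successively with the indices of an inclusion-maximal S in its
support leaves ± f(S) · 1 = 0, and 1 ≠ 0. -/
theorem linearIndependent_mon (hk : (2 : k) ≠ 0) : LinearIndependent k (mon α β γ lam) := by
  have := nontrivial (α := α) (β := β) (γ := γ) (lam := lam) hk
  have key : ∀ (m : ℕ) (f : Finset (Fin (n + 1)) → k), ∑ S, f S • mon α β γ lam S = 0 →
      ∀ S, S.card = m → (∀ U, S ⊂ U → f U = 0) → f S = 0 := by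
    intro m
    induction m with
    | zero =>
      intro f hf S hS hU
      obtain rfl := Finset.card_eq_zero.1 hS
      rw [Finset.sum_eq_single ∅ (fun U _ h => by
        rw [hU U (Finset.empty_ssubset.2 (Finset.nonempty_iff_ne_empty.2 h)), zero_smul])
        (by simp), mon_empty] at hf
      exact (smul_eq_zero_iff_left one_ne_zero).1 hf
    | succ m ih =>
      intro f hf S hS hU
      obtain ⟨i, hi⟩ : S.Nonempty := Finset.card_pos.1 (by omega)
      have h1 := congrArg (contract i) hf
      rw [map_sum, map_zero] at h1
      -- D_i turns the relation into one whose coefficient at V, for i ∉ V, is ± f(V ∪ {i}).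
      have h2 := ih (fun V => if i ∈ V then 0 else
        f (insert i V) * (-1 : k) ^ ((insert i V).filter (i < ·)).card) ?_ (S.erase i)
        (by rw [Finset.card_erase_of_mem hi, hS]; rfl) ?_
      · simpa [Finset.insert_erase hi] using h2
      · rw [← h1]
        symm
        simp only [map_smul, contract_mon, smul_ite, smul_zero, ite_smul, zero_smul, smul_smul]
        simp only [Finset.sum_ite, Finset.sum_const_zero, add_zero, zero_add]
        refine Finset.sum_nbij' (fun U => U.erase i) (fun V => insert i V) ?_ ?_ ?_ ?_ ?_
        · simp
        · simp
        · intro U hU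
          simp only [Finset.mem_filter] at hU
          exact Finset.insert_erase hU.2
        · intro U hU
          simp only [Finset.mem_filter] at hU
          exact Finset.erase_insert hU.2
        · intro U hU
          simp only [Finset.mem_filter] at hU
          rw [Finset.insert_erase hU.2]
      · intro V hV
        split_ifs with hiV
        · rfl
        · rw [hU, zero_mul]
          refine Finset.ssubset_iff_subset_ne.2 ⟨?_, ?_⟩
          · rw [← Finset.insert_erase hi]
            exact Finset.insert_subset_insert i hV.1
          · rintro rfl
            simp [Finset.erase_insert hiV] at hV
  rw [Fintype.linearIndependent_iff]
  intro f hf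
  by_contra! h
  obtain ⟨S, hS⟩ := h
  -- A set of largest cardinality in the support has no strict superset there, as `key` requires.
  obtain ⟨U, hU, hmax⟩ := Set.Finite.exists_maximalFor Finset.card {S | f S ≠ 0}
    (Set.toFinite _) ⟨S, hS⟩
  refine hU (key _ f hf U rfl fun V hV => ?_)
  by_contra hne
  exact (Finset.card_lt_card hV).not_ge (hmax hne (Finset.card_lt_card hV).le)

/-- The basis of the monomials `X_R`. -/
def monBasis (α : k) (β γ : Fin n → k) (lam : Fin n → Fin n → k) (hk : (2 : k) ≠ 0) :
    Module.Basis (Finset (Fin (n + 1))) k (Cl α β γ lam) :=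
  Module.Basis.mk (linearIndependent_mon hk) span_mon.ge

@[simp]
theorem monBasis_apply (hk : (2 : k) ≠ 0) (S : Finset (Fin (n + 1))) :
    monBasis α β γ lam hk S = mon α β γ lam S := by
  simp [monBasis]

@[simp]
theorem repr_mon (hk : (2 : k) ≠ 0) (S R : Finset (Fin (n + 1))) :
    (monBasis α β γ lam hk).repr (mon α β γ lam S) R = if S = R then 1 else 0 := by
  rw [← monBasis_apply hk, Module.Basis.repr_self, Finsupp.single_apply]

theorem mon_ext {M : Type*} [AddCommGroup M] [Module k M] {f g : Cl α β γ lam →ₗ[k] M}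
    (h : ∀ S, f (mon α β γ lam S) = g (mon α β γ lam S)) : f = g :=
  LinearMap.ext_on_range span_mon h

theorem repr_parity (hk : (2 : k) ≠ 0) (a : Cl α β γ lam) (R : Finset (Fin (n + 1))) :
    (monBasis α β γ lam hk).repr (parity a) R =
      (-1) ^ R.card * (monBasis α β γ lam hk).repr a R := by
  have : (monBasis α β γ lam hk).coord R ∘ₗ parity.toLinearMap =
      (-1 : k) ^ R.card • (monBasis α β γ lam hk).coord R := by
    refine mon_ext fun S => ?_
    simp only [LinearMap.comp_apply, AlgHom.toLinearMap_apply, parity_mon, map_smul,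
      LinearMap.smul_apply, Module.Basis.coord_apply, repr_mon]
    split_ifs with h
    · rw [h]
    · simp
  exact LinearMap.congr_fun this a

theorem repr_contract (hk : (2 : k) ≠ 0) (i : Fin (n + 1)) (a : Cl α β γ lam)
    (R : Finset (Fin (n + 1))) :
    (monBasis α β γ lam hk).repr (contract i a) R = if i ∈ R then 0 else
      (-1) ^ (R.filter (i < ·)).card * (monBasis α β γ lam hk).repr a (insert i R) := by
  have : (monBasis α β γ lam hk).coord R ∘ₗ contract i = if i ∈ R then 0 else
      (-1 : k) ^ (R.filter (i < ·)).card • (monBasis α β γ lam hk).coord (insert i R) := by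
    refine mon_ext fun S => ?_
    simp only [LinearMap.comp_apply, contract_mon]
    by_cases hi : i ∈ R
    · rw [if_pos hi]
      by_cases hS : i ∈ S
      · rw [if_pos hS, map_smul, Module.Basis.coord_apply, repr_mon, if_neg]
        · simp
        · rintro rfl
          simp at hi
      · simp [hS]
    · rw [if_neg hi]
      by_cases hS : i ∈ S
      · simp only [if_pos hS, map_smul, Module.Basis.coord_apply, repr_mon, LinearMap.smul_apply]
        by_cases h : S.erase i = R
        · subst h
          rw [Finset.insert_erase hS, if_pos rfl, if_pos rfl]
          congr 3
          ext x
          simp only [Finset.mem_filter, Finset.mem_erase]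
          exact ⟨fun h => ⟨⟨h.2.ne', h.1⟩, h.2⟩, fun h => ⟨h.1.2, h.2⟩⟩
        · rw [if_neg h, if_neg]
          · simp
          · rintro rfl
            exact h (Finset.erase_insert hi)
      · rw [if_neg hS, map_zero, LinearMap.smul_apply, Module.Basis.coord_apply, repr_mon, if_neg,
          smul_zero]
        rintro rfl
        simp at hS
  have h := LinearMap.congr_fun this a
  simp only [LinearMap.comp_apply, Module.Basis.coord_apply] at h
  rw [h]
  split_ifs <;> simp

/-- If R contains some i ≥ 1, the coefficient of X_R in a is, up to sign, that of X_{R \ {i}} in D_i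
a. Hence the contractions D_1, …, D_n determine an element up to the span of 1 and G; the later
inductions on |Q| all use this. -/
theorem eq_smul_add_smul_of_contract_eq_zero (hk : (2 : k) ≠ 0) {a : Cl α β γ lam}
    (h : ∀ i : Fin n, contract i.succ a = 0) :
    a = (monBasis α β γ lam hk).repr a ∅ • 1 +
      (monBasis α β γ lam hk).repr a {0} • gen α β γ lam 0 := by
  refine (monBasis α β γ lam hk).ext_elem fun R => ?_
  rw [← mon_empty, ← mon_singleton, map_add, map_smul, map_smul]
  simp only [Finsupp.add_apply, Finsupp.smul_apply, repr_mon, smul_eq_mul, mul_ite, mul_one,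
    mul_zero]
  by_cases hR : ∃ i : Fin n, i.succ ∈ R
  · obtain ⟨i, hi⟩ := hR
    have h1 := repr_contract hk i.succ a (R.erase i.succ)
    rw [h, if_neg (Finset.notMem_erase _ _), Finset.insert_erase hi] at h1
    rw [if_neg, if_neg]
    · simpa using h1
    · rintro rfl
      exact Fin.succ_ne_zero i (Finset.mem_singleton.1 hi)
    · rintro rfl
      simp at hi
  · push Not at hR
    have hsub : R ⊆ {0} := by
      intro j hj
      refine Fin.cases (fun _ => by simp) (fun i hi => absurd hi (hR i)) j hj
    rcases Finset.subset_singleton_iff.1 hsub with rfl | rfl <;> simp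

theorem algebraMap_eq_zero (hk : (2 : k) ≠ 0) {r : k}
    (h : algebraMap k (Cl α β γ lam) r = 0) : r = 0 := by
  have := nontrivial (α := α) (β := β) (γ := γ) (lam := lam) hk
  exact (map_eq_zero_iff _ (algebraMap k (Cl α β γ lam)).injective).1 h

end

end Cl

end

/-! ### Colinearity through contractions, and the Casimir conditions on generators. -/

noncomputable section

namespace Cl

section
variable {k : Type*} [Field k] {n : ℕ} {α : k} {β γ : Fin n → k} {lam : Fin n → Fin n → k}

theorem coact_parity (a : Cl α β γ lam) : coact α β γ lam (parity a) =
    (parity (α := (1 : k)) (β := 0) (γ := 0) (lam := 0)).toLinearMap.lTensor _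
      (coact α β γ lam a) := by
  have : (coact α β γ lam).comp parity =
      (Algebra.TensorProduct.map (.id k _) parity).comp (coact α β γ lam) := by
    ext i
    refine Fin.cases ?_ (fun i => ?_) i
    · simp [coact_gen_zero, En.g, TensorProduct.tmul_neg]
    · simp [coact_gen_succ, En.g, En.x, TensorProduct.tmul_neg, add_comm]
  exact DFunLike.congr_fun this a

theorem lTensor_contract_mul {B : Type*} [Ring B] [Algebra k B] (i : Fin (n + 1))
    (s t : B ⊗[k] Cl α β γ lam) :
    (contract i).lTensor B (s * t) =
      (contract i).lTensor B s * parity.toLinearMap.lTensor B t +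
        s * (contract i).lTensor B t := by
  induction s with
  | zero => simp
  | add u v hu hv => simp only [add_mul, map_add, hu, hv]; abel
  | tmul u v =>
    induction t with
    | zero => simp
    | add u v hu hv => simp only [mul_add, map_add, hu, hv]; abel
    | tmul x y => simp [contract_mul, TensorProduct.tmul_add]

/-- Applying the counit to the second factor gives D_i a = a₀ ε(D_i a₁), so D_i comes from a
functional on E(n). This fails for D_0, since ρ(D_0 G) = 1 ⊗ 1 while (id ⊗ D_0)(G ⊗ g) = G ⊗ 1. -/
theorem coact_contract (i : Fin n) (a : Cl α β γ lam) : coact α β γ lam (contract i.succ a) =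
    (contract (α := (1 : k)) (β := 0) (γ := 0) (lam := 0) i.succ).lTensor _
      (coact α β γ lam a) := by
  induction a using induction_right with
  | hone => simp [Algebra.TensorProduct.one_def]
  | hsmul r a ha => simp [ha]
  | hadd a b ha hb => simp [ha, hb]
  | hgen a j ha =>
    rw [contract_mul, map_add, map_mul, map_mul, map_mul, coact_parity, ha, lTensor_contract_mul]
    congr 2
    refine Fin.cases ?_ (fun j => ?_) j
    · simp [coact_gen_zero, En.g, (Fin.succ_ne_zero i).symm]
    · simp only [contract_gen, coact_gen_succ, map_add, LinearMap.lTensor_tmul, En.g, En.x,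
        (Fin.succ_ne_zero i).symm, if_false, TensorProduct.tmul_zero, zero_add]
      split_ifs <;> simp [Algebra.TensorProduct.one_def]

theorem lTensor_counit_coact (a : Cl α β γ lam) :
    (Coalgebra.counit (R := k) (A := En k n)).lTensor _ (coact α β γ lam a) = a ⊗ₜ[k] 1 :=
  LinearMap.congr_fun (comoduleAlgebra α β γ lam).counit a

theorem comul_eq_coact (h : En k n) : Coalgebra.comul (R := k) h = coact 1 0 0 0 h := rfl

/-- An element of `M ⊗ E(n)` on which the contractions and the counit vanish and which is
homogeneous is `0`. -/
theorem eq_zero_of_lTensor (hk : (2 : k) ≠ 0) {M ι : Type*} [AddCommGroup M] [Module k M]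
    [DecidableEq ι] (b : Module.Basis ι k M) {z : M ⊗[k] En k n} (s : k) (hs : s = 1 ∨ s = -1)
    (h : ∀ i : Fin n,
      (contract (α := (1 : k)) (β := 0) (γ := 0) (lam := 0) i.succ).lTensor M z = 0)
    (hε : (Coalgebra.counit (R := k) (A := En k n)).lTensor M z = 0)
    (hσ : (parity (α := (1 : k)) (β := 0) (γ := 0) (lam := 0)).toLinearMap.lTensor M z = s • z) :
    z = 0 := by
  classical
  have hcoord : ∀ (N : Type _) [AddCommGroup N] [Module k N] (f : En k n →ₗ[k] N) (w : ι)
      (z : M ⊗[k] En k n),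
      TensorProduct.lid k N ((b.coord w).rTensor N (f.lTensor M z)) =
        f (TensorProduct.lid k _ ((b.coord w).rTensor (En k n) z)) := by
    intro N _ _ f w z
    induction z with
    | zero => simp
    | add u v hu hv => simp only [map_add, hu, hv]
    | tmul u v => simp
  -- Taking the coordinate at each basis vector of M reduces the claim to a single element y of
  -- E(n).
  refine (TensorProduct.equivFinsuppOfBasisLeft b).injective (Finsupp.ext fun w => ?_)
  rw [map_zero, Finsupp.zero_apply, TensorProduct.equivFinsuppOfBasisLeft_apply]
  have h1 := fun i => hcoord _ (contract (α := (1 : k)) (β := 0) (γ := 0) (lam := 0) (Fin.succ i))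
    w z
  have h2 := hcoord _ (parity (α := (1 : k)) (β := 0) (γ := 0) (lam := 0)).toLinearMap w z
  have h3 := hcoord _ (Coalgebra.counit (R := k) (A := En k n)) w z
  simp only [h, map_zero] at h1
  rw [hε, map_zero, map_zero] at h3
  rw [hσ, map_smul, map_smul] at h2
  generalize TensorProduct.lid k _ ((b.coord w).rTensor (En k n) z) = y at h1 h2 h3
  have hy := eq_smul_add_smul_of_contract_eq_zero hk fun i => (h1 i).symm
  generalize (monBasis (1 : k) 0 0 0 hk).repr y ∅ = c at hy
  generalize (monBasis (1 : k) 0 0 0 hk).repr y {0} = d at hy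
  subst hy
  rw [En.counit_eq, map_add, map_smul, map_smul, map_one] at h3
  have hg : En.counitHom k n (gen 1 0 0 0 0) = 1 := En.counitHom_g
  rw [hg, smul_eq_mul, smul_eq_mul, mul_one, mul_one] at h3
  -- Now y = c (1 - g), which mixes an even and an odd part; homogeneity forces 2c = 0.
  obtain rfl : d = -c := eq_neg_of_add_eq_zero_right h3.symm
  rw [AlgHom.toLinearMap_apply, map_add, map_smul, map_smul, map_one, parity_gen] at h2
  have h4 := congrArg (fun v => (monBasis (1 : k) 0 0 0 hk).repr v ∅) h2
  have h5 := congrArg (fun v => (monBasis (1 : k) 0 0 0 hk).repr v {0}) h2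
  simp only [← mon_empty (α := (1 : k)) (β := (0 : Fin n → k)) (γ := 0) (lam := 0),
    ← mon_singleton, map_add, map_smul, map_neg, Finsupp.add_apply, Finsupp.smul_apply,
    Finsupp.neg_apply, repr_mon] at h4 h5
  simp at h4 h5
  have hc : 2 * c = 0 := by
    rcases hs with rfl | rfl
    · linear_combination -h5
    · linear_combination -h4
  rw [mul_eq_zero, or_iff_right hk] at hc
  simp [hc]

/-- `E(n)`-colinearity of a map to `Cl α β γ lam`, in terms of the parity automorphism and of the
contractions. -/
theorem colinear_iff (hk : (2 : k) ≠ 0) (b : En k n →ₗ[k] Cl α β γ lam) :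
    (∀ h, coact α β γ lam (b h) = b.rTensor _ (Coalgebra.comul (R := k) h)) ↔
      (∀ h, b (parity h) = parity (b h)) ∧
        ∀ (i : Fin n) h, b (contract i.succ h) = contract i.succ (b h) := by
  have hcomm : ∀ (N : Type _) [AddCommGroup N] [Module k N] (f : En k n →ₗ[k] N)
      (t : En k n ⊗[k] En k n), f.lTensor _ (b.rTensor _ t) = b.rTensor _ (f.lTensor _ t) := by
    intro N _ _ f t
    rw [← LinearMap.comp_apply, ← LinearMap.comp_apply, LinearMap.lTensor_comp_rTensor,
      LinearMap.rTensor_comp_lTensor]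
  have hε : ∀ h : En k n, (Coalgebra.counit (R := k)).lTensor _
      (b.rTensor _ (Coalgebra.comul (R := k) h)) = b h ⊗ₜ[k] (1 : k) := by
    intro h
    rw [hcomm, Coalgebra.lTensor_counit_comul]
    simp
  have hinj : Function.Injective fun a : Cl α β γ lam => a ⊗ₜ[k] (1 : k) :=
    (TensorProduct.rid k (Cl α β γ lam)).symm.injective
  constructor
  -- Apply id ⊗ (ε ∘ f) to the colinearity identity, with f = σ or f = D_i; since f acts on the
  -- second factor and b on the first, they commute.
  · intro H
    refine ⟨fun h => hinj ?_, fun i h => hinj ?_⟩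
    · dsimp only
      rw [← hε, comul_eq_coact, coact_parity, ← comul_eq_coact, ← hcomm, ← H, ← coact_parity,
        lTensor_counit_coact]
    · dsimp only
      rw [← hε, comul_eq_coact, coact_contract, ← comul_eq_coact, ← hcomm, ← H, ← coact_contract,
        lTensor_counit_coact]
  · rintro ⟨h1, h2⟩
    -- The defect of colinearity on a monomial has counit 0 and is homogeneous, and its contractions
    -- are defects on smaller monomials, so induction on the degree applies through
    -- `eq_zero_of_lTensor`.
    suffices key : ∀ (m : ℕ) (S : Finset (Fin (n + 1))), S.card = m →
        coact α β γ lam (b (mon 1 0 0 0 S)) -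
          b.rTensor _ (Coalgebra.comul (R := k) (mon 1 0 0 0 S : En k n)) = 0 by
      have : (coact α β γ lam).toLinearMap ∘ₗ b = b.rTensor _ ∘ₗ Coalgebra.comul (R := k) :=
        mon_ext fun S => sub_eq_zero.1 (key _ S rfl)
      exact LinearMap.congr_fun this
    intro m
    induction m with
    | zero =>
      intro S hS
      obtain rfl := Finset.card_eq_zero.1 hS
      refine eq_zero_of_lTensor hk (monBasis α β γ lam hk) 1 (.inl rfl) (fun i => ?_) ?_ ?_
      · rw [map_sub, ← coact_contract, hcomm, comul_eq_coact, ← coact_contract, ← h2]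
        simp
      · rw [map_sub, hε, lTensor_counit_coact, sub_self]
      · rw [map_sub, ← coact_parity, hcomm, comul_eq_coact, ← coact_parity, ← h1]
        simp
    | succ m ih =>
      intro S hS
      refine eq_zero_of_lTensor hk (monBasis α β γ lam hk) ((-1) ^ S.card)
        (neg_one_pow_eq_or k _) (fun i => ?_) ?_ ?_
      · rw [map_sub, ← coact_contract, hcomm, comul_eq_coact, ← coact_contract, ← h2,
          contract_mon]
        split_ifs with hi
        · have := ih (S.erase i.succ) (by rw [Finset.card_erase_of_mem hi, hS]; rfl)
          rw [map_smul, map_smul, map_smul, map_smul]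
          exact sub_eq_zero.2 (congrArg (fun v => (-1 : k) ^ (S.filter (i.succ < ·)).card • v)
            (sub_eq_zero.1 this))
        · simp
      · rw [map_sub, hε, lTensor_counit_coact, sub_self]
      · rw [map_sub, ← coact_parity, hcomm, comul_eq_coact, ← coact_parity, ← h1, parity_mon,
          map_smul, map_smul, map_smul, map_smul, smul_sub]

theorem antipode_g : HopfAlgebra.antipode k (En.g : En k n) = En.g := En.antipodeMap_g

theorem antipode_x (i : Fin n) : HopfAlgebra.antipode k (En.x i : En k n) = En.g * En.x i :=
  En.antipodeMap_x i

theorem antipode_mul' (a b : En k n) : HopfAlgebra.antipode k (a * b) =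
    HopfAlgebra.antipode k b * HopfAlgebra.antipode k a := En.antipodeMap_mul a b

theorem antipode_one' : HopfAlgebra.antipode k (1 : En k n) = 1 := En.antipodeMap_one

theorem comul_g : Coalgebra.comul (R := k) (En.g : En k n) = En.g ⊗ₜ[k] En.g := En.comulHom_g

theorem comul_x (i : Fin n) : Coalgebra.comul (R := k) (En.x i : En k n) =
    En.x i ⊗ₜ[k] En.g + 1 ⊗ₜ[k] En.x i := En.comulHom_x i

/-- The conditions on `b = B^A(1 ⊗ -)` equivalent to `B^A` being a normalized Casimir
morphism, on generators. -/
structure IsCasimirOne (b : En k n →ₗ[k] Cl α β γ lam) : Prop where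
  apply_g_mul_g : ∀ m, gen α β γ lam 0 * b (En.g * m * En.g) = b m * gen α β γ lam 0
  apply_mul_x : ∀ (i : Fin n) m, gen α β γ lam i.succ * b (En.g * m * En.g) +
    b (En.g * En.x i * m * En.g) + b (m * En.x i) = b m * gen α β γ lam i.succ
  apply_parity : ∀ m, b (parity m) = parity (b m)
  apply_contract : ∀ (i : Fin n) m, b (contract i.succ m) = contract i.succ (b m)
  apply_one : b 1 = 1

/-- Invariance reduces B^A to b = B^A(1 ⊗ -), colinearity becomes commutation with σ and the D_i,
and the condition in a ∈ A, being multiplicative in a, is tested on G and the X_i. -/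
theorem isRtCasimir_iff (hk : (2 : k) ≠ 0) (BA : En k n ⊗[k] En k n →ₗ[k] Cl α β γ lam) :
    (comoduleAlgebra α β γ lam).IsRtCasimir BA ↔
      (∀ x y, BA (x ⊗ₜ[k] y) = BA (1 ⊗ₜ[k] (HopfAlgebra.antipode k x * y))) ∧
        IsCasimirOne (BA ∘ₗ TensorProduct.mk k _ _ 1) := by
  rw [ComoduleAlgebra.isRtCasimir_iff]
  have hcol := colinear_iff hk (BA ∘ₗ TensorProduct.mk k _ _ 1)
  simp only [comoduleAlgebra]
  constructor
  · rintro ⟨h1, h2, h3, h4⟩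
    have hS := ComoduleAlgebra.apply_tmul_of_invariant h3
    obtain ⟨h5, h6⟩ := hcol.1 h2
    refine ⟨hS, fun m => ?_, fun i m => ?_, h5, h6, h4⟩
    · have := h1 (1 ⊗ₜ[k] m) (gen α β γ lam 0)
      simp only [coact_gen_zero, LinearMap.lTensor_tmul, LinearMap.mul'_apply,
        LinearMap.comp_apply, LinearMap.mulLeft_apply, comul_g,
        Algebra.TensorProduct.tmul_mul_tmul, one_mul, hS En.g, antipode_g] at this
      simpa [mul_assoc] using this
    · have := h1 (1 ⊗ₜ[k] m) (gen α β γ lam i.succ)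
      simp only [coact_gen_succ, LinearMap.lTensor_tmul, LinearMap.mul'_apply, map_add,
        LinearMap.comp_apply, LinearMap.mulLeft_apply, comul_g, comul_x, mul_add,
        Algebra.TensorProduct.tmul_mul_tmul, one_mul, hS En.g, hS (En.x i), antipode_g,
        antipode_x] at this
      simpa [mul_assoc, add_assoc] using this
  · rintro ⟨hS, h1, h2, h3, h4, h5⟩
    simp only [LinearMap.comp_apply, TensorProduct.mk_apply] at h1 h2
    refine ⟨fun z a => ?_, hcol.2 ⟨h3, h4⟩, fun h z => ?_, h5⟩
    -- Multiplicativity in a: for s = c ⊗ h the factor Δ(h) is absorbed into z, and the hypothesis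
    -- on a is used at z Δ(h).
    · have hmul : ∀ a : Cl α β γ lam, (∀ z : En k n ⊗[k] En k n, LinearMap.mul' k _
          ((BA ∘ₗ LinearMap.mulLeft k z ∘ₗ Coalgebra.comul).lTensor _ (coact α β γ lam a)) =
            BA z * a) → ∀ z s, LinearMap.mul' k _
          ((BA ∘ₗ LinearMap.mulLeft k z ∘ₗ Coalgebra.comul).lTensor _
            (s * coact α β γ lam a)) = LinearMap.mul' k _
          ((BA ∘ₗ LinearMap.mulLeft k z ∘ₗ Coalgebra.comul).lTensor _ s) * a := by
        intro a ha z s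
        induction s with
        | zero => simp
        | add u v hu hv => simp only [add_mul, map_add, hu, hv]
        | tmul c h =>
          trans c * (LinearMap.mul' k _ ((BA ∘ₗ LinearMap.mulLeft k
            (z * Coalgebra.comul (R := k) h) ∘ₗ Coalgebra.comul).lTensor _ (coact α β γ lam a)))
          · generalize coact α β γ lam a = w
            induction w with
            | zero => simp
            | add u v hu hv => simp only [mul_add, map_add, hu, hv]
            | tmul d l => simp [mul_assoc]
          · rw [ha]
            simp [mul_assoc]
      induction a using induction_right generalizing z with
      | hone => simp [Algebra.TensorProduct.one_def (A := Cl α β γ lam)]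
      | hsmul r a ha => simp [ha]
      | hadd a b ha hb => simp [ha, hb, mul_add]
      | hgen a i ha =>
        rw [map_mul, hmul, ha, mul_assoc]
        intro z
        induction z with
        | zero =>
          rw [LinearMap.mulLeft_zero_eq_zero, LinearMap.zero_comp, LinearMap.comp_zero]
          simp
        | add u v hu hv =>
          have : LinearMap.mulLeft k (u + v) = LinearMap.mulLeft k u + LinearMap.mulLeft k v := by
            ext
            simp [add_mul]
          rw [this, LinearMap.add_comp, LinearMap.comp_add, LinearMap.lTensor_add,
            LinearMap.add_apply, map_add, hu, hv, map_add, add_mul]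
        | tmul u v =>
          refine Fin.cases ?_ (fun i => ?_) i
          · have := h1 (HopfAlgebra.antipode k u * v)
            simp only [coact_gen_zero, LinearMap.lTensor_tmul, LinearMap.mul'_apply,
              LinearMap.comp_apply, LinearMap.mulLeft_apply, comul_g,
              Algebra.TensorProduct.tmul_mul_tmul, hS (u * En.g), hS u, antipode_mul', antipode_g]
            simpa [mul_assoc] using this
          · have := h2 i (HopfAlgebra.antipode k u * v)
            simp only [coact_gen_succ, LinearMap.lTensor_tmul, LinearMap.mul'_apply, map_add,
              LinearMap.comp_apply, LinearMap.mulLeft_apply, comul_g, comul_x, mul_add,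
              Algebra.TensorProduct.tmul_mul_tmul, hS (u * En.g), hS u, hS (u * En.x i),
              hS (u * 1), antipode_mul', antipode_g, antipode_x, antipode_one', one_mul]
            simpa [mul_assoc, add_assoc] using this
    · induction z with
      | zero => simp
      | add u v hu hv => simp only [mul_add, map_add, hu, hv, smul_add]
      | tmul u v =>
        -- Since S reverses products, S(h₁ u) h₂ v = S(u) S(h₁) h₂ v, and S(h₁) h₂ = ε(h).
        trans BA (1 ⊗ₜ[k] (HopfAlgebra.antipode k u * (LinearMap.mul' k _
          ((HopfAlgebra.antipode k).rTensor _ (Coalgebra.comul (R := k) h))) * v))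
        · generalize Coalgebra.comul (R := k) h = w
          induction w with
          | zero => simp
          | add u v hu hv => simp only [mul_add, add_mul, map_add, hu, hv, TensorProduct.tmul_add]
          | tmul x y =>
            simp [hS (x * u), antipode_mul', mul_assoc]
        · rw [HopfAlgebra.mul_antipode_rTensor_comul_apply, hS u, ← Algebra.commutes, mul_assoc,
            ← Algebra.smul_def]
          simp

end

end Cl

end

/-! ### Signs attached to subsets and to perfect matchings. -/

section posSum
variable {ι : Type*} [LinearOrder ι]

/-- The positions of the elements of F within F are 1, …, r. So the term subtracted in `posSum`
counts the pairs inside F, and only the pairs between F and its complement remain. -/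
theorem Finset.sum_card_filter_le_self (F : Finset ι) :
    ∑ f ∈ F, (F.filter fun p => p ≤ f).card = F.card * (F.card + 1) / 2 := by
  suffices h : 2 * ∑ f ∈ F, (F.filter fun p => p ≤ f).card = F.card * (F.card + 1) by omega
  induction F using Finset.induction_on_max with
  | empty => simp
  | insert a s hs ih =>
    have ha : a ∉ s := fun h => lt_irrefl _ (hs a h)
    rw [Finset.sum_insert ha, Finset.card_insert_of_notMem ha, Finset.filter_true_of_mem,
      Finset.card_insert_of_notMem ha]
    · have : ∀ f ∈ s, ((insert a s).filter fun p => p ≤ f).card =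
          (s.filter fun p => p ≤ f).card := by
        intro f hf
        rw [Finset.filter_insert, if_neg (hs f hf).not_ge]
      rw [Finset.sum_congr rfl this, mul_add, ih]
      ring
    · intro x hx
      rcases Finset.mem_insert.1 hx with rfl | hx
      · exact le_rfl
      · exact (hs x hx).le

/-- `S(F, P)` is the number of pairs `p < f` with `p ∈ P \ F` and `f ∈ F`. -/
theorem posSum_eq {F P : Finset ι} (h : F ⊆ P) :
    posSum F P = ∑ f ∈ F, ((P \ F).filter (· < f)).card := by
  have h1 : ∀ f ∈ F, (P.filter fun p => p ≤ f).card =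
      ((P \ F).filter (· < f)).card + (F.filter fun p => p ≤ f).card := by
    intro f hf
    rw [← Finset.card_union_of_disjoint]
    · congr 1
      ext x
      simp only [Finset.mem_filter, Finset.mem_union, Finset.mem_sdiff]
      constructor
      · rintro ⟨hx, hxf⟩
        by_cases hF : x ∈ F
        · exact .inr ⟨hF, hxf⟩
        · exact .inl ⟨⟨hx, hF⟩, lt_of_le_of_ne hxf fun e => hF (e ▸ hf)⟩
      · rintro (⟨⟨hx, -⟩, hxf⟩ | ⟨hx, hxf⟩)
        · exact ⟨hx, hxf.le⟩
        · exact ⟨h hx, hxf⟩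
    · rw [Finset.disjoint_left]
      intro x hx hx'
      simp only [Finset.mem_filter, Finset.mem_sdiff] at hx hx'
      exact hx.1.2 hx'.1
  rw [posSum, Finset.sum_congr rfl h1, Finset.sum_add_distrib, Finset.sum_card_filter_le_self,
    Nat.add_sub_cancel]

theorem posSum_self (F : Finset ι) : posSum F F = 0 := by
  rw [posSum_eq (Finset.Subset.refl F)]
  simp

/-- The new element i lies in the complement of F and forms one additional pair with each larger
element of F. -/
theorem posSum_insert_right {F P : Finset ι} (h : F ⊆ P) {i : ι} (hi : i ∉ P) :
    posSum F (insert i P) = posSum F P + (F.filter (i < ·)).card := by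
  rw [posSum_eq h, posSum_eq (h.trans (Finset.subset_insert i P)), Finset.card_filter,
    ← Finset.sum_add_distrib]
  refine Finset.sum_congr rfl fun f hf => ?_
  rw [Finset.insert_sdiff_of_notMem _ fun hF => hi (h hF), Finset.filter_insert]
  split_ifs with hif
  · rw [Finset.card_insert_of_notMem (by simp [hi])]
  · rfl

/-- Moving an element `r` of `P` into `F`. -/
theorem posSum_insert_left {F P : Finset ι} (h : F ⊆ P) {r : ι} (hr : r ∈ P) (hrF : r ∉ F) :
    posSum (insert r F) P + (F.filter (r < ·)).card =
      posSum F P + ((P \ F).filter (· < r)).card := by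
  rw [posSum_eq h, posSum_eq (Finset.insert_subset hr h), Finset.sum_insert hrF,
    Finset.card_filter (fun x => r < x) F, add_assoc, ← Finset.sum_add_distrib, add_comm]
  congr 1
  · refine Finset.sum_congr rfl fun f hf => ?_
    have : (P \ F).filter (· < f) = if r < f then insert r ((P \ insert r F).filter (· < f)) else
        (P \ insert r F).filter (· < f) := by
      ext x
      by_cases hx : x = r
      · subst hx
        split_ifs with hxf <;> simp [hr, hrF, hxf]
      · split_ifs with hxf <;> simp [hx]
    rw [this]
    split_ifs with hxf
    · rw [Finset.card_insert_of_notMem (by simp)]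
    · rfl
  · congr 1
    ext x
    simp only [Finset.mem_filter, Finset.mem_sdiff, Finset.mem_insert, not_or]
    exact ⟨fun ⟨⟨h1, _, h2⟩, h3⟩ => ⟨⟨h1, h2⟩, h3⟩, fun ⟨⟨h1, h2⟩, h3⟩ => ⟨⟨h1, h3.ne, h2⟩, h3⟩⟩

theorem posSum_singleton {T : Finset ι} {i : ι} (hi : i ∈ T) :
    posSum {i} T = (T.filter (· < i)).card := by
  rw [posSum_eq (Finset.singleton_subset_iff.2 hi), Finset.sum_singleton]
  congr 1
  ext x
  simp only [Finset.mem_filter, Finset.mem_sdiff, Finset.mem_singleton]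
  exact ⟨fun ⟨⟨h1, _⟩, h2⟩ => ⟨h1, h2⟩, fun ⟨h1, h2⟩ => ⟨⟨h1, h2.ne⟩, h2⟩⟩

/-- The sign of a list without repetitions: the parity of its number of inversions. -/
def List.inversionSign : List ι → ℤ
  | [] => 1
  | a :: l => (l.map fun b => if a < b then (1 : ℤ) else -1).prod * inversionSign l

theorem List.inversionSign_append_singleton (l : List ι) (c : ι) :
    (l ++ [c]).inversionSign =
      l.inversionSign * (l.map fun x => if x < c then (1 : ℤ) else -1).prod := by
  induction l with
  | nil => simp [inversionSign]
  | cons a l ih =>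
    rw [List.cons_append, inversionSign, ih, inversionSign]
    simp only [List.map_append, List.prod_append, List.map_cons, List.prod_cons, List.map_nil,
      List.prod_nil]
    ring

theorem List.prod_prod_get_eq_inversionSign (l : List ι) :
    ∏ j : Fin l.length, ∏ i : Fin l.length,
      (if i < j then if l.get i < l.get j then (1 : ℤ) else -1 else 1) = l.inversionSign := by
  induction l with
  | nil => simp [inversionSign]
  | cons a l ih =>
    change ∏ j : Fin (l.length + 1), ∏ i : Fin (l.length + 1), _ = _
    rw [inversionSign, ← ih, Fin.prod_univ_succ]
    simp only [Fin.not_lt_zero, if_false, Finset.prod_const_one, one_mul, Fin.prod_univ_succ,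
      Fin.succ_pos, if_true, Fin.succ_lt_succ_iff, Finset.prod_mul_distrib]
    congr 1
    rw [← List.prod_ofFn]
    congr 1
    refine List.ext_get (by simp) ?_
    intro m h1 h2
    simp only [List.get_eq_getElem, List.getElem_ofFn, List.getElem_map]
    rfl

namespace PerfectMatching

/-- Conjugating by the increasing enumeration of S gives a permutation of an initial segment of ℕ
whose inversions are those of `toList`. In this form the sign is easy to follow when entries are
appended. -/
theorem sgn_eq {S : Finset ι} (P : PerfectMatching S) : P.sgn = P.toList.inversionSign := by
  rw [← List.prod_prod_get_eq_inversionSign]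
  let e := (Finset.sort_nodup S (· ≤ ·)).getEquiv
  have h1 := Equiv.Perm.sign_trans_trans_symm P.perm e
  rw [sgn, ← h1, Equiv.Perm.sign_eq_prod_prod_Iio]
  push_cast
  refine Fintype.prod_equiv (finCongr P.length_toList) _ _ fun j => ?_
  have hmono : StrictMono S.sort.get := (Finset.sortedLT_sort S).strictMono_get
  have hval : ∀ i, S.sort.get (((e.trans P.perm).trans e.symm) i) =
      P.toList.get (finCongr P.length_toList i) := by
    intro i
    have h : (e (((e.trans P.perm).trans e.symm) i)).1 = (P.perm (e i)).1 := by
      simp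
    have h' : (P.perm (e i)).1 = P.toList.get (finCongr P.length_toList i) := by
      simp [perm, e]
    exact h.trans h'
  rw [← Finset.filter_gt_eq_Iio, Finset.prod_filter]
  refine Fintype.prod_equiv (finCongr P.length_toList) _ _ fun i => ?_
  have : (finCongr P.length_toList i < finCongr P.length_toList j) ↔ i < j := Iff.rfl
  simp only [this, ← hval, hmono.lt_iff_lt]
  split_ifs <;> simp

/-- Adding the block `{r, j}` to a perfect matching. -/
def addBlock {T : Finset ι} {r j : ι} (hr : r ∈ T) (hj : ∀ x ∈ T, x < j)
    (P : PerfectMatching (T.erase r)) : PerfectMatching (insert j T) :=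
  ⟨P.1.extend (b := {r, j}) (c := insert j T) (by simp)
    (by
      rw [Finset.disjoint_left]
      intro x hx
      simp only [Finset.mem_erase] at hx
      simp only [Finset.mem_insert, Finset.mem_singleton, not_or]
      exact ⟨hx.1, (hj x hx.2).ne⟩)
    (by
      ext x
      simp only [Finset.sup_eq_union, Finset.mem_union, Finset.mem_erase, Finset.mem_insert,
        Finset.mem_singleton]
      by_cases hx : x = r
      · simp [hx, hr]
      · simp [hx, or_comm]),
    by
      intro b hb
      rcases Finset.mem_insert.1 hb with rfl | hb
      · exact Finset.card_pair (hj r hr).ne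
      · exact P.2 b hb⟩

theorem addBlock_parts {T : Finset ι} {r j : ι} (hr : r ∈ T) (hj : ∀ x ∈ T, x < j)
    (P : PerfectMatching (T.erase r)) :
    (P.addBlock hr hj).1.parts = insert {r, j} P.1.parts := rfl

theorem notMem_of_mem_parts {T : Finset ι} {r j : ι} (hj : ∀ x ∈ T, x < j)
    (P : PerfectMatching (T.erase r)) {b : Finset ι} (hb : b ∈ P.1.parts) : j ∉ b := fun h =>
  lt_irrefl j (hj j (Finset.mem_of_mem_erase (P.1.le hb h)))

theorem part_addBlock_self {T : Finset ι} {r j : ι} (hr : r ∈ T) (hj : ∀ x ∈ T, x < j)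
    (P : PerfectMatching (T.erase r)) : (P.addBlock hr hj).1.part j = {r, j} :=
  Finpartition.part_eq_of_mem _ (by rw [addBlock_parts]; exact Finset.mem_insert_self _ _)
    (by simp)

theorem part_addBlock_self' {T : Finset ι} {r j : ι} (hr : r ∈ T) (hj : ∀ x ∈ T, x < j)
    (P : PerfectMatching (T.erase r)) : (P.addBlock hr hj).1.part r = {r, j} :=
  Finpartition.part_eq_of_mem _ (by rw [addBlock_parts]; exact Finset.mem_insert_self _ _)
    (by simp)

theorem part_addBlock {T : Finset ι} {r j : ι} (hr : r ∈ T) (hj : ∀ x ∈ T, x < j)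
    (P : PerfectMatching (T.erase r)) {s : ι} (hs : s ∈ T.erase r) :
    (P.addBlock hr hj).1.part s = P.1.part s :=
  Finpartition.part_eq_of_mem _ (by
    rw [addBlock_parts]; exact Finset.mem_insert_of_mem (P.1.part_mem.2 hs)) (P.1.mem_part hs)

/-- The largest element j has a unique partner r ∈ T, and deleting the block {r, j} leaves a
matching of T \ {r}. This reindexes the Pfaffian for its expansion along j. -/
theorem addBlock_bijective {T : Finset ι} {j : ι} (hj : ∀ x ∈ T, x < j) :
    Function.Bijective fun x : Σ r : {x // x ∈ T}, PerfectMatching (T.erase r.1) =>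
      x.2.addBlock x.1.2 hj := by
  constructor
  · rintro ⟨⟨r, hr⟩, P⟩ ⟨⟨r', hr'⟩, P'⟩ h
    dsimp only at h
    have h1 := part_addBlock_self hr hj P
    rw [h, part_addBlock_self hr' hj P'] at h1
    have : r' = r := by
      have h2 : r' ∈ ({r, j} : Finset ι) := h1 ▸ Finset.mem_insert_self _ _
      simpa [(hj r' hr').ne] using h2
    subst this
    have h2 : (P.addBlock hr hj).1.parts = (P'.addBlock hr hj).1.parts := by rw [h]
    rw [addBlock_parts, addBlock_parts] at h2
    have hn : ∀ P : PerfectMatching (T.erase r'), ({r', j} : Finset ι) ∉ P.1.parts :=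
      fun P hP => notMem_of_mem_parts hj P hP (by simp)
    have h3 := congrArg (fun s => s.erase {r', j}) h2
    simp only [Finset.erase_insert (hn P), Finset.erase_insert (hn P')] at h3
    obtain rfl : P = P' := Subtype.ext (Finpartition.ext h3)
    rfl
  · intro P
    have hjS : j ∈ insert j T := Finset.mem_insert_self _ _
    have hjp := P.1.mem_part hjS
    obtain ⟨r, hrp⟩ : ∃ r, (P.1.part j).erase j = {r} := by
      rw [← Finset.card_eq_one, Finset.card_erase_of_mem hjp, P.2 _ (P.1.part_mem.2 hjS)]
    have hpj : P.1.part j = {r, j} := by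
      rw [← Finset.insert_erase hjp, hrp, Finset.pair_comm]
    have hrj : r ≠ j := by
      have : r ∈ (P.1.part j).erase j := by simp [hrp]
      exact Finset.ne_of_mem_erase this
    have hr : r ∈ T := by
      have : r ∈ insert j T := P.1.part_subset j (by simp [hpj])
      exact Finset.mem_of_mem_insert_of_ne this hrj
    have hmem : ({r, j} : Finset ι) ∈ P.1.parts := hpj ▸ P.1.part_mem.2 hjS
    have hsup : (P.1.parts.erase {r, j}).sup id = T.erase r := by
      ext x
      simp only [Finset.mem_sup, Finset.mem_erase, id_eq]
      constructor
      · rintro ⟨b, ⟨hbne, hb⟩, hx⟩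
        have hx2 : x ∉ ({r, j} : Finset ι) := fun hx' =>
          hbne (P.1.eq_of_mem_parts hb hmem hx hx')
        simp only [Finset.mem_insert, Finset.mem_singleton, not_or] at hx2
        exact ⟨hx2.1, Finset.mem_of_mem_insert_of_ne (P.1.le hb hx) hx2.2⟩
      · rintro ⟨hxr, hxT⟩
        have hxS : x ∈ insert j T := Finset.mem_insert_of_mem hxT
        refine ⟨P.1.part x, ⟨fun h => ?_, P.1.part_mem.2 hxS⟩, P.1.mem_part hxS⟩
        have : x ∈ ({r, j} : Finset ι) := h ▸ P.1.mem_part hxS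
        simp [hxr, (hj x hxT).ne] at this
    refine ⟨⟨⟨r, hr⟩, ⟨P.1.ofSubset (Finset.erase_subset _ _) hsup,
      fun b hb => P.2 b (Finset.mem_of_mem_erase hb)⟩⟩, Subtype.ext (Finpartition.ext ?_)⟩
    rw [addBlock_parts]
    exact Finset.insert_erase hmem

/-- Blocks are listed by their largest elements and j is the overall maximum, so the new block comes
last; r is not the maximum of its block and contributes no entry of its own. -/
theorem toList_addBlock {T : Finset ι} {r j : ι} (hr : r ∈ T) (hj : ∀ x ∈ T, x < j)
    (P : PerfectMatching (T.erase r)) : (P.addBlock hr hj).toList = P.toList ++ [r, j] := by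
  have hfilter : (insert j T).filter (fun s => ∀ t ∈ (P.addBlock hr hj).1.part s, t ≤ s) =
      insert j ((T.erase r).filter fun s => ∀ t ∈ P.1.part s, t ≤ s) := by
    ext s
    simp only [Finset.mem_filter, Finset.mem_insert]
    by_cases hsj : s = j
    · subst hsj
      simp [part_addBlock_self hr hj P, (hj r hr).le]
    · by_cases hsr : s = r
      · subst hsr
        simp [part_addBlock_self' hr hj P, hsj, (hj s hr).not_ge]
      · by_cases hsT : s ∈ T
        · simp [part_addBlock hr hj P (Finset.mem_erase.2 ⟨hsr, hsT⟩), hsj, hsr]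
        · simp [hsj, hsT]
  rw [toList, toList, hfilter, Finset.sort_insert_of_forall_lt, List.flatMap_append]
  · congr 1
    · refine List.flatMap_congr fun s hs => ?_
      rw [Finset.mem_sort, Finset.mem_filter] at hs
      rw [part_addBlock hr hj P hs.1]
    · rw [List.flatMap_singleton, part_addBlock_self hr hj P, Finset.pair_comm,
        Finset.sort_insert_of_forall_lt]
      · simp
      · simpa using hj r hr
  · intro x hx
    exact hj x (Finset.mem_of_mem_erase (Finset.mem_filter.1 hx).1)

/-- In the appended pair r, j, the maximum j creates no inversion, while r creates one with each
larger element of T. -/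
theorem sgn_addBlock {T : Finset ι} {r j : ι} (hr : r ∈ T) (hj : ∀ x ∈ T, x < j)
    (P : PerfectMatching (T.erase r)) :
    (P.addBlock hr hj).sgn = (-1) ^ (T.filter (r < ·)).card * P.sgn := by
  have hperm : P.toList.toFinset = T.erase r := by
    ext x
    rw [List.mem_toFinset, ← mem_toList, Finset.mem_sort]
  rw [sgn_eq, sgn_eq, toList_addBlock, show [r, j] = [r] ++ [j] from rfl, ← List.append_assoc,
    List.inversionSign_append_singleton, List.inversionSign_append_singleton,
    ← List.prod_toFinset _ P.nodup_toList, hperm]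
  have h1 : ((P.toList ++ [r]).map fun x => if x < j then (1 : ℤ) else -1).prod = 1 := by
    refine List.prod_eq_one fun y hy => ?_
    obtain ⟨x, hx, rfl⟩ := List.mem_map.1 hy
    refine if_pos (hj x ?_)
    rcases List.mem_append.1 hx with hx | hx
    · rw [← mem_toList, Finset.mem_sort] at hx
      exact Finset.mem_of_mem_erase hx
    · rw [List.mem_singleton.1 hx]
      exact hr
  rw [h1, mul_one, mul_comm, Finset.prod_ite, Finset.prod_const_one, one_mul, Finset.prod_const]
  congr 3
  ext x
  simp only [Finset.mem_filter, Finset.mem_erase, not_lt]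
  exact ⟨fun h => ⟨h.1.2, lt_of_le_of_ne h.2 h.1.1.symm⟩, fun h => ⟨⟨h.2.ne', h.1⟩, h.2.le⟩⟩

end PerfectMatching

end posSum

/-! ### Pfaffians and their expansion along the largest element. -/

noncomputable section

section
variable {k : Type*} [Field k] {n : ℕ}

/-- The Pfaffian `∑ sgn(P) Λ(P)` over the perfect matchings of `S`. -/
def pfaffian (γ : Fin n → k) (lam : Fin n → Fin n → k) (S : Finset (Fin (n + 1))) : k :=
  ∑ P : PerfectMatching S, (P.sgn : k) * P.weight γ lam

theorem PerfectMatching.weight_addBlock (γ : Fin n → k) (lam : Fin n → Fin n → k)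
    {T : Finset (Fin (n + 1))} {r j : Fin (n + 1)} (hr : r ∈ T) (hj : ∀ x ∈ T, x < j)
    (P : PerfectMatching (T.erase r)) :
    (P.addBlock hr hj).weight γ lam = lamBar γ lam r j * P.weight γ lam := by
  rw [weight, weight, addBlock_parts, Finset.prod_insert]
  · congr 2
    · simp [(hj r hr).le]
    · simp [(hj r hr).le]
  · exact fun hP => notMem_of_mem_parts hj P hP (by simp)

@[simp]
theorem pfaffian_empty (γ : Fin n → k) (lam : Fin n → Fin n → k) : pfaffian γ lam ∅ = 1 := by
  have h : ∀ P : PerfectMatching (∅ : Finset (Fin (n + 1))),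
      (P.sgn : k) * P.weight γ lam = 1 := by
    intro P
    have hp : P.1.parts = ∅ := by
      have : P.1 = ⊥ := Subsingleton.elim (α := Finpartition (⊥ : Finset (Fin (n + 1)))) _ _
      rw [this]
      rfl
    have hl : P.toList = [] := by
      rw [← List.length_eq_zero_iff, ← P.length_toList]
      simp
    rw [PerfectMatching.weight, hp, PerfectMatching.sgn_eq, hl]
    simp [List.inversionSign]
  have hsub : Subsingleton (Finpartition (∅ : Finset (Fin (n + 1)))) :=
    inferInstanceAs (Subsingleton (Finpartition (⊥ : Finset (Fin (n + 1)))))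
  let P₀ : PerfectMatching (∅ : Finset (Fin (n + 1))) := ⟨Finpartition.empty _, by
    intro b hb
    simp at hb⟩
  rw [pfaffian, Fintype.sum_eq_single P₀ fun P hP => absurd (Subtype.ext (Subsingleton.elim _ _)) hP,
    h]

/-- Expansion of the Pfaffian along the largest element. -/
theorem pfaffian_insert (γ : Fin n → k) (lam : Fin n → Fin n → k) {T : Finset (Fin (n + 1))}
    {j : Fin (n + 1)} (hj : ∀ x ∈ T, x < j) : pfaffian γ lam (insert j T) =
      ∑ r ∈ T, (-1) ^ (T.filter (r < ·)).card * lamBar γ lam r j * pfaffian γ lam (T.erase r) := by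
  rw [pfaffian, ← (PerfectMatching.addBlock_bijective hj).sum_comp, Fintype.sum_sigma,
    ← Finset.sum_coe_sort T]
  refine Finset.sum_congr rfl fun r _ => ?_
  rw [pfaffian, Finset.mul_sum]
  refine Finset.sum_congr rfl fun P _ => ?_
  rw [PerfectMatching.sgn_addBlock, PerfectMatching.weight_addBlock]
  push_cast
  ring

end

end

/-! ### The elements x_Q and g x_Q of E(n). -/

noncomputable section

theorem addZero_insert {n : ℕ} (j : Fin n) (Q : Finset (Fin n)) :
    addZero (insert j Q) = insert j.succ (addZero Q) := by
  rw [addZero, addZero, Finset.map_insert, Finset.insert_comm]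
  rfl

theorem mem_addZero_succ {n : ℕ} {i : Fin n} {Q : Finset (Fin n)} :
    i.succ ∈ addZero Q ↔ i ∈ Q := by
  simp [addZero]

theorem zero_mem_addZero {n : ℕ} (Q : Finset (Fin n)) : 0 ∈ addZero Q := by simp [addZero]

theorem zero_notMem_map_succEmb {n : ℕ} (Q : Finset (Fin n)) : 0 ∉ Q.map (Fin.succEmb n) := by
  simp

theorem exists_eq_map_succEmb {n : ℕ} {S : Finset (Fin (n + 1))} (h : 0 ∉ S) :
    ∃ Q : Finset (Fin n), S = Q.map (Fin.succEmb n) := by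
  refine ⟨Finset.univ.filter fun i => i.succ ∈ S, ?_⟩
  ext x
  refine Fin.cases ?_ (fun i => ?_) x
  · simp [h]
  · simp

theorem exists_eq_addZero {n : ℕ} {S : Finset (Fin (n + 1))} (h : 0 ∈ S) :
    ∃ Q : Finset (Fin n), S = addZero Q := by
  obtain ⟨Q, hQ⟩ := exists_eq_map_succEmb (Finset.notMem_erase 0 S)
  exact ⟨Q, by rw [addZero, ← hQ, Finset.insert_erase h]⟩

namespace En

variable {k : Type*} [Field k] {n : ℕ}

theorem xs_eq_mon (Q : Finset (Fin n)) :
    (xs Q : En k n) = Cl.mon 1 0 0 0 (Q.map (Fin.succEmb n)) := by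
  have : (Q.map (Fin.succEmb n)).sort = Q.sort.map (Fin.succEmb n) := by
    refine (Finset.sortedLT_sort _).eq_of_mem_iff ?_ (by simp)
    rw [List.sortedLT_iff_pairwise, List.pairwise_map]
    exact (List.sortedLT_iff_pairwise.1 (Finset.sortedLT_sort _)).imp
      fun h => Fin.succ_lt_succ_iff.2 h
  rw [xs, Cl.mon, this, List.map_map]
  rfl

theorem g_mul_xs (Q : Finset (Fin n)) :
    (g * xs Q : En k n) = Cl.mon 1 0 0 0 (addZero Q) := by
  rw [xs_eq_mon, addZero, Cl.mon_insert_of_forall_gt, g]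
  intro i hi
  obtain ⟨i, -, rfl⟩ := Finset.mem_map.1 hi
  exact Fin.succ_pos i

theorem xs_insert_of_forall_lt {j : Fin n} {Q : Finset (Fin n)} (h : ∀ i ∈ Q, i < j) :
    (xs (insert j Q) : En k n) = xs Q * x j := by
  simp [xs, Finset.sort_insert_of_forall_lt h]

@[simp]
theorem xs_empty : (xs ∅ : En k n) = 1 := by simp [xs]

theorem ext_xs {M : Type*} [AddCommGroup M] [Module k M] {f h : En k n →ₗ[k] M}
    (h1 : ∀ Q, f (xs Q) = h (xs Q)) (h2 : ∀ Q, f (g * xs Q) = h (g * xs Q)) : f = h := by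
  refine Cl.mon_ext fun S => ?_
  by_cases h0 : 0 ∈ S
  · obtain ⟨Q, rfl⟩ := exists_eq_addZero h0
    rw [← g_mul_xs, h2]
  · obtain ⟨Q, rfl⟩ := exists_eq_map_succEmb h0
    rw [← xs_eq_mon, h1]

theorem parity_g : Cl.parity (g : En k n) = -g := Cl.parity_gen 0

theorem parity_x (i : Fin n) : Cl.parity (x i : En k n) = -x i := Cl.parity_gen _

theorem parity_xs (Q : Finset (Fin n)) :
    Cl.parity (xs Q : En k n) = (-1 : k) ^ Q.card • xs Q := by
  rw [xs_eq_mon, Cl.parity_mon, Finset.card_map]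

theorem polar_succ (i : Fin n) (l : Fin (n + 1)) :
    Cl.polar (1 : k) (0 : Fin n → k) 0 0 i.succ l = 0 := by
  refine Fin.cases ?_ (fun l => ?_) l
  · rw [Cl.polar_succ_zero]; rfl
  · rcases lt_trichotomy i l with h | rfl | h
    · rw [Cl.polar_succ_succ h]; rfl
    · rw [Cl.polar_succ_self]; simp
    · rw [Cl.polar_comm, Cl.polar_succ_succ h]; rfl

/-- The generators `x_i` are central in the graded sense. -/
theorem mul_x (i : Fin n) (m : En k n) : m * x i = x i * Cl.parity m := by
  have h := Cl.mul_gen_sub i.succ m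
  simp only [polar_succ, zero_smul, Finset.sum_const_zero] at h
  exact sub_eq_zero.1 h

theorem contract_g (i : Fin n) : Cl.contract i.succ (g : En k n) = 0 := by
  rw [g, Cl.contract_gen, if_neg (Fin.succ_ne_zero i).symm]

theorem contract_g_mul (i : Fin n) (m : En k n) :
    Cl.contract i.succ (g * m) = g * Cl.contract i.succ m := by
  rw [Cl.contract_mul, contract_g, zero_mul, zero_add]

theorem contract_xs (i : Fin n) (Q : Finset (Fin n)) : Cl.contract i.succ (xs Q : En k n) =
    if i ∈ Q then (-1 : k) ^ (Q.filter (i < ·)).card • xs (Q.erase i) else 0 := by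
  rw [xs_eq_mon, Cl.contract_mon, xs_eq_mon]
  have h1 : i.succ ∈ Q.map (Fin.succEmb n) ↔ i ∈ Q := by simp
  have h2 : (Q.map (Fin.succEmb n)).erase i.succ = (Q.erase i).map (Fin.succEmb n) :=
    (Finset.map_erase (Fin.succEmb n) Q i).symm
  have h3 : ((Q.map (Fin.succEmb n)).filter (i.succ < ·)).card = (Q.filter (i < ·)).card := by
    rw [Finset.filter_map, Finset.card_map]
    congr 1
    ext x
    rw [Finset.mem_filter, Finset.mem_filter]
    exact and_congr_right fun _ => Fin.succ_lt_succ_iff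
  simp only [h1, h2, h3]

/-- In E(n) the row of g in the polar form has only its diagonal entry, so the supercommutator with
g is 2 D_0, which kills monomials without g. -/
theorem xs_mul_g (Q : Finset (Fin n)) : (xs Q * g : En k n) = g * Cl.parity (xs Q) := by
  have h := Cl.mul_gen_sub 0 (xs Q : En k n)
  rw [Fin.sum_univ_succ] at h
  simp only [Cl.polar_zero_succ, Pi.zero_apply, zero_smul, Finset.sum_const_zero, add_zero] at h
  rw [xs_eq_mon, Cl.contract_mon, if_neg (zero_notMem_map_succEmb Q), smul_zero] at h
  rw [xs_eq_mon]
  exact sub_eq_zero.1 h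

theorem xs_mul_x_mem (Q : Finset (Fin n)) (i : Fin n) :
    (xs Q * x i : En k n) ∈ Submodule.span k (Set.range (xs : Finset (Fin n) → En k n)) := by
  rw [xs_eq_mon]
  refine Submodule.span_mono ?_ (Cl.mon_mul_gen_mem _ _)
  rintro _ ⟨U, hU, rfl⟩
  have h0 : 0 ∉ U := by
    intro h
    have := hU h
    simp [(Fin.succ_ne_zero i).symm] at this
  obtain ⟨P, rfl⟩ := exists_eq_map_succEmb h0
  exact ⟨P, xs_eq_mon P⟩

end En

/-! ### Antisymmetrized products and Wick's formula. -/

namespace Cl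

section
variable {k : Type*} [Field k] {n : ℕ} {α : k} {β γ : Fin n → k} {lam : Fin n → Fin n → k}

/-- The operator `u ↦ u ∧ X_j = (u X_j + X_j σ(u)) / 2`. -/
def wedgeRight (j : Fin (n + 1)) : Cl α β γ lam →ₗ[k] Cl α β γ lam :=
  (2⁻¹ : k) • (LinearMap.mulRight k (gen α β γ lam j) +
    LinearMap.mulLeft k (gen α β γ lam j) ∘ₗ parity.toLinearMap)

theorem wedgeRight_apply (j : Fin (n + 1)) (u : Cl α β γ lam) : wedgeRight j u =
    (2⁻¹ : k) • (u * gen α β γ lam j + gen α β γ lam j * parity u) := rfl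

/-- In the symmetrized expression the mixed terms X_i σ(u) X_j cancel, and the commutator of u with
X_i X_j + X_j X_i remains; the latter is a scalar, hence central. -/
theorem wedgeRight_wedgeRight (i j : Fin (n + 1)) (u : Cl α β γ lam) :
    wedgeRight i (wedgeRight j u) = -wedgeRight j (wedgeRight i u) := by
  have h := gen_mul_gen_add (α := α) (β := β) (γ := γ) (lam := lam) i j
  have hc := Algebra.commutes (polar α β γ lam i j) u
  rw [← h] at hc
  simp only [wedgeRight_apply, map_smul, map_add, map_mul, parity_gen, parity_parity,
    ← smul_add, ← smul_neg]
  congr 2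
  rw [← sub_eq_zero] at hc ⊢
  rw [← neg_eq_zero, ← hc]
  noncomm_ring

theorem wedgeRight_self (hk : (2 : k) ≠ 0) (i : Fin (n + 1)) (u : Cl α β γ lam) :
    wedgeRight i (wedgeRight i u) = 0 := by
  have h := wedgeRight_wedgeRight i i u
  rw [eq_neg_iff_add_eq_zero, ← two_smul k] at h
  exact (smul_eq_zero_iff_right hk).1 h

theorem wedgeRight_parity (i : Fin (n + 1)) (u : Cl α β γ lam) :
    wedgeRight i (parity u) = -parity (wedgeRight i u) := by
  simp [wedgeRight_apply, add_comm]

theorem contract_wedgeRight (hk : (2 : k) ≠ 0) (i j : Fin (n + 1)) (u : Cl α β γ lam) :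
    contract i (wedgeRight j u) = -wedgeRight j (contract i u) + if j = i then u else 0 := by
  simp only [wedgeRight_apply, map_smul, map_add, contract_mul, contract_gen, parity_gen,
    contract_parity, parity_parity]
  split_ifs
  · have hu : (2⁻¹ : k) • (u + u) = u := by
      rw [← two_smul k, smul_smul, inv_mul_cancel₀ hk, one_smul]
    rw [← sub_eq_iff_eq_add', sub_neg_eq_add, ← smul_add, ← hu]
    congr 1
    rw [hu]
    simp only [mul_neg, mul_one, one_mul]
    abel
  · rw [add_zero, ← smul_neg]
    congr 1
    simp only [mul_neg, mul_zero, zero_mul]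
    abel

/-- The wedge is the Clifford product corrected by half the supercommutator, a sum of contractions.
This is the source of the recursion behind Wick's formula. -/
theorem wedgeRight_eq_sub (hk : (2 : k) ≠ 0) (j : Fin (n + 1)) (u : Cl α β γ lam) :
    wedgeRight j u = u * gen α β γ lam j -
      (2⁻¹ : k) • ∑ l, polar α β γ lam j l • contract l u := by
  rw [← mul_gen_sub, wedgeRight_apply]
  have hv : ∀ v : Cl α β γ lam, (2⁻¹ : k) • (v + v) = v := fun v => by
    rw [← two_smul k, smul_smul, inv_mul_cancel₀ hk, one_smul]
  rw [eq_sub_iff_add_eq, ← smul_add, add_add_sub_cancel, hv]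

variable (α β γ lam) in
-- The operators σ and - ∧ X_i satisfy the relations of g and x_i, so E(n) acts on the Clifford
-- algebra. The action is on the right, hence the opposite of the endomorphism algebra.
theorem exists_wedgeAction (hk : (2 : k) ≠ 0) :
    ∃ F : En k n →ₐ[k] (Module.End k (Cl α β γ lam))ᵐᵒᵖ,
      F En.g = MulOpposite.op parity.toLinearMap ∧
        ∀ i, F (En.x i) = MulOpposite.op (wedgeRight i.succ) := by
  obtain ⟨F, hF⟩ := exists_algHom (α := (1 : k)) (β := (0 : Fin n → k)) (γ := 0) (lam := 0)
    (Fin.cons (MulOpposite.op parity.toLinearMap)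
      fun i => MulOpposite.op (wedgeRight (α := α) (β := β) (γ := γ) (lam := lam) i.succ))
    (fun i => by
      refine Fin.cases ?_ (fun i => ?_) i
      · simp only [Fin.cons_zero, map_one, ← MulOpposite.op_mul]
        rw [← MulOpposite.op_one]
        congr 1
        ext u
        simp
      · simp only [Fin.cons_succ, Pi.zero_apply, map_zero, ← MulOpposite.op_mul]
        rw [← MulOpposite.op_zero]
        congr 1
        ext u
        simp [wedgeRight_self hk])
    (fun i j hij => by
      obtain ⟨j, rfl⟩ := Fin.exists_succ_eq.2 (Fin.ne_zero_of_lt hij)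
      rw [polar_comm, En.polar_succ, map_zero]
      refine Fin.cases ?_ (fun i => ?_) i
      · simp only [Fin.cons_zero, Fin.cons_succ, ← MulOpposite.op_mul, ← MulOpposite.op_add]
        rw [← MulOpposite.op_zero]
        congr 1
        ext u
        simp [wedgeRight_parity]
      · simp only [Fin.cons_succ, ← MulOpposite.op_mul, ← MulOpposite.op_add]
        rw [← MulOpposite.op_zero]
        congr 1
        ext u
        simp [wedgeRight_wedgeRight i.succ j.succ u])
  exact ⟨F, by rw [En.g, hF]; rfl, fun i => by rw [En.x, hF]; rfl⟩

variable (α β γ lam) in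
/-- The linear map with `1 ↦ G`, `m x_j ↦ wedge m ∧ X_j` and `m g ↦ σ (wedge m)`. On `x_Q` it is
the antisymmetrized product `G ∧ X_{i_1} ∧ ⋯ ∧ X_{i_s}`. -/
def wedge (hk : (2 : k) ≠ 0) : En k n →ₗ[k] Cl α β γ lam :=
  LinearMap.applyₗ (gen α β γ lam 0) ∘ₗ (MulOpposite.opLinearEquiv k).symm.toLinearMap ∘ₗ
    (exists_wedgeAction α β γ lam hk).choose.toLinearMap

@[simp]
theorem wedge_one (hk : (2 : k) ≠ 0) : wedge α β γ lam hk 1 = gen α β γ lam 0 := by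
  simp [wedge]

theorem wedge_mul_x (hk : (2 : k) ≠ 0) (m : En k n) (i : Fin n) :
    wedge α β γ lam hk (m * En.x i) = wedgeRight i.succ (wedge α β γ lam hk m) := by
  simp [wedge, (exists_wedgeAction α β γ lam hk).choose_spec.2]

theorem parity_wedge_xs (hk : (2 : k) ≠ 0) (Q : Finset (Fin n)) :
    parity (wedge α β γ lam hk (En.xs Q)) =
      (-1 : k) ^ (Q.card + 1) • wedge α β γ lam hk (En.xs Q) := by
  induction Q using Finset.induction_on_max with
  | empty => simp
  | insert j Q hQ ih =>
    rw [En.xs_insert_of_forall_lt hQ, wedge_mul_x, ← neg_eq_iff_eq_neg.2 (wedgeRight_parity _ _),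
      ih, map_smul, Finset.card_insert_of_notMem fun h => lt_irrefl _ (hQ j h), pow_succ _ (_ + 1)]
    simp

theorem contract_wedge_xs (hk : (2 : k) ≠ 0) (i : Fin n) (Q : Finset (Fin n)) :
    contract i.succ (wedge α β γ lam hk (En.xs Q)) =
      wedge α β γ lam hk (contract i.succ (En.xs Q)) := by
  induction Q using Finset.induction_on_max with
  | empty => simp [(Fin.succ_ne_zero i).symm]
  | insert j Q hQ ih =>
    have h : contract i.succ (En.xs Q * En.x j : En k n) =
        -(contract i.succ (En.xs Q) * En.x j) + if j.succ = i.succ then En.xs Q else 0 :=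
      contract_mul_gen _ _ _
    rw [En.xs_insert_of_forall_lt hQ, h, wedge_mul_x, contract_wedgeRight hk, map_add, map_neg,
      wedge_mul_x, ih]
    split_ifs <;> simp

/-- G ∧ G = 0, and - ∧ G anticommutes past the other factors. This is the condition at the generator
G for the values on g x_Q. -/
theorem wedgeRight_zero_wedge_xs (hk : (2 : k) ≠ 0) (Q : Finset (Fin n)) :
    wedgeRight 0 (wedge α β γ lam hk (En.xs Q)) = 0 := by
  induction Q using Finset.induction_on_max with
  | empty => simp [wedgeRight_apply]
  | insert j Q hQ ih =>
    rw [En.xs_insert_of_forall_lt hQ, wedge_mul_x, wedgeRight_wedgeRight, ih, map_zero, neg_zero]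

/-- The coefficient of `X_R` in the antisymmetrized product of the `X_i`, `i ∈ S`. -/
def wickCoeff (γ : Fin n → k) (lam : Fin n → Fin n → k) (S R : Finset (Fin (n + 1))) : k :=
  if R ⊆ S ∧ R.card ≡ S.card [MOD 2] then
    (-1) ^ (posSum R S + (S.card - R.card) / 2) * (2⁻¹) ^ ((S.card - R.card) / 2) *
      pfaffian γ lam (S \ R)
  else 0

/-- All monomials of u have indices below j, so right multiplication by X_j appends j to each of
them without reordering. -/
theorem repr_mul_gen_of_wickCoeff (hk : (2 : k) ≠ 0) {S : Finset (Fin (n + 1))}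
    {j : Fin (n + 1)} (hj : ∀ i ∈ S, i < j) {u : Cl α β γ lam}
    (hu : ∀ R, (monBasis α β γ lam hk).repr u R = wickCoeff γ lam S R)
    (R : Finset (Fin (n + 1))) :
    (monBasis α β γ lam hk).repr (u * gen α β γ lam j) R =
      if j ∈ R then wickCoeff γ lam S (R.erase j) else 0 := by
  have hjS : j ∉ S := fun h => lt_irrefl _ (hj j h)
  have h1 : u * gen α β γ lam j =
      ∑ V ∈ S.powerset, wickCoeff γ lam S V • mon α β γ lam (insert j V) := by
    conv_lhs => rw [← (monBasis α β γ lam hk).sum_repr u, Finset.sum_mul]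
    rw [← Finset.sum_subset (Finset.subset_univ S.powerset)]
    · refine Finset.sum_congr rfl fun V hV => ?_
      rw [hu, monBasis_apply, smul_mul_assoc, mon_insert_of_forall_lt]
      exact fun i hi => hj i (Finset.mem_powerset.1 hV hi)
    · intro V _ hV
      rw [hu, wickCoeff, if_neg (fun h => hV (Finset.mem_powerset.2 h.1)), zero_smul, zero_mul]
  rw [h1, map_sum, Finsupp.finsetSum_apply]
  simp only [map_smul, Finsupp.smul_apply, repr_mon, smul_eq_mul, mul_ite, mul_one, mul_zero]
  split_ifs with hjR
  · have h2 : ∀ V ∈ S.powerset, (insert j V = R ↔ V = R.erase j) := by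
      intro V hV
      have hjV : j ∉ V := fun h => hjS (Finset.mem_powerset.1 hV h)
      exact ⟨fun h => by rw [← h, Finset.erase_insert hjV],
        fun h => by rw [h, Finset.insert_erase hjR]⟩
    rw [Finset.sum_congr rfl fun V hV => by rw [if_congr (h2 V hV) rfl rfl],
      Finset.sum_ite_eq' S.powerset]
    split_ifs with hR
    · rfl
    · rw [wickCoeff, if_neg (fun h => hR (Finset.mem_powerset.2 h.1))]
  · refine Finset.sum_eq_zero fun V _ => if_neg ?_
    rintro rfl
    simp at hjR

/-- Adding the maximum j to both sets changes `posSum` by |S \ V|, which is even by the congruence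
of cardinalities, and leaves S \ V unchanged. -/
theorem wickCoeff_insert_insert {S V : Finset (Fin (n + 1))} {j : Fin (n + 1)}
    (hj : ∀ i ∈ S, i < j) (hjV : j ∉ V) :
    wickCoeff γ lam (insert j S) (insert j V) = wickCoeff γ lam S V := by
  have hjS : j ∉ S := fun h => lt_irrefl _ (hj j h)
  have hsub : insert j V ⊆ insert j S ↔ V ⊆ S := Finset.insert_subset_insert_iff hjV
  rw [wickCoeff, wickCoeff, Finset.card_insert_of_notMem hjV,
    Finset.card_insert_of_notMem hjS, Nat.add_sub_add_right]
  have hmod : V.card + 1 ≡ S.card + 1 [MOD 2] ↔ V.card ≡ S.card [MOD 2] :=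
    ⟨fun h => h.add_right_cancel' 1, fun h => h.add_right 1⟩
  refine if_ctx_congr (and_congr hsub hmod) ?_ fun _ => rfl
  rintro ⟨hVS, hc⟩
  have h1 := posSum_insert_left (hVS.trans (Finset.subset_insert j S))
    (Finset.mem_insert_self j S) hjV
  have h2 := posSum_insert_right hVS hjS
  have h3 : V.filter (j < ·) = ∅ :=
    Finset.filter_false_of_mem fun x hx => (hj x (hVS hx)).not_gt
  have h4 : (insert j S \ V).filter (· < j) = S \ V := by
    ext x
    simp only [Finset.mem_filter, Finset.mem_sdiff, Finset.mem_insert]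
    constructor
    · rintro ⟨⟨rfl | hx, hxV⟩, hlt⟩
      · exact absurd hlt (lt_irrefl _)
      · exact ⟨hx, hxV⟩
    · rintro ⟨hx, hxV⟩
      exact ⟨⟨.inr hx, hxV⟩, hj x hx⟩
  rw [h3, Finset.card_empty, add_zero] at h1 h2
  rw [h4, h2, Finset.card_sdiff_of_subset hVS] at h1
  have h5 : Even (S.card - V.card) := by
    rw [Nat.even_iff]
    have := Finset.card_le_card hVS
    unfold Nat.ModEq at hc
    omega
  have h6 : insert j S \ insert j V = S \ V := by
    rw [Finset.insert_sdiff_insert, Finset.sdiff_insert_of_notMem hjS]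
  rw [h1, h6, add_right_comm, pow_add _ _ (S.card - V.card), h5.neg_one_pow, mul_one]

/-- Recursion for the coefficients of the antisymmetrized product. -/
theorem wickCoeff_insert {S R : Finset (Fin (n + 1))} {j : Fin (n + 1)}
    (hj : ∀ i ∈ S, i < j) (hjR : j ∉ R) :
    wickCoeff γ lam (insert j S) R = -(2⁻¹ * ∑ l, polar α β γ lam j l *
      if l ∈ R then 0 else (-1) ^ (R.filter (l < ·)).card * wickCoeff γ lam S (insert l R)) := by
  have hjS : j ∉ S := fun h => lt_irrefl _ (hj j h)
  by_cases hR : R ⊆ S ∧ R.card ≡ (insert j S).card [MOD 2]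
  · obtain ⟨hRS, hc⟩ := hR
    rw [wickCoeff, if_pos ⟨hRS.trans (Finset.subset_insert j S), hc⟩,
      Finset.insert_sdiff_of_notMem _ hjR,
      pfaffian_insert γ lam fun x hx => hj x (Finset.mem_sdiff.1 hx).1]
    have hle := Finset.card_le_card hRS
    rw [Finset.card_insert_of_notMem hjS] at hc ⊢
    obtain ⟨m, hm⟩ : ∃ m, S.card = R.card + 2 * m + 1 := by
      unfold Nat.ModEq at hc
      exact ⟨(S.card - R.card) / 2, by omega⟩
    have hm1 : (S.card + 1 - R.card) / 2 = m + 1 := by omega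
    -- Only l ∈ S \ R contributes, and the terms are matched with the expansion of the Pfaffian of
    -- (S \ R) ∪ {j} along j.
    rw [← Finset.sum_subset (Finset.subset_univ (S \ R)), Finset.mul_sum, Finset.mul_sum,
      ← Finset.sum_neg_distrib, hm1]
    · refine Finset.sum_congr rfl fun l hl => ?_
      obtain ⟨hlS, hlR⟩ := Finset.mem_sdiff.1 hl
      have hci : (insert l R).card = R.card + 1 := Finset.card_insert_of_notMem hlR
      have hm2 : (S.card - (R.card + 1)) / 2 = m := by omega
      rw [if_neg hlR, polar_comm, polar_of_lt (hj l hlS), wickCoeff,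
        if_pos ⟨Finset.insert_subset hlS hRS, by rw [hci, hm]; unfold Nat.ModEq; omega⟩, hci, hm2,
        posSum_insert_right hRS hjS,
        Finset.filter_false_of_mem fun x hx => (hj x (hRS hx)).not_gt, Finset.card_empty, add_zero,
        Finset.sdiff_insert]
      have h1 := posSum_insert_left hRS hlS hlR
      -- S \ R has 2m + 1 elements, so the numbers of its elements above and below l have the same
      -- parity. This converts the sign of `posSum` into the Pfaffian sign.
      have h2 : ((S \ R).filter (l < ·)).card + ((S \ R).filter (· < l)).card = 2 * m := by
        have h3 : (S \ R).card = 2 * m + 1 := by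
          rw [Finset.card_sdiff_of_subset hRS]
          omega
        rw [← Finset.card_union_of_disjoint]
        · have h4 : (S \ R).filter (l < ·) ∪ (S \ R).filter (· < l) = (S \ R).erase l := by
            ext x
            simp only [Finset.mem_union, Finset.mem_filter, Finset.mem_erase, ← and_or_left,
              ne_eq, lt_or_lt_iff_ne]
            tauto
          rw [h4, Finset.card_erase_of_mem hl, h3]
          rfl
        · rw [Finset.disjoint_left]
          intro x hx hx'
          exact lt_asymm (Finset.mem_filter.1 hx).2 (Finset.mem_filter.1 hx').2
      have hsign : (-1 : k) ^ (R.filter (l < ·)).card * (-1) ^ posSum (insert l R) S =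
          (-1) ^ posSum R S * (-1) ^ ((S \ R).filter (l < ·)).card := by
        rw [← pow_add, add_comm, h1, pow_add]
        congr 1
        have : (-1 : k) ^ (((S \ R).filter (l < ·)).card + ((S \ R).filter (· < l)).card) = 1 := by
          rw [h2, pow_mul]
          simp
        rw [pow_add] at this
        rcases neg_one_pow_eq_or k ((S \ R).filter (l < ·)).card with h | h <;>
          rw [h] at this ⊢ <;> [linear_combination this; linear_combination -this]
      rw [pow_add, pow_add _ _ m, pow_succ, pow_succ]
      linear_combination (2⁻¹ * (2⁻¹) ^ m * (-1) ^ m * lamBar γ lam l j *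
        pfaffian γ lam ((S \ R).erase l)) * hsign
    · intro l _ hl
      split_ifs with hlR
      · rw [mul_zero]
      · have hlS : l ∉ S := fun h => hl (Finset.mem_sdiff.2 ⟨h, hlR⟩)
        rw [wickCoeff, if_neg, mul_zero, mul_zero]
        exact fun h => hlS (h.1 (Finset.mem_insert_self _ _))
  · rw [wickCoeff, if_neg, Finset.sum_eq_zero, mul_zero, neg_zero]
    · intro l _
      split_ifs with hlR
      · rw [mul_zero]
      · rw [wickCoeff, if_neg, mul_zero, mul_zero]
        rintro ⟨h1, h2⟩
        refine hR ⟨(Finset.subset_insert l R).trans h1, ?_⟩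
        rw [Finset.card_insert_of_notMem hlR] at h2
        rw [Finset.card_insert_of_notMem hjS]
        unfold Nat.ModEq at h2 ⊢
        omega
    · rintro ⟨h1, h2⟩
      refine hR ⟨fun x hx => Finset.mem_of_mem_insert_of_ne (h1 hx) ?_, h2⟩
      rintro rfl
      exact hjR hx

/-- Wick's formula: the expansion of the antisymmetrized product `G ∧ X_{i_1} ∧ ⋯ ∧ X_{i_s}` in
the basis of monomials. -/
theorem repr_wedge_xs (hk : (2 : k) ≠ 0) (Q : Finset (Fin n)) (R : Finset (Fin (n + 1))) :
    (monBasis α β γ lam hk).repr (wedge α β γ lam hk (En.xs Q)) R =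
      wickCoeff γ lam (addZero Q) R := by
  induction Q using Finset.induction_on_max generalizing R with
  | empty =>
    have h0 : addZero (∅ : Finset (Fin n)) = {0} := rfl
    rw [En.xs_empty, wedge_one, ← mon_singleton, repr_mon, wickCoeff, h0]
    by_cases hR : R = {0}
    · subst hR
      rw [if_pos rfl, if_pos ⟨Finset.Subset.refl _, rfl⟩, posSum_self, Finset.sdiff_self,
        pfaffian_empty]
      simp
    · rw [if_neg (Ne.symm hR), if_neg]
      rintro ⟨h1, h2⟩
      rcases Finset.subset_singleton_iff.1 h1 with rfl | h
      · simp [Nat.ModEq] at h2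
      · exact hR h
  | insert j Q hQ ih =>
    have hj : ∀ i ∈ addZero Q, i < j.succ := by
      intro i
      refine Fin.cases (fun _ => Fin.succ_pos j) (fun i hi => ?_) i
      exact Fin.succ_lt_succ_iff.2 (hQ i (mem_addZero_succ.1 hi))
    have hjS : j.succ ∉ addZero Q := fun h => lt_irrefl _ (hj _ h)
    rw [En.xs_insert_of_forall_lt hQ, wedge_mul_x, addZero_insert, wedgeRight_eq_sub hk, map_sub,
      map_smul, map_sum, Finsupp.sub_apply, Finsupp.smul_apply, Finsupp.finsetSum_apply,
      repr_mul_gen_of_wickCoeff hk hj ih]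
    simp only [map_smul, Finsupp.smul_apply, repr_contract, ih, smul_eq_mul]
    -- If j occurs in R only the product u X_j contributes to the coefficient; otherwise only the
    -- contractions of u do.
    by_cases hjR : j.succ ∈ R
    · rw [if_pos hjR, Finset.sum_eq_zero, mul_zero, sub_zero]
      · conv_rhs => rw [← Finset.insert_erase hjR]
        rw [wickCoeff_insert_insert hj (Finset.notMem_erase _ _)]
      · intro l _
        have h0 : wickCoeff γ lam (addZero Q) (insert l R) = 0 :=
          if_neg fun h => hjS (h.1 (Finset.mem_insert_of_mem hjR))
        simp [h0]
    · rw [if_neg hjR, zero_sub, wickCoeff_insert (α := α) (β := β) hj hjR]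

end

end Cl

end

/-! ### The sums with parameters η and their supercommutators. -/

noncomputable section

namespace Cl

section
variable {k : Type*} [Field k] {n : ℕ} {α : k} {β γ : Fin n → k} {lam : Fin n → Fin n → k}

variable (α β γ lam) in
/-- The value at `x_Q` of the colinear map with parameters `η`. -/
def etaSum (η : Finset (Fin n) → k) (Q : Finset (Fin n)) : Cl α β γ lam :=
  ∑ R ∈ (addZero Q).powerset with R.card ≡ Q.card [MOD 2],
    ((-1) ^ posSum (diffZero Q R) Q * η (diffZero Q R)) • mon α β γ lam R

theorem repr_etaSum (hk : (2 : k) ≠ 0) (η : Finset (Fin n) → k) (Q : Finset (Fin n))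
    (R : Finset (Fin (n + 1))) : (monBasis α β γ lam hk).repr (etaSum α β γ lam η Q) R =
      if R ⊆ addZero Q ∧ R.card ≡ Q.card [MOD 2] then
        (-1) ^ posSum (diffZero Q R) Q * η (diffZero Q R) else 0 := by
  rw [etaSum, map_sum, Finsupp.finsetSum_apply]
  simp only [map_smul, Finsupp.smul_apply, repr_mon, smul_eq_mul, mul_ite, mul_one, mul_zero]
  rw [Finset.sum_ite_eq']
  simp

theorem etaSum_empty (η : Finset (Fin n) → k) : etaSum α β γ lam η ∅ = η ∅ • 1 := by
  have : (addZero (∅ : Finset (Fin n))).powerset.filter (fun R => R.card ≡ 0 [MOD 2]) = {∅} := by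
    ext R
    simp only [Finset.mem_filter, Finset.mem_powerset, Finset.mem_singleton]
    constructor
    · rintro ⟨h1, h2⟩
      rcases Finset.subset_singleton_iff.1 (h1 : R ⊆ {0}) with h | rfl
      · exact h
      · simp [Nat.ModEq] at h2
    · rintro rfl
      exact ⟨Finset.empty_subset _, rfl⟩
  rw [etaSum, Finset.card_empty, this, Finset.sum_singleton]
  simp [diffZero, posSum_self]

theorem parity_etaSum (hk : (2 : k) ≠ 0) (η : Finset (Fin n) → k) (Q : Finset (Fin n)) :
    parity (etaSum α β γ lam η Q) = (-1 : k) ^ Q.card • etaSum α β γ lam η Q := by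
  refine (monBasis α β γ lam hk).ext_elem fun R => ?_
  rw [repr_parity, map_smul, Finsupp.smul_apply, repr_etaSum, smul_eq_mul]
  split_ifs with h
  · congr 1
    rw [neg_one_pow_eq_pow_mod_two, h.2, ← neg_one_pow_eq_pow_mod_two]
  · simp

/-- The sums obey the contraction rule of the x_Q for every family η, so x_Q ↦ `etaSum` commutes
with D_1, …, D_n and colinearity does not constrain η. -/
theorem contract_etaSum (hk : (2 : k) ≠ 0) (η : Finset (Fin n) → k) (i : Fin n)
    (Q : Finset (Fin n)) : contract i.succ (etaSum α β γ lam η Q) =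
      if i ∈ Q then (-1 : k) ^ (Q.filter (i < ·)).card • etaSum α β γ lam η (Q.erase i)
      else 0 := by
  refine (monBasis α β γ lam hk).ext_elem fun R => ?_
  rw [repr_contract]
  by_cases hi : i ∈ Q
  · rw [if_pos hi, map_smul, Finsupp.smul_apply, smul_eq_mul, repr_etaSum, repr_etaSum]
    by_cases hR : i.succ ∈ R
    · rw [if_pos hR, if_neg, mul_zero]
      intro h
      exact Finset.notMem_erase i Q (mem_addZero_succ.1 (h.1 hR))
    · have hQ : insert i.succ (addZero (Q.erase i)) = addZero Q := by
        rw [← addZero_insert, Finset.insert_erase hi]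
      have hsub : insert i.succ R ⊆ addZero Q ↔ R ⊆ addZero (Q.erase i) := by
        rw [← hQ, Finset.insert_subset_insert_iff hR]
      have hcard : (insert i.succ R).card ≡ Q.card [MOD 2] ↔
          R.card ≡ (Q.erase i).card [MOD 2] := by
        rw [Finset.card_insert_of_notMem hR, ← Finset.card_erase_add_one hi]
        exact ⟨fun h => h.add_right_cancel' 1, fun h => h.add_right 1⟩
      have hdiff : diffZero Q (insert i.succ R) = diffZero (Q.erase i) R := by
        ext x
        simp only [diffZero, Finset.mem_filter, Finset.mem_insert, Finset.mem_erase, not_or,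
          Fin.succ_inj]
        tauto
      rw [if_neg hR, hdiff]
      by_cases h : R ⊆ addZero (Q.erase i) ∧ R.card ≡ (Q.erase i).card [MOD 2]
      · rw [if_pos h, if_pos ⟨hsub.2 h.1, hcard.2 h.2⟩]
        have h1 : posSum (diffZero (Q.erase i) R) Q = _ :=
          Finset.insert_erase hi ▸ posSum_insert_right (F := diffZero (Q.erase i) R)
            (P := Q.erase i) (Finset.filter_subset _ _) (Finset.notMem_erase i Q)
        -- The elements of Q above i split into those outside R, which account for the change of
        -- `posSum`, and those in R, which give the sign of the contraction.
        have h2 : (Q.filter (i < ·)).card = ((diffZero (Q.erase i) R).filter (i < ·)).card +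
            (R.filter (i.succ < ·)).card := by
          have h3 : R.filter (i.succ < ·) =
              (Q.filter fun q => i < q ∧ q.succ ∈ R).map (Fin.succEmb n) := by
            ext x
            refine Fin.cases (by simp) (fun x => ?_) x
            simp only [Finset.mem_filter, Finset.mem_map, Fin.coe_succEmb, Fin.succ_inj,
              exists_eq_right, Fin.succ_lt_succ_iff]
            constructor
            · rintro ⟨hx, hix⟩
              exact ⟨Finset.mem_of_mem_erase (mem_addZero_succ.1 (h.1 hx)), hix, hx⟩
            · rintro ⟨-, hix, hx⟩
              exact ⟨hx, hix⟩
          rw [h3, Finset.card_map, ← Finset.card_union_of_disjoint]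
          · congr 1
            ext x
            simp only [diffZero, Finset.mem_filter, Finset.mem_union, Finset.mem_erase]
            constructor
            · rintro ⟨hx, hix⟩
              by_cases hxR : x.succ ∈ R
              · exact .inr ⟨hx, hix, hxR⟩
              · exact .inl ⟨⟨⟨hix.ne', hx⟩, hxR⟩, hix⟩
            · rintro (⟨⟨⟨-, hx⟩, -⟩, hix⟩ | ⟨hx, hix, -⟩) <;> exact ⟨hx, hix⟩
          · rw [Finset.disjoint_left]
            intro x hx hx'
            simp only [diffZero, Finset.mem_filter] at hx hx'
            exact hx.1.2 hx'.2.2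
        rw [h1, h2, pow_add, pow_add]
        ring
      · rw [if_neg h, if_neg fun h' => h ⟨hsub.1 h'.1, hcard.1 h'.2⟩, mul_zero, mul_zero]
  · rw [if_neg hi, map_zero, Finsupp.zero_apply]
    split_ifs with hR
    · rfl
    · rw [repr_etaSum, if_neg, mul_zero]
      exact fun h => hi (mem_addZero_succ.1 (h.1 (Finset.mem_insert_self _ _)))

/-- The supercommutator `a ↦ a X_j - X_j σ(a)` with a generator. -/
def superComm (j : Fin (n + 1)) : Cl α β γ lam →ₗ[k] Cl α β γ lam :=
  ∑ l, polar α β γ lam j l • contract l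

theorem superComm_apply (j : Fin (n + 1)) (a : Cl α β γ lam) :
    superComm j a = a * gen α β γ lam j - gen α β γ lam j * parity a := by
  rw [mul_gen_sub, superComm, LinearMap.sum_apply]
  rfl

/-- κ_j is a linear combination of contractions, and contractions anticommute. -/
theorem contract_superComm (i j : Fin (n + 1)) (a : Cl α β γ lam) :
    contract i (superComm j a) = -superComm j (contract i a) := by
  simp only [superComm, LinearMap.sum_apply, LinearMap.smul_apply, map_sum, map_smul,
    ← Finset.sum_neg_distrib, ← smul_neg]
  exact Finset.sum_congr rfl fun l _ => by rw [contract_contract]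

/-- Up to sign, the square of κ_j is the commutator with X_j², which is a scalar. -/
theorem superComm_superComm (j : Fin (n + 1)) (a : Cl α β γ lam) :
    superComm j (superComm j a) = 0 := by
  have h := Algebra.commutes ((Fin.cons α β : Fin (n + 1) → k) j) a
  rw [← gen_sq (γ := γ) (lam := lam)] at h
  simp only [superComm_apply, map_sub, map_mul, parity_gen, parity_parity]
  rw [← sub_eq_zero] at h
  rw [← neg_eq_zero, ← h]
  noncomm_ring

theorem parity_superComm (j : Fin (n + 1)) (a : Cl α β γ lam) :
    parity (superComm j a) = -superComm j (parity a) := by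
  simp only [superComm_apply, map_sub, map_mul, parity_gen, parity_parity]
  noncomm_ring

theorem superComm_zero_gen_zero :
    superComm 0 (gen α β γ lam 0) = algebraMap k _ (2 * α) := by
  rw [superComm_apply, parity_gen, mul_neg, sub_neg_eq_add, gen_mul_gen_add, polar_zero_zero]

/-- The constant term of `κ(u)` for the supercommutator `κ` with `G`. -/
theorem repr_superComm_zero (hk : (2 : k) ≠ 0) (a : Cl α β γ lam) :
    (monBasis α β γ lam hk).repr (superComm 0 a) ∅ =
      2 * α * (monBasis α β γ lam hk).repr a {0} +
        ∑ i, γ i * (monBasis α β γ lam hk).repr a {i.succ} := by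
  rw [superComm, LinearMap.sum_apply, map_sum, Finsupp.finsetSum_apply, Fin.sum_univ_succ]
  simp [repr_contract, polar_zero_zero, polar_zero_succ]

/-- Only the monomials G and X_i with i ∈ T contribute to the constant term. When α ≠ 0, its
vanishing is the recursion for η_T multiplied by 2α. -/
theorem repr_superComm_etaSum (hk : (2 : k) ≠ 0) (η : Finset (Fin n) → k) {T : Finset (Fin n)}
    (hT : Odd T.card) :
    (monBasis α β γ lam hk).repr (superComm 0 (etaSum α β γ lam η T)) ∅ =
      2 * α * η T + ∑ i ∈ T, (-1) ^ posSum {i} T * η (T.erase i) * γ i := by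
  rw [repr_superComm_zero]
  congr 1
  · have hd : diffZero T {0} = T := Finset.filter_true_of_mem fun i _ => by simp
    rw [repr_etaSum, if_pos, hd, posSum_self, pow_zero, one_mul]
    refine ⟨Finset.singleton_subset_iff.2 (zero_mem_addZero T), ?_⟩
    rw [Finset.card_singleton, Nat.ModEq, Nat.odd_iff.1 hT]
  · rw [← Finset.sum_subset (Finset.subset_univ T)]
    · refine Finset.sum_congr rfl fun i hi => ?_
      have hd : diffZero T {i.succ} = T.erase i := by
        ext x
        simp [diffZero, and_comm]
      rw [repr_etaSum, if_pos, hd]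
      · have h1 : posSum (T.erase i) T = _ :=
          Finset.insert_erase hi ▸ posSum_insert_right (F := T.erase i)
            (P := T.erase i) (Finset.Subset.refl _) (Finset.notMem_erase i T)
        rw [posSum_self, zero_add] at h1
        -- The two numbers count the elements of T below and above i. Their sum is even for odd |T|,
        -- so the two signs agree.
        have h2 : posSum {i} T + posSum (T.erase i) T = T.card - 1 := by
          rw [h1, posSum_singleton hi, ← Finset.card_erase_of_mem hi,
            ← Finset.card_union_of_disjoint]
          · congr 1
            ext x
            simp only [Finset.mem_union, Finset.mem_filter, Finset.mem_erase]
            constructor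
            · rintro (⟨hx, h⟩ | ⟨h, -⟩)
              · exact ⟨h.ne, hx⟩
              · exact h
            · rintro ⟨hne, hx⟩
              rcases lt_or_gt_of_ne hne with h | h
              · exact .inl ⟨hx, h⟩
              · exact .inr ⟨⟨hne, hx⟩, h⟩
          · rw [Finset.disjoint_left]
            intro x hx hx'
            exact lt_asymm (Finset.mem_filter.1 hx).2 (Finset.mem_filter.1 hx').2
        have h3 : Even (posSum {i} T + posSum (T.erase i) T) := by
          rw [h2]
          exact Nat.Odd.sub_odd hT odd_one
        have h4 : (-1 : k) ^ posSum (T.erase i) T = (-1) ^ posSum {i} T := by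
          have h5 := h3.neg_one_pow (α := k)
          rw [pow_add] at h5
          rcases neg_one_pow_eq_or k (posSum {i} T) with h | h <;>
            rw [h] at h5 ⊢ <;> [linear_combination h5; linear_combination -h5]
        rw [h4]
        ring
      · refine ⟨Finset.singleton_subset_iff.2 (mem_addZero_succ.2 hi), ?_⟩
        rw [Finset.card_singleton, Nat.ModEq, Nat.odd_iff.1 hT]
    · intro i _ hi
      rw [repr_etaSum, if_neg, mul_zero]
      exact fun h => hi (mem_addZero_succ.1 (Finset.singleton_subset_iff.1 h.1))

theorem etaRecursion_iff (hk : (2 : k) ≠ 0) (hα : α ≠ 0) (η : Finset (Fin n) → k) :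
    EtaRecursion α γ η ↔ ∀ T : Finset (Fin n), Odd T.card →
      (monBasis α β γ lam hk).repr (superComm 0 (etaSum α β γ lam η T)) ∅ = 0 := by
  have key : ∀ T : Finset (Fin n), ∑ i ∈ T, (-1) ^ (posSum {i} T + 1) * η (T.erase i) *
      (γ i / (2 * α)) =
      -(2 * α)⁻¹ * ∑ i ∈ T, (-1) ^ posSum {i} T * η (T.erase i) * γ i := by
    intro T
    rw [Finset.mul_sum]
    refine Finset.sum_congr rfl fun i _ => ?_
    rw [pow_succ, div_eq_mul_inv]
    ring
  have h2α : 2 * α ≠ 0 := mul_ne_zero hk hα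
  constructor
  · intro h T hT
    rw [repr_superComm_etaSum hk η hT, h hα T hT, key, ← mul_assoc, mul_neg, mul_inv_cancel₀ h2α]
    ring
  · intro h _ T hT
    have := h T hT
    rw [repr_superComm_etaSum hk η hT] at this
    rw [key, eq_comm, neg_mul, neg_eq_iff_eq_neg, inv_mul_eq_iff_eq_mul₀ h2α]
    linear_combination this

/-- By induction on |T| the contractions of the supercommutator vanish, so it lies in the span of 1
and G; parity and `superComm_superComm` reduce its vanishing to the recursion. -/
theorem superComm_zero_etaSum (hk : (2 : k) ≠ 0) (hα : α ≠ 0) {η : Finset (Fin n) → k}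
    (h : EtaRecursion α γ η) (T : Finset (Fin n)) :
    superComm 0 (etaSum α β γ lam η T) = 0 := by
  rw [etaRecursion_iff (β := β) (lam := lam) hk hα] at h
  have two_mul_eq_zero : ∀ c : k, 2 * c = 0 → c = 0 :=
    fun c hc => (mul_eq_zero.1 hc).resolve_left hk
  induction hm : T.card generalizing T with
  | zero =>
    obtain rfl := Finset.card_eq_zero.1 hm
    rw [etaSum_empty, map_smul, superComm_apply]
    simp
  | succ m ih =>
    have hD : ∀ i : Fin n, contract i.succ (superComm 0 (etaSum α β γ lam η T)) = 0 := by
      intro i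
      rw [contract_superComm, contract_etaSum hk]
      split_ifs with hi
      · rw [map_smul, ih (T.erase i) (by rw [Finset.card_erase_of_mem hi, hm]; rfl)]
        simp
      · simp
    have hσ := parity_superComm 0 (etaSum α β γ lam η T)
    rw [parity_etaSum hk, map_smul, ← neg_smul] at hσ
    have hrep := eq_smul_add_smul_of_contract_eq_zero hk hD
    have h2 := superComm_superComm 0 (etaSum α β γ lam η T)
    have hpar : ∀ R, (monBasis α β γ lam hk).repr (parity (superComm 0 (etaSum α β γ lam η T))) R =
        -(-1) ^ T.card * (monBasis α β γ lam hk).repr (superComm 0 (etaSum α β γ lam η T)) R := by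
      intro R
      rw [hσ, map_smul, Finsupp.smul_apply, smul_eq_mul]
    have h0 := hpar ∅
    have h1 := hpar {0}
    rw [repr_parity] at h0 h1
    -- κ_0 reverses parity. For |T| even a multiple of G is left, and a second application of κ_0,
    -- with κ_0(G) = 2α ≠ 0, kills it. For |T| odd a scalar is left, which is 0 by the recursion.
    rcases Nat.even_or_odd T.card with hT | hT
    · rw [hT.neg_one_pow, Finset.card_empty] at h0
      have hz : (monBasis α β γ lam hk).repr (superComm 0 (etaSum α β γ lam η T)) ∅ = 0 := by
        refine two_mul_eq_zero _ ?_
        linear_combination h0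
      rw [hz, zero_smul, zero_add] at hrep
      rw [hrep, map_smul, superComm_zero_gen_zero, Algebra.smul_def, ← map_mul] at h2
      have h3 := (mul_eq_zero.1 (algebraMap_eq_zero hk h2)).resolve_right (mul_ne_zero hk hα)
      rw [hrep, h3, zero_smul]
    · have hz := h T hT
      rw [hT.neg_one_pow, Finset.card_singleton] at h1
      have hz' : (monBasis α β γ lam hk).repr (superComm 0 (etaSum α β γ lam η T)) {0} = 0 := by
        refine two_mul_eq_zero _ ?_
        linear_combination -h1
      rw [hrep, hz, hz']
      simp

end

end Cl

end

/-! ### The Casimir conditions on x_Q and g x_Q, and the classification. -/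

noncomputable section

namespace En

variable {k : Type*} [Field k] {n : ℕ}

theorem g_mul_xs_mul_g (Q : Finset (Fin n)) : (g * xs Q * g : En k n) = Cl.parity (xs Q) := by
  rw [mul_assoc, xs_mul_g, ← mul_assoc, g_sq, one_mul]

theorem g_mul_x_mul_g (i : Fin n) : (g * x i * g : En k n) = -x i := by
  rw [g_x, neg_mul, mul_assoc, g_sq, mul_one]

theorem g_mul_x_mul_xs_mul_g (i : Fin n) (Q : Finset (Fin n)) :
    (g * x i * xs Q * g : En k n) = -(xs Q * x i) := by
  rw [mul_assoc, xs_mul_g, ← mul_assoc, g_mul_x_mul_g, mul_x, neg_mul]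

theorem g_mul_g_mul_xs_mul_g (Q : Finset (Fin n)) :
    (g * (g * xs Q) * g : En k n) = -Cl.parity (g * xs Q) := by
  rw [← mul_assoc, g_sq, one_mul, xs_mul_g, map_mul, parity_g, neg_mul, neg_neg]

theorem g_mul_x_mul_g_mul_xs_mul_g (i : Fin n) (Q : Finset (Fin n)) :
    (g * x i * (g * xs Q) * g : En k n) = g * xs Q * x i := by
  rw [mul_assoc, g_mul_xs_mul_g, mul_assoc, ← mul_x, mul_assoc]

end En

namespace Cl

section
variable {k : Type*} [Field k] {n : ℕ} {α : k} {β γ : Fin n → k} {lam : Fin n → Fin n → k}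

/-- In case 1 the polar form vanishes, and with it every κ_j. In case 2 row j of the polar form is
γ_j/(2α) times row 0, so only κ_0 has to be considered. -/
theorem RtCondition.superComm_etaSum (hk : (2 : k) ≠ 0) (h : RtCondition α β γ lam)
    {η : Finset (Fin n) → k} (hη : EtaRecursion α γ η) (j : Fin (n + 1)) (T : Finset (Fin n)) :
    superComm j (etaSum α β γ lam η T) = 0 := by
  rcases h with ⟨h0, h1, h2, h3⟩ | ⟨h0, h1, h2⟩
  · have hpol : ∀ l, polar α β γ lam j l = 0 := by
      intro l
      have hlt : ∀ i l : Fin (n + 1), i < l → lamBar γ lam i l = 0 := by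
        intro i l hil
        obtain ⟨l, rfl⟩ := Fin.exists_succ_eq.2 (Fin.ne_zero_of_lt hil)
        revert hil
        refine Fin.cases (fun _ => ?_) (fun i hil => ?_) i
        · rw [lamBar_zero_succ, h2]
        · rw [lamBar_succ_succ, h3 i l (Fin.succ_lt_succ_iff.1 hil)]
      rcases lt_trichotomy j l with hjl | rfl | hjl
      · rw [polar_of_lt hjl, hlt _ _ hjl]
      · refine Fin.cases ?_ (fun i => ?_) j
        · rw [polar_zero_zero, h0, mul_zero]
        · rw [polar_succ_self, h1, mul_zero]
      · rw [polar_comm, polar_of_lt hjl, hlt _ _ hjl]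
    simp [superComm, hpol]
  · have hz := superComm_zero_etaSum (β := β) (lam := lam) hk h0 hη T
    refine Fin.cases hz (fun j => ?_) j
    have hpol : ∀ l, polar α β γ lam j.succ l = γ j / (2 * α) * polar α β γ lam 0 l := by
      refine Fin.cases ?_ fun l => ?_
      · rw [polar_succ_zero, polar_zero_zero]
        field_simp
      · rw [polar_zero_succ]
        rcases lt_trichotomy j l with hjl | rfl | hjl
        · rw [polar_succ_succ hjl, h2 _ _ hjl]
          ring
        · rw [polar_succ_self, h1, show (4 : k) = 2 * 2 by norm_num]
          field_simp
        · rw [polar_comm, polar_succ_succ hjl, h2 _ _ hjl]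
          ring
    have : superComm (α := α) (β := β) (γ := γ) (lam := lam) j.succ =
        (γ j / (2 * α)) • superComm 0 := by
      simp only [superComm, hpol, Finset.smul_sum, smul_smul]
    rw [this, LinearMap.smul_apply, hz, smul_zero]

/-- On x_Q the conditions at generators are the vanishing of the κ_j; on g x_Q they are the defining
property of the wedge and G ∧ G = 0. Thus only the values on x_Q use the condition on the scalars
and the recursion. -/
theorem isCasimirOne_of_formula (hk : (2 : k) ≠ 0) (h : RtCondition α β γ lam)
    {η : Finset (Fin n) → k} (hη : EtaRecursion α γ η) {μ : k} {b : En k n →ₗ[k] Cl α β γ lam}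
    (hone : b 1 = 1) (hx : ∀ Q, b (En.xs Q) = etaSum α β γ lam η Q)
    (hg : ∀ Q, b (En.g * En.xs Q) = μ • wedge α β γ lam hk (En.xs Q)) : IsCasimirOne b := by
  have hpar : ∀ m, b (parity m) = parity (b m) := by
    have : b ∘ₗ parity.toLinearMap = parity.toLinearMap ∘ₗ b := by
      refine En.ext_xs (fun Q => ?_) fun Q => ?_
      · simp only [LinearMap.comp_apply, AlgHom.toLinearMap_apply]
        rw [En.parity_xs, map_smul, hx, parity_etaSum hk]
      · simp only [LinearMap.comp_apply, AlgHom.toLinearMap_apply]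
        rw [map_mul, En.parity_g, En.parity_xs, neg_mul, mul_smul_comm, map_neg, map_smul, hg,
          map_smul, parity_wedge_xs, pow_succ, smul_comm]
        simp
    exact LinearMap.congr_fun this
  -- The elements x_Q x_i and D_i x_Q are combinations of monomials x_P, so the formula is needed on
  -- their whole span.
  have hgspan : ∀ m ∈ Submodule.span k (Set.range (En.xs : Finset (Fin n) → En k n)),
      b (En.g * m) = μ • wedge α β γ lam hk m := by
    intro m hm
    induction hm using Submodule.span_induction with
    | mem y hy =>
      obtain ⟨Q, rfl⟩ := hy
      exact hg Q
    | zero => simp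
    | add y z _ _ hy hz => simp only [mul_add, map_add, smul_add, hy, hz]
    | smul r y _ hy => rw [mul_smul_comm, map_smul, map_smul, hy, smul_comm]
  refine ⟨?_, fun i => ?_, hpar, fun i => ?_, hone⟩
  · have : LinearMap.mulLeft k (gen α β γ lam 0) ∘ₗ b ∘ₗ LinearMap.mulRight k En.g ∘ₗ
        LinearMap.mulLeft k En.g = LinearMap.mulRight k (gen α β γ lam 0) ∘ₗ b := by
      refine En.ext_xs (fun Q => ?_) fun Q => ?_
      · simp only [LinearMap.comp_apply, LinearMap.mulLeft_apply, LinearMap.mulRight_apply]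
        rw [En.g_mul_xs_mul_g, hpar, hx, eq_comm, ← sub_eq_zero, ← superComm_apply,
          h.superComm_etaSum hk hη]
      · simp only [LinearMap.comp_apply, LinearMap.mulLeft_apply, LinearMap.mulRight_apply]
        have hw := wedgeRight_zero_wedge_xs (α := α) (β := β) (γ := γ) (lam := lam) hk Q
        rw [wedgeRight_apply, smul_eq_zero_iff_right (inv_ne_zero hk)] at hw
        rw [En.g_mul_g_mul_xs_mul_g, map_neg, hpar, hg, map_smul, mul_neg, mul_smul_comm,
          smul_mul_assoc, ← smul_neg, eq_neg_of_add_eq_zero_left hw]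
    exact LinearMap.congr_fun this
  · have : LinearMap.mulLeft k (gen α β γ lam i.succ) ∘ₗ b ∘ₗ LinearMap.mulRight k En.g ∘ₗ
        LinearMap.mulLeft k En.g + b ∘ₗ LinearMap.mulRight k En.g ∘ₗ
        LinearMap.mulLeft k (En.g * En.x i) + b ∘ₗ LinearMap.mulRight k (En.x i) =
        LinearMap.mulRight k (gen α β γ lam i.succ) ∘ₗ b := by
      refine En.ext_xs (fun Q => ?_) fun Q => ?_
      · simp only [LinearMap.comp_apply, LinearMap.add_apply, LinearMap.mulLeft_apply,
          LinearMap.mulRight_apply]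
        rw [En.g_mul_x_mul_xs_mul_g, map_neg, neg_add_cancel_right, En.g_mul_xs_mul_g, hpar, hx,
          eq_comm, ← sub_eq_zero, ← superComm_apply, h.superComm_etaSum hk hη]
      · simp only [LinearMap.comp_apply, LinearMap.add_apply, LinearMap.mulLeft_apply,
          LinearMap.mulRight_apply]
        rw [En.g_mul_x_mul_g_mul_xs_mul_g, En.g_mul_g_mul_xs_mul_g, map_neg, hpar, mul_assoc,
          hgspan _ (En.xs_mul_x_mem Q i), hg, wedge_mul_x, add_assoc, ← two_smul k,
          smul_comm (2 : k), wedgeRight_apply, smul_smul (2 : k), mul_inv_cancel₀ hk, one_smul,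
          map_smul, mul_neg, mul_smul_comm, smul_mul_assoc, smul_add]
        abel
    exact LinearMap.congr_fun this
  · have : b ∘ₗ contract i.succ = contract i.succ ∘ₗ b := by
      refine En.ext_xs (fun Q => ?_) fun Q => ?_
      · simp only [LinearMap.comp_apply]
        rw [En.contract_xs, hx, contract_etaSum hk]
        split_ifs <;> simp [hx]
      · simp only [LinearMap.comp_apply]
        rw [En.contract_g_mul, hg, map_smul, contract_wedge_xs, hgspan]
        rw [En.contract_xs]
        split_ifs
        · exact Submodule.smul_mem _ _ (Submodule.subset_span ⟨_, rfl⟩)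
        · exact zero_mem _
    exact LinearMap.congr_fun this

theorem repr_eq_zero_of_parity (hk : (2 : k) ≠ 0) {a : Cl α β γ lam} {m : ℕ}
    (ha : parity a = (-1 : k) ^ m • a) {R : Finset (Fin (n + 1))} (hR : ¬R.card ≡ m [MOD 2]) :
    (monBasis α β γ lam hk).repr a R = 0 := by
  have h := repr_parity hk a R
  rw [ha, map_smul, Finsupp.smul_apply, smul_eq_mul, neg_one_pow_eq_pow_mod_two,
    neg_one_pow_eq_pow_mod_two (n := R.card)] at h
  unfold Nat.ModEq at hR
  refine (mul_eq_zero.1 (?_ : (2 : k) * _ = 0)).resolve_left hk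
  rcases Nat.mod_two_eq_zero_or_one m with h1 | h1 <;>
    rcases Nat.mod_two_eq_zero_or_one R.card with h2 | h2 <;> rw [h1, h2] at h <;>
    first
    | exact absurd (h2.trans h1.symm) hR
    | linear_combination h
    | linear_combination -h

namespace IsCasimirOne

variable {b : En k n →ₗ[k] Cl α β γ lam}

/-- Since g x_i x_Q g = -x_Q x_i, the two additional terms in the condition for X_i cancel, and g
x_Q g = σ(x_Q) turns what is left into a supercommutator. -/
theorem superComm_xs (hb : IsCasimirOne b) (j : Fin (n + 1)) (Q : Finset (Fin n)) :
    superComm j (b (En.xs Q)) = 0 := by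
  rw [superComm_apply, sub_eq_zero, ← hb.apply_parity]
  refine Fin.cases ?_ (fun i => ?_) j
  · rw [← hb.apply_g_mul_g, En.g_mul_xs_mul_g]
  · rw [← hb.apply_mul_x, En.g_mul_x_mul_xs_mul_g, map_neg, neg_add_cancel_right,
      En.g_mul_xs_mul_g]

theorem parity_xs (hb : IsCasimirOne b) (Q : Finset (Fin n)) :
    parity (b (En.xs Q)) = (-1 : k) ^ Q.card • b (En.xs Q) := by
  rw [← hb.apply_parity, En.parity_xs, map_smul]

theorem contract_xs (hb : IsCasimirOne b) (i : Fin n) (Q : Finset (Fin n)) :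
    contract i.succ (b (En.xs Q)) =
      if i ∈ Q then (-1 : k) ^ (Q.filter (i < ·)).card • b (En.xs (Q.erase i)) else 0 := by
  rw [← hb.apply_contract, En.contract_xs]
  split_ifs <;> simp

/-- The parameters `η`. -/
theorem exists_eq_etaSum (hk : (2 : k) ≠ 0) (hb : IsCasimirOne b) :
    ∃ η : Finset (Fin n) → k, ∀ Q, b (En.xs Q) = etaSum α β γ lam η Q := by
  -- Contractions leave b(x_Q) undetermined only in the span of 1 and G, and parity selects one of
  -- the two; its coefficient is the parameter η_Q.
  let η : Finset (Fin n) → k := fun Q => (monBasis α β γ lam hk).repr (b (En.xs Q))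
    (if Even Q.card then ∅ else {0})
  refine ⟨η, fun Q => ?_⟩
  induction hm : Q.card generalizing Q with
  | zero =>
    obtain rfl := Finset.card_eq_zero.1 hm
    have h1 := repr_mon (α := α) (β := β) (γ := γ) (lam := lam) hk ∅ ∅
    rw [mon_empty, if_pos rfl] at h1
    simp [etaSum_empty, η, hb.apply_one, h1]
  | succ m ih =>
    have hD : ∀ i : Fin n, contract i.succ (b (En.xs Q) - etaSum α β γ lam η Q) = 0 := by
      intro i
      rw [map_sub, hb.contract_xs, contract_etaSum hk]
      split_ifs with hi
      · rw [ih (Q.erase i) (by rw [Finset.card_erase_of_mem hi, hm]; rfl), sub_self]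
      · rw [sub_self]
    have hrep := eq_smul_add_smul_of_contract_eq_zero hk hD
    rw [← sub_eq_zero, hrep]
    have hp : parity (b (En.xs Q) - etaSum α β γ lam η Q) =
        (-1 : k) ^ Q.card • (b (En.xs Q) - etaSum α β γ lam η Q) := by
      rw [map_sub, hb.parity_xs, parity_etaSum hk, smul_sub]
    have hd : ∀ R : Finset (Fin (n + 1)), R ⊆ {0} → diffZero Q R = Q := by
      intro R hR
      refine Finset.filter_true_of_mem fun i _ hi => ?_
      exact Fin.succ_ne_zero i (Finset.mem_singleton.1 (hR hi))
    have hmain : ∀ R : Finset (Fin (n + 1)), R ⊆ {0} → R.card ≡ Q.card [MOD 2] →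
        R = (if Even Q.card then ∅ else {0}) →
        (monBasis α β γ lam hk).repr (b (En.xs Q) - etaSum α β γ lam η Q) R = 0 := by
      intro R hR hc he
      rw [map_sub, Finsupp.sub_apply, repr_etaSum, if_pos
        ⟨hR.trans (Finset.singleton_subset_iff.2 (zero_mem_addZero Q)), hc⟩, hd R hR, posSum_self,
        pow_zero, one_mul, sub_eq_zero]
      rw [he]
    have h0 : (monBasis α β γ lam hk).repr (b (En.xs Q) - etaSum α β γ lam η Q) ∅ = 0 := by
      by_cases hQ : Even Q.card
      · exact hmain ∅ (Finset.empty_subset _)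
          (by rw [Finset.card_empty, Nat.ModEq, Nat.even_iff.1 hQ]) (by rw [if_pos hQ])
      · refine repr_eq_zero_of_parity hk hp ?_
        rw [Finset.card_empty, Nat.ModEq]
        rw [Nat.even_iff] at hQ
        omega
    have h1 : (monBasis α β γ lam hk).repr (b (En.xs Q) - etaSum α β γ lam η Q) {0} = 0 := by
      by_cases hQ : Even Q.card
      · refine repr_eq_zero_of_parity hk hp ?_
        rw [Finset.card_singleton, Nat.ModEq]
        rw [Nat.even_iff] at hQ
        omega
      · refine hmain {0} (Finset.Subset.refl _) ?_ (by rw [if_neg hQ])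
        rw [Finset.card_singleton, Nat.ModEq]
        rw [Nat.even_iff] at hQ
        omega
    rw [h0, h1]
    simp

/-- The parameter `μ`. -/
theorem exists_eq_wedge (hk : (2 : k) ≠ 0) (hb : IsCasimirOne b) :
    ∃ μ : k, ∀ Q, b (En.g * En.xs Q) = μ • wedge α β γ lam hk (En.xs Q) := by
  have hD : ∀ i : Fin n, contract i.succ (b En.g) = 0 := by
    intro i
    rw [← hb.apply_contract, En.contract_g, map_zero]
  have hp : parity (b En.g) = (-1 : k) ^ 1 • b En.g := by
    rw [← hb.apply_parity, En.parity_g]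
    simp
  have hrep := eq_smul_add_smul_of_contract_eq_zero hk hD
  rw [repr_eq_zero_of_parity hk hp (by simp [Nat.ModEq]), zero_smul, zero_add] at hrep
  refine ⟨(monBasis α β γ lam hk).repr (b En.g) {0}, fun Q => ?_⟩
  induction Q using Finset.induction_on_max with
  | empty => rw [En.xs_empty, mul_one, wedge_one, ← hrep]
  | insert j Q hQ ih =>
    -- On g x_Q the two additional terms coincide instead of cancelling, so the condition determines
    -- 2 b(g x_Q x_j).
    have h := hb.apply_mul_x j (En.g * En.xs Q)
    rw [En.g_mul_g_mul_xs_mul_g, En.g_mul_x_mul_g_mul_xs_mul_g, map_neg, hb.apply_parity,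
      add_assoc, ← two_smul k] at h
    have h2 : b (En.g * En.xs Q * En.x j) = wedgeRight j.succ (b (En.g * En.xs Q)) := by
      rw [wedgeRight_apply, ← h, mul_neg, neg_add_cancel_comm, smul_smul, inv_mul_cancel₀ hk,
        one_smul]
    rw [En.xs_insert_of_forall_lt hQ, ← mul_assoc, h2, ih, map_smul, wedge_mul_x]

/-- Colinearity gives b(x_i) = X_i + d G. The supercommutator of this element with X_j is the scalar
p(j,i) + d p(j,0), which must vanish for all j. Eliminating d by the equation for j = 0 gives case 2
if α ≠ 0; if α = 0 that equation forces γ = 0 and the others force p = 0. -/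
theorem rtCondition (hk : (2 : k) ≠ 0) (hb : IsCasimirOne b) : RtCondition α β γ lam := by
  have key : ∀ i : Fin n, ∃ d : k, 2 * α * d + γ i = 0 ∧
      ∀ j : Fin n, γ j * d + polar α β γ lam j.succ i.succ = 0 := by
    intro i
    have hD : ∀ j : Fin n, contract j.succ (b (En.x i) - gen α β γ lam i.succ) = 0 := by
      intro j
      have hc : contract j.succ (En.x i : En k n) = if i.succ = j.succ then 1 else 0 :=
        contract_gen _ _
      rw [map_sub, ← hb.apply_contract, hc, contract_gen]
      split_ifs <;> simp [hb.apply_one]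
    have hp : parity (b (En.x i) - gen α β γ lam i.succ) =
        (-1 : k) ^ 1 • (b (En.x i) - gen α β γ lam i.succ) := by
      rw [map_sub, parity_gen, ← hb.apply_parity, En.parity_x, map_neg, pow_one, neg_one_smul]
      abel
    have hrep := eq_smul_add_smul_of_contract_eq_zero hk hD
    rw [repr_eq_zero_of_parity hk hp (by simp [Nat.ModEq]), zero_smul, zero_add,
      sub_eq_iff_eq_add] at hrep
    generalize (monBasis α β γ lam hk).repr _ {0} = d at hrep
    have hs : ∀ j, polar α β γ lam j 0 * d + polar α β γ lam j i.succ = 0 := by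
      intro j
      refine algebraMap_eq_zero (α := α) (β := β) (γ := γ) (lam := lam) hk ?_
      have h := hb.superComm_xs j {i}
      have hxs : (En.xs {i} : En k n) = En.x i := by simp [En.xs]
      rw [hxs, hrep, superComm, LinearMap.sum_apply] at h
      simp only [LinearMap.smul_apply, map_add, map_smul, contract_gen,
        Finset.sum_add_distrib, smul_ite, smul_zero, Finset.sum_ite_eq, Finset.mem_univ,
        if_true, smul_smul] at h
      rw [mul_comm, map_add, Algebra.algebraMap_eq_smul_one, Algebra.algebraMap_eq_smul_one, h]
    refine ⟨d, ?_, fun j => ?_⟩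
    · have := hs 0
      rwa [polar_zero_zero, polar_zero_succ] at this
    · have := hs j.succ
      rwa [polar_succ_zero] at this
  by_cases hα : α = 0
  · left
    have hγ : ∀ i, γ i = 0 := by
      intro i
      obtain ⟨d, h1, -⟩ := key i
      rw [hα] at h1
      linear_combination h1
    refine ⟨hα, fun i => ?_, hγ, fun i j hij => ?_⟩
    · obtain ⟨d, -, h2⟩ := key i
      have h3 := h2 i
      rw [hγ, zero_mul, zero_add, polar_succ_self] at h3
      exact (mul_eq_zero.1 h3).resolve_left hk
    · obtain ⟨d, -, h2⟩ := key j
      have h3 := h2 i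
      rwa [hγ, zero_mul, zero_add, polar_succ_succ hij] at h3
  · right
    have h2α : 2 * α ≠ 0 := mul_ne_zero hk hα
    refine ⟨hα, fun i => ?_, fun i j hij => ?_⟩
    · obtain ⟨d, h1, h2⟩ := key i
      have h3 := h2 i
      rw [polar_succ_self] at h3
      have h4 : (4 * α : k) ≠ 0 := by
        have : (4 * α : k) = 2 * (2 * α) := by ring
        rw [this]
        exact mul_ne_zero hk h2α
      rw [eq_div_iff h4]
      linear_combination 2 * α * h3 - γ i * h1
    · obtain ⟨d, h1, h2⟩ := key j
      have h3 := h2 i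
      rw [polar_succ_succ hij] at h3
      rw [eq_div_iff h2α]
      linear_combination 2 * α * h3 - γ i * h1

end IsCasimirOne

/-- As |R| and the cardinality of Q ∪ {0} have the same parity, the difference of their halves
rounded down is half their difference; this matches the two normalizations by powers of 2. -/
theorem wedge_xs_eq (hk : (2 : k) ≠ 0) (μ : k) (Q : Finset (Fin n)) :
    μ • wedge α β γ lam hk (En.xs Q) = (μ / 2 ^ ((addZero Q).card / 2)) •
      ∑ R ∈ (addZero Q).powerset with R.card ≡ (addZero Q).card [MOD 2],
        ((-1) ^ (posSum R (addZero Q) + ((addZero Q).card - R.card) / 2) * 2 ^ (R.card / 2) *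
          ∑ P : PerfectMatching (addZero Q \ R), (P.sgn : k) * P.weight γ lam) •
            mon α β γ lam R := by
  refine (monBasis α β γ lam hk).ext_elem fun R => ?_
  rw [map_smul, map_smul, Finsupp.smul_apply, Finsupp.smul_apply, repr_wedge_xs, map_sum,
    Finsupp.finsetSum_apply]
  simp only [map_smul, Finsupp.smul_apply, repr_mon, smul_eq_mul, mul_ite, mul_one, mul_zero]
  rw [Finset.sum_ite_eq', wickCoeff]
  simp only [Finset.mem_filter, Finset.mem_powerset]
  split_ifs with h
  · have hle := Finset.card_le_card h.1
    have hdiv : (addZero Q).card / 2 = R.card / 2 + ((addZero Q).card - R.card) / 2 := by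
      have := h.2
      unfold Nat.ModEq at this
      omega
    rw [hdiv, pow_add _ (R.card / 2), ← pfaffian, inv_pow]
    have h2 : (2 : k) ^ (R.card / 2) ≠ 0 := pow_ne_zero _ hk
    field_simp
  · simp

theorem casimirFormula_iff (hk : (2 : k) ≠ 0) (μ : k) (η : Finset (Fin n) → k)
    (BA : En k n ⊗[k] En k n →ₗ[k] Cl α β γ lam) :
    CasimirFormula α β γ lam μ η BA ↔
      (∀ x y, BA (x ⊗ₜ[k] y) = BA (1 ⊗ₜ[k] (HopfAlgebra.antipode k x * y))) ∧
        BA (1 ⊗ₜ[k] 1) = 1 ∧ (∀ Q, BA (1 ⊗ₜ[k] En.xs Q) = etaSum α β γ lam η Q) ∧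
        ∀ Q, BA (1 ⊗ₜ[k] (En.g * En.xs Q)) = μ • wedge α β γ lam hk (En.xs Q) := by
  constructor
  · rintro ⟨h1, h2, h3, h4⟩
    refine ⟨fun x y => ?_, h2, h3, fun Q => by rw [h4, wedge_xs_eq]⟩
    -- The identity known on pairs of basis elements is extended linearly in the second argument,
    -- and in `h6` in the first.
    have h5 : ∀ j Q, BA ∘ₗ (TensorProduct.mk k _ _ (En.g ^ ((j : Fin 2) : ℕ) * En.xs Q)) =
        BA ∘ₗ TensorProduct.mk k _ _ 1 ∘ₗ
          LinearMap.mulLeft k (HopfAlgebra.antipode k (En.g ^ (j : ℕ) * En.xs Q)) := by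
      intro j Q
      refine En.ext_xs (fun P => ?_) fun P => ?_
      · simpa using h1 j 0 Q P
      · simpa using h1 j 1 Q P
    have h6 : BA ∘ₗ (TensorProduct.mk k _ _).flip y =
        BA ∘ₗ TensorProduct.mk k _ _ 1 ∘ₗ LinearMap.mulRight k y ∘ₗ HopfAlgebra.antipode k := by
      refine En.ext_xs (fun Q => ?_) fun Q => ?_
      · simpa using LinearMap.congr_fun (h5 0 Q) y
      · simpa using LinearMap.congr_fun (h5 1 Q) y
    exact LinearMap.congr_fun h6 x
  · rintro ⟨h1, h2, h3, h4⟩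
    exact ⟨fun j l P Q => h1 _ _, h2, h3, fun Q => by rw [h4, wedge_xs_eq]⟩

theorem isRtCasimir_iff_formula (hk : (2 : k) ≠ 0)
    (BA : En k n ⊗[k] En k n →ₗ[k] Cl α β γ lam) :
    (comoduleAlgebra α β γ lam).IsRtCasimir BA ↔ RtCondition α β γ lam ∧
      ∃ (μ : k) (η : Finset (Fin n) → k), EtaRecursion α γ η ∧
        CasimirFormula α β γ lam μ η BA := by
  rw [isRtCasimir_iff hk]
  constructor
  · rintro ⟨hS, hb⟩
    obtain ⟨η, hη⟩ := hb.exists_eq_etaSum hk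
    obtain ⟨μ, hμ⟩ := hb.exists_eq_wedge hk
    refine ⟨hb.rtCondition hk, μ, η, fun hα => ?_,
      (casimirFormula_iff hk μ η BA).2 ⟨hS, hb.apply_one, hη, hμ⟩⟩
    refine (etaRecursion_iff (β := β) (lam := lam) hk hα η).2 (fun T _ => ?_) hα
    rw [← hη, hb.superComm_xs]
    simp
  · rintro ⟨hrt, μ, η, hη, hf⟩
    obtain ⟨h1, h2, h3, h4⟩ := (casimirFormula_iff hk μ η BA).1 hf
    exact ⟨h1, isCasimirOne_of_formula hk hrt hη h2 h3 h4⟩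

/-- The formulas prescribe b freely on the basis x_Q, g x_Q of E(n), and B^A(x ⊗ y) = b(S(x) y) does
the rest. The only overlap, at 1 = x_∅, is consistent because η_∅ = 1. -/
theorem existsUnique_casimirFormula (hk : (2 : k) ≠ 0) (μ : k) {η : Finset (Fin n) → k}
    (hη : η ∅ = 1) : ∃! BA : En k n ⊗[k] En k n →ₗ[k] Cl α β γ lam,
      CasimirFormula α β γ lam μ η BA := by
  let toFin : Finset (Fin (n + 1)) → Finset (Fin n) := fun S =>
    Finset.univ.filter fun i => i.succ ∈ S
  have htx : ∀ Q : Finset (Fin n), toFin (Q.map (Fin.succEmb n)) = Q := by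
    intro Q
    ext i
    simp [toFin]
  have htg : ∀ Q : Finset (Fin n), toFin (addZero Q) = Q := by
    intro Q
    ext i
    simp [toFin, mem_addZero_succ]
  let b : En k n →ₗ[k] Cl α β γ lam := (monBasis (1 : k) 0 0 0 hk).constr k fun S =>
    if 0 ∈ S then μ • wedge α β γ lam hk (En.xs (toFin S)) else etaSum α β γ lam η (toFin S)
  have hb : ∀ S, b (mon 1 0 0 0 S) = if 0 ∈ S then μ • wedge α β γ lam hk (En.xs (toFin S)) else
      etaSum α β γ lam η (toFin S) := by
    intro S
    rw [← monBasis_apply hk]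
    exact (monBasis (1 : k) 0 0 0 hk).constr_basis k _ S
  have hx : ∀ Q, b (En.xs Q) = etaSum α β γ lam η Q := by
    intro Q
    conv_lhs => rw [En.xs_eq_mon, hb, if_neg (zero_notMem_map_succEmb Q), htx]
  have hg : ∀ Q, b (En.g * En.xs Q) = μ • wedge α β γ lam hk (En.xs Q) := by
    intro Q
    conv_lhs => rw [En.g_mul_xs, hb, if_pos (zero_mem_addZero Q), htg]
  refine ⟨b ∘ₗ LinearMap.mul' k _ ∘ₗ (HopfAlgebra.antipode k).rTensor _,
    (casimirFormula_iff hk μ η _).2 ⟨fun x y => ?_, ?_, fun Q => ?_, fun Q => ?_⟩, ?_⟩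
  · simp
  · have := hx ∅
    rw [En.xs_empty, etaSum_empty, hη, one_smul] at this
    simpa [antipode_one'] using this
  · simpa [antipode_one'] using hx Q
  · simpa [antipode_one'] using hg Q
  · intro BA hBA
    obtain ⟨h1, -, h3, h4⟩ := (casimirFormula_iff hk μ η BA).1 hBA
    have h5 : BA ∘ₗ TensorProduct.mk k _ _ 1 = b :=
      En.ext_xs (fun Q => (h3 Q).trans (hx Q).symm) fun Q => (h4 Q).trans (hg Q).symm
    refine TensorProduct.ext' fun x y => ?_
    rw [h1, ← h5]
    simp

/-- For |T| odd the recursion involves only sets of even size, so values on even sets can be chosen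
freely and no circularity arises. -/
theorem exists_etaRecursion (α : k) (γ : Fin n → k) :
    ∃ η : Finset (Fin n) → k, η ∅ = 1 ∧ EtaRecursion α γ η := by
  let η₀ : Finset (Fin n) → k := fun S => if S = ∅ then 1 else 0
  refine ⟨fun T => if Odd T.card then
    ∑ i ∈ T, (-1) ^ (posSum {i} T + 1) * η₀ (T.erase i) * (γ i / (2 * α)) else η₀ T,
    by simp [η₀], fun _ T hT => ?_⟩
  refine (if_pos hT).trans (Finset.sum_congr rfl fun i hi => ?_)
  have hodd : ¬Odd (T.erase i).card := by
    rw [Finset.card_erase_of_mem hi, Nat.not_odd_iff_even]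
    exact Nat.Odd.sub_odd hT odd_one
  simp only [if_neg hodd]

end

end Cl

end

theorem theorem4 {k : Type*} [Field k] (hk : ringChar k ≠ 2) (n : ℕ) (α : k) (β γ : Fin n → k)
    (lam : Fin n → Fin n → k) :
    ((Cl.comoduleAlgebra α β γ lam).IsRtSeparable ↔ Cl.RtCondition α β γ lam) ∧
    (∀ BA : En k n ⊗[k] En k n →ₗ[k] Cl α β γ lam,
      (Cl.comoduleAlgebra α β γ lam).IsRtCasimir BA ↔
        Cl.RtCondition α β γ lam ∧ ∃ (μ : k) (η : Finset (Fin n) → k),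
          Cl.EtaRecursion α γ η ∧ Cl.CasimirFormula α β γ lam μ η BA) ∧
    (Cl.RtCondition α β γ lam → ∀ (μ : k) (η : Finset (Fin n) → k), η ∅ = 1 →
      Cl.EtaRecursion α γ η →
        ∃! BA : En k n ⊗[k] En k n →ₗ[k] Cl α β γ lam,
          (Cl.comoduleAlgebra α β γ lam).IsRtCasimir BA ∧
            Cl.CasimirFormula α β γ lam μ η BA) := by
  have h2 : (2 : k) ≠ 0 := Ring.two_ne_zero hk
  have hexists : Cl.RtCondition α β γ lam → ∀ (μ : k) (η : Finset (Fin n) → k), η ∅ = 1 →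
      Cl.EtaRecursion α γ η →
        ∃! BA : En k n ⊗[k] En k n →ₗ[k] Cl α β γ lam,
          (Cl.comoduleAlgebra α β γ lam).IsRtCasimir BA ∧
            Cl.CasimirFormula α β γ lam μ η BA := by
    intro hrt μ η hη hrec
    obtain ⟨BA, hBA, huniq⟩ := Cl.existsUnique_casimirFormula (α := α) (β := β) (γ := γ)
      (lam := lam) h2 μ hη
    exact ⟨BA, ⟨(Cl.isRtCasimir_iff_formula h2 BA).2 ⟨hrt, μ, η, hrec, hBA⟩, hBA⟩,
      fun B hB => huniq B hB.2⟩
  refine ⟨⟨?_, fun hrt => ?_⟩, Cl.isRtCasimir_iff_formula h2, hexists⟩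
  · rintro ⟨BA, hBA⟩
    exact ((Cl.isRtCasimir_iff_formula h2 BA).1 hBA).1
  -- Any μ would do for separability; 0 is taken.
  · obtain ⟨η, hη, hrec⟩ := Cl.exists_etaRecursion α γ
    obtain ⟨BA, hBA, -⟩ := hexists hrt 0 η hη hrec
    exact ⟨BA, hBA.1⟩
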